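/- **Theorem (Coherence for (op)lax shadow functors).** Every black-tie diagram of morphisms for a lax shadow functor commutes, and likewise for an oplax shadow functor. Moreover, for every graph $G$ and every object $W$ of the shadow category $\mathcal{F}_G$ of the free lax shadow functor on $G$ whose list of edges $X_1,\dots,X_n$ is aperiodic, the supporting functor from the connected component of $W$ in $\mathcal{F}_G$ to the comma category $(\underline n\downarrow\mathbf\Lambda')$ is an equivalence of categories. Here the terms are as follows. *Shadows and lax shadow functors.* A shadow on a bicategory $\mathscr B$ with values in a category $\mathscr B_{Sh}$ consists of functors $\langle-\rangle\colon \mathscr B(a,a)\to\mathscr B_{Sh}$ and natural isomorphisms $\theta\colon\langle f\odot g\rangle\cong\langle g\odot f\rangle$ for $f\colon a\to b$, $g\colon b\to a$, satisfying the hexagon with the associators and the two unit triangles. A lax shadow functor $(F,H)\colon(\mathscr C,\mathscr C_{Sh})\to(\mathscr D,\mathscr D_{Sh})$ consists of a lax functor $F\colon\mathscr C\to\mathscr D$ with constraints $i\colon 1\to F(1)$ and $m\colon F(f)\odot F(g)\to F(f\odot g)$, a functor $H\colon\mathscr C_{Sh}\to\mathscr D_{Sh}$, and natural maps $s\colon\langle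 F(f)\rangle\to H\langle f\rangle$ such that $s\circ\langle m\rangle\circ\theta=H(\theta)\circ s\circ\langle m\rangle$. In an oplax shadow functor $i$, $m$ and $s$ point the other way. *The category $\mathbf\Lambda'$.* The bi-augmented cyclic category $\mathbf\Lambda'$ has objects $\underline n$ ($n\ge 0$) and $*$; it is generated by cofaces $d^i\colon\underline n\to\underline{n+1}$ ($1\le i\le n+1$), codegeneracies $s^i\colon\underline{n+1}\to\underline n$ ($1\le i\le n$), cycles to the left $\tau_n\colon\underline n\to\underline n$ ($n\ge1$) and $t\colon\underline1\to *$, subject to the (augmented) cosimplicial identities and the relations $\tau_{n+1}d^{i+1}=d^i\tau_n$ ($1\le i\le n$), $\tau_{n+1}d^1=d^{n+1}$, $\tau_ns^{i+1}=s^i\tau_{n+1}$ ($1\le i<n$), $\tau_ns^1=s^n\tau_{n+1}^2$, $\tau_n^n=\mathrm{id}$ and $t\,s^1=t\,s^1\,\tau_2$. *The free lax shadow functor.* For a graph $G$, let $\mathscr B_G$ be the free bicategory on $G$ with its free shadow. The free lax shadow functor on $G$ is obtained from $\mathscr B_G$ by freely adjoining a lax functor $F$ to a bicategory with shadow, a functor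 $H$ on shadow categories, and shadow commutation maps $s$. Its shadow category $\mathcal F_G$ has as objects the formal words $\langle w\rangle$, where $w$ is a closed formal $\odot$-product of units and symbols $F(V)$ with $V$ a 1-cell of $\mathscr B_G$, and the objects $H\langle V\rangle$ with $V$ a closed 1-cell of $\mathscr B_G$. A list of edges is *aperiodic* if no nontrivial rotation of it returns the same list. *Supporting maps and underlying permutations.* The supporting map $U(\varphi)\in\mathbf\Lambda'$ of a morphism $\varphi$ of $\mathcal F_G$ is given by the functor that sends $\langle w\rangle$ to $\underline k$, where $k$ is the number of symbols $F(-)$ in $w$, and $H\langle V\rangle$ to $*$. On generators, $i$ acts as a coface, $m$ as a codegeneracy, a rotator $\theta\colon\langle w\odot w'\rangle\to\langle w'\odot w\rangle$ outside the symbols $F(-)$ and $H$ as the power of $\tau$ moving the symbols of $w$ past those of $w'$, $s$ as $t$, and all other generators as identities. The underlying permutation $P(\varphi)$ is the cyclic permutation of the positions of the edges $X_1,\dots,X_n$: every rotator, inside or outside $H$, acts by the corresponding cyclic permutation of edges, and all other generators act trivially. If the edges of $W$ are aperiodic, every object $W'$ of the component of $W$ has the list of edges of $W$ up to a unique rotation;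 for $n\geq 0$ edges, the supporting functor sends $W'$ to the resulting map from $\underline n$ that carries each edge of $W$ to the symbol $F(-)$ of $W'$ containing it (or to $*$), and sends $\varphi$ to $U(\varphi)$. *Diagrams.* Let $(F,H)\colon(\mathscr C,\mathscr C_{Sh})\to(\mathscr D,\mathscr D_{Sh})$ be a lax shadow functor and let $|\mathscr C|$ be the graph of 0- and 1-cells of $\mathscr C$. A formal diagram is a diagram in $\mathscr D_{Sh}$ that lifts along the evaluation functor $\mathcal F_{|\mathscr C|}\to\mathscr D_{Sh}$. A formal diagram is *black-tie* if it has a lift in which any two parallel composites have the same supporting map and the same underlying permutation. For oplax shadow functors the same definitions are used with 2-cells, the morphisms of shadow categories and $\mathbf\Lambda'$ reversed, so that the free shadow category is $(\mathcal F_{|\mathscr C|})^{op}$. -/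

import Mathlib

open CategoryTheory

set_option linter.unusedSimpArgs false
set_option linter.unusedVariables false

universe w₁ w₂ v₁ v₂ v₃ v₄ v₅ u₁ u₂ u₃ u₄ u₅

namespace LaxShadow

/-! ### The bi-augmented cyclic category -/

/-- The objects `0, 1, 2, …` and `*` of the bi-augmented cyclic category. -/
inductive LObj : Type
  | fin (n : ℕ) : LObj
  | star : LObj

/-- The generators: cofaces `d^i`, codegeneracies `s^i`, cycles to the left `τ`, and `t : 1 ⟶ *`
(superscripts start at `1`). -/
inductive LGen : LObj → LObj → Type
  | d (n i : ℕ) (h₁ : 1 ≤ i) (h₂ : i ≤ n + 1) : LGen (.fin n) (.fin (n + 1))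
  | s (n i : ℕ) (h₁ : 1 ≤ i) (h₂ : i ≤ n) : LGen (.fin (n + 1)) (.fin n)
  | τ (n : ℕ) (h : 1 ≤ n) : LGen (.fin n) (.fin n)
  | t : LGen (.fin 1) .star

instance : Quiver LObj := ⟨LGen⟩

namespace LGen

/-- The one-letter word on a generator. -/
def w {x y : LObj} (g : LGen x y) : (Paths.of LObj).obj x ⟶ (Paths.of LObj).obj y :=
  (Paths.of LObj).map g

/-- The word `τ^k`. -/
def τpow (n : ℕ) (h : 1 ≤ n) :
    ℕ → ((Paths.of LObj).obj (.fin n) ⟶ (Paths.of LObj).obj (.fin n))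
  | 0 => 𝟙 _
  | k + 1 => (τ n h).w ≫ τpow n h k

end LGen

open LGen in
/-- The relations between words in the generators. Words are written in diagrammatic order, so
that `(d n j).w ≫ (d (n + 1) i).w` is the composite `d^i d^j`. -/
inductive LRel : HomRel (Paths LObj)
  | face_face (n i j : ℕ) (h₁ : 1 ≤ i) (h₂ : i ≤ j) (h₃ : j ≤ n + 1) :
      LRel ((d n j (by omega) h₃).w ≫ (d (n + 1) i h₁ (by omega)).w)
        ((d n i h₁ (by omega)).w ≫ (d (n + 1) (j + 1) (by omega) (by omega)).w)
  | deg_deg (n i j : ℕ) (h₁ : 1 ≤ i) (h₂ : i ≤ j) (h₃ : j ≤ n) :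
      LRel ((s (n + 1) i h₁ (by omega)).w ≫ (s n j (by omega) h₃).w)
        ((s (n + 1) (j + 1) (by omega) (by omega)).w ≫ (s n i h₁ (by omega)).w)
  | deg_face_lt (n i j : ℕ) (h₁ : 1 ≤ i) (h₂ : i ≤ j) (h₃ : j ≤ n) :
      LRel ((d (n + 1) i h₁ (by omega)).w ≫ (s (n + 1) (j + 1) (by omega) (by omega)).w)
        ((s n j (by omega) h₃).w ≫ (d n i h₁ (by omega)).w)
  | deg_face_eq (n j : ℕ) (h₁ : 1 ≤ j) (h₂ : j ≤ n) :
      LRel ((d n j h₁ (by omega)).w ≫ (s n j h₁ h₂).w) (𝟙 _)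
  | deg_face_succ (n j : ℕ) (h₁ : 1 ≤ j) (h₂ : j ≤ n) :
      LRel ((d n (j + 1) (by omega) (by omega)).w ≫ (s n j h₁ h₂).w) (𝟙 _)
  | deg_face_gt (n i j : ℕ) (h₁ : 1 ≤ j) (h₂ : j < i) (h₃ : i ≤ n + 1) :
      LRel ((d (n + 1) (i + 1) (by omega) (by omega)).w ≫ (s (n + 1) j h₁ (by omega)).w)
        ((s n j h₁ (by omega)).w ≫ (d n i (by omega) h₃).w)
  | cycle_face (n i : ℕ) (h₁ : 1 ≤ i) (h₂ : i ≤ n) :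
      LRel ((d n (i + 1) (by omega) (by omega)).w ≫ (τ (n + 1) (by omega)).w)
        ((τ n (by omega)).w ≫ (d n i h₁ (by omega)).w)
  | cycle_face_one (n : ℕ) :
      LRel ((d n 1 le_rfl (by omega)).w ≫ (τ (n + 1) (by omega)).w)
        ((d n (n + 1) (by omega) le_rfl).w)
  | cycle_deg (n i : ℕ) (h₁ : 1 ≤ i) (h₂ : i + 1 ≤ n) :
      LRel ((s n (i + 1) (by omega) h₂).w ≫ (τ n (by omega)).w)
        ((τ (n + 1) (by omega)).w ≫ (s n i h₁ (by omega)).w)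
  | cycle_deg_one (n : ℕ) (h : 1 ≤ n) :
      LRel ((s n 1 le_rfl h).w ≫ (τ n h).w)
        ((τ (n + 1) (by omega)).w ≫ (τ (n + 1) (by omega)).w ≫ (s n n h le_rfl).w)
  | torsion (n : ℕ) (h : 1 ≤ n) : LRel (τpow n h n) (𝟙 _)
  | terminal :
      LRel ((s 1 1 le_rfl le_rfl).w ≫ t.w)
        ((τ 2 (by omega)).w ≫ (s 1 1 le_rfl le_rfl).w ≫ t.w)

/-- The bi-augmented cyclic category `Λ'`. -/
abbrev Lam : Type := CategoryTheory.Quotient LRel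

namespace Lam

/-- The object `n` of `Λ'`. -/
abbrev fin (n : ℕ) : Lam := (Quotient.functor LRel).obj ((Paths.of LObj).obj (.fin n))

/-- The object `*` of `Λ'`. -/
abbrev star : Lam := (Quotient.functor LRel).obj ((Paths.of LObj).obj .star)

/-- A generator as a morphism of `Λ'`. -/
def gen {x y : LObj} (g : LGen x y) :
    (Quotient.functor LRel).obj ((Paths.of LObj).obj x) ⟶
      (Quotient.functor LRel).obj ((Paths.of LObj).obj y) :=
  (Quotient.functor LRel).map g.w

/-- `d^i`, with its target known up to a propositional equality. -/
def d (N M i : ℕ) (hM : M = N + 1) (h₁ : 1 ≤ i) (h₂ : i ≤ N + 1) : fin N ⟶ fin M :=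
  gen (.d N i h₁ h₂) ≫ eqToHom (by rw [hM])

/-- `s^i`, with its source known up to a propositional equality. -/
def s (N M i : ℕ) (hN : N = M + 1) (h₁ : 1 ≤ i) (h₂ : i ≤ M) : fin N ⟶ fin M :=
  eqToHom (by rw [hN]) ≫ gen (.s M i h₁ h₂)

/-- The cycle to the left on `n`; the identity if `n = 0`. -/
def cyc (n : ℕ) : fin n ⟶ fin n := if h : 1 ≤ n then gen (.τ n h) else 𝟙 _

/-- The `k`-th power of the cycle to the left. -/
def rot (n : ℕ) : ℕ → (fin n ⟶ fin n)
  | 0 => 𝟙 _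
  | k + 1 => cyc n ≫ rot n k

/-- The map `t : 1 ⟶ *`. -/
def t : fin 1 ⟶ star := gen .t

theorem d_d (N M K i j : ℕ) (hM : M = N + 1) (hK : K = M + 1) (h₁ : 1 ≤ i) (h₂ : i ≤ j)
    (h₃ : j ≤ N + 1) :
    d N M j hM (by omega) h₃ ≫ d M K i hK h₁ (by omega) =
      d N M i hM h₁ (by omega) ≫ d M K (j + 1) hK (by omega) (by omega) := by
  subst hM hK
  simpa [d, gen] using CategoryTheory.Quotient.sound LRel (LRel.face_face N i j h₁ h₂ h₃)

theorem s_s (N M K i j : ℕ) (hN : N = M + 1) (hM : M = K + 1) (h₁ : 1 ≤ i) (h₂ : i ≤ j)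
    (h₃ : j ≤ K) :
    s N M i hN h₁ (by omega) ≫ s M K j hM (by omega) h₃ =
      s N M (j + 1) hN (by omega) (by omega) ≫ s M K i hM h₁ (by omega) := by
  subst hM; subst hN
  simpa [s, gen] using CategoryTheory.Quotient.sound LRel (LRel.deg_deg K i j h₁ h₂ h₃)

theorem d_s_lt (N M K L i j : ℕ) (hM : M = N + 1) (hK : M = K + 1) (hL : N = L + 1)
    (hL' : K = L + 1) (h₁ : 1 ≤ i) (h₂ : i ≤ j) (h₃ : j ≤ L) :
    d N M i hM h₁ (by omega) ≫ s M K (j + 1) hK (by omega) (by omega) =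
      s N L j hL (by omega) h₃ ≫ d L K i hL' h₁ (by omega) := by
  subst hL'; subst hL; subst hK
  simpa [d, s, gen] using CategoryTheory.Quotient.sound LRel (LRel.deg_face_lt L i j h₁ h₂ h₃)

theorem d_s_gt (N M K L i j : ℕ) (hM : M = N + 1) (hK : M = K + 1) (hL : N = L + 1)
    (hL' : K = L + 1) (h₁ : 1 ≤ j) (h₂ : j < i) (h₃ : i ≤ L + 1) :
    d N M (i + 1) hM (by omega) (by omega) ≫ s M K j hK h₁ (by omega) =
      s N L j hL h₁ (by omega) ≫ d L K i hL' (by omega) h₃ := by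
  subst hL'; subst hL; subst hK
  simpa [d, s, gen] using CategoryTheory.Quotient.sound LRel (LRel.deg_face_gt L i j h₁ h₂ h₃)

theorem d_s_eq (N M j : ℕ) (hM : M = N + 1) (h₁ : 1 ≤ j) (h₂ : j ≤ N) :
    d N M j hM h₁ (by omega) ≫ s M N j hM h₁ h₂ = 𝟙 _ := by
  subst hM
  simpa [d, s, gen] using CategoryTheory.Quotient.sound LRel (LRel.deg_face_eq N j h₁ h₂)

theorem d_s_succ (N M j : ℕ) (hM : M = N + 1) (h₁ : 1 ≤ j) (h₂ : j ≤ N) :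
    d N M (j + 1) hM (by omega) (by omega) ≫ s M N j hM h₁ h₂ = 𝟙 _ := by
  subst hM
  simpa [d, s, gen] using CategoryTheory.Quotient.sound LRel (LRel.deg_face_succ N j h₁ h₂)

theorem d_cyc (N M i : ℕ) (hM : M = N + 1) (h₁ : 1 ≤ i) (h₂ : i ≤ N) :
    d N M (i + 1) hM (by omega) (by omega) ≫ cyc M = cyc N ≫ d N M i hM h₁ (by omega) := by
  subst hM
  simpa [d, gen, cyc, show 1 ≤ N by omega] using CategoryTheory.Quotient.sound LRel (LRel.cycle_face N i h₁ h₂)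

theorem d_one_cyc (N M : ℕ) (hM : M = N + 1) :
    d N M 1 hM le_rfl (by omega) ≫ cyc M = d N M (N + 1) hM (by omega) le_rfl := by
  subst hM
  simpa [d, gen, cyc] using CategoryTheory.Quotient.sound LRel (LRel.cycle_face_one N)

theorem s_cyc (N M i : ℕ) (hN : N = M + 1) (h₁ : 1 ≤ i) (h₂ : i + 1 ≤ M) :
    s N M (i + 1) hN (by omega) h₂ ≫ cyc M = cyc N ≫ s N M i hN h₁ (by omega) := by
  subst hN
  simpa [s, gen, cyc, show 1 ≤ M by omega] using CategoryTheory.Quotient.sound LRel (LRel.cycle_deg M i h₁ h₂)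

theorem s_one_cyc (N M : ℕ) (hN : N = M + 1) (h : 1 ≤ M) :
    s N M 1 hN le_rfl h ≫ cyc M = cyc N ≫ cyc N ≫ s N M M hN h le_rfl := by
  subst hN
  simpa [s, gen, cyc, h] using CategoryTheory.Quotient.sound LRel (LRel.cycle_deg_one M h)

theorem rot_self (n : ℕ) : rot n n = 𝟙 _ := by
  by_cases h : 1 ≤ n
  · have key : ∀ k, (Quotient.functor LRel).map (LGen.τpow n h k) = rot n k := by
      intro k
      induction k with
      | zero => rfl
      | succ k ih => simp [LGen.τpow, rot, cyc, h, gen, ih]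
    rw [← key]
    exact CategoryTheory.Quotient.sound LRel (LRel.torsion n h)
  · obtain rfl : n = 0 := by omega
    rfl

theorem s_t : s 2 1 1 rfl le_rfl le_rfl ≫ t = cyc 2 ≫ s 2 1 1 rfl le_rfl le_rfl ≫ t := by
  simpa [s, t, gen, cyc] using CategoryTheory.Quotient.sound LRel LRel.terminal

theorem rot_add (n a b : ℕ) : rot n (a + b) = rot n a ≫ rot n b := by
  induction a with
  | zero => simp [rot]
  | succ a ih => rw [Nat.succ_add]; simp [rot, ih]

theorem rot_mul (n a : ℕ) : rot n (n * a) = 𝟙 _ := by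
  induction a with
  | zero => rfl
  | succ a ih => rw [Nat.mul_succ, rot_add, ih, rot_self]; simp

theorem rot_mod (n a : ℕ) : rot n (a % n) = rot n a := by
  conv_rhs => rw [← Nat.mod_add_div a n, rot_add, rot_mul]
  simp

end Lam

/-! ### Expressions for maps of finite ordered sets -/

/-- Expressions for maps of finite totally ordered sets built from `0 ⟶ 1` and `2 ⟶ 1` by
composing and by adding points on the left or on the right. -/
inductive DExpr : ℕ → ℕ → Type
  | cast {k l : ℕ} (h : k = l) : DExpr k l
  | comp {k l m : ℕ} (e : DExpr k l) (f : DExpr l m) : DExpr k m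
  | addLeft (a : ℕ) {k l : ℕ} (e : DExpr k l) : DExpr (a + k) (a + l)
  | addRight {k l : ℕ} (e : DExpr k l) (b : ℕ) : DExpr (k + b) (l + b)
  | face : DExpr 0 1
  | deg : DExpr 2 1

namespace DExpr

/-- The morphism `id_p + e + id_q` of `Λ'`, with source `N = p + k + q` and target
`M = p + l + q`. The generator `0 ⟶ 1` becomes `d^(p+1)` and `2 ⟶ 1` becomes `s^(p+1)`. -/
def real : {k l : ℕ} → DExpr k l → (p q N M : ℕ) → N = p + k + q → M = p + l + q →
    (Lam.fin N ⟶ Lam.fin M)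
  | _, _, cast h, p, q, N, M, hN, hM => eqToHom (by rw [hN, hM, h])
  | _, _, comp (l := l) e f, p, q, N, M, hN, hM =>
      e.real p q N (p + l + q) hN rfl ≫ f.real p q (p + l + q) M rfl hM
  | _, _, addLeft a e, p, q, N, M, hN, hM =>
      e.real (p + a) q N M (by omega) (by omega)
  | _, _, addRight e b, p, q, N, M, hN, hM =>
      e.real p (b + q) N M (by omega) (by omega)
  | _, _, face, p, q, N, M, hN, hM => Lam.d N M (p + 1) (by omega) (by omega) (by omega)
  | _, _, deg, p, q, N, M, hN, hM => Lam.s N M (p + 1) (by omega) (by omega) (by omega)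

theorem real_congr {k l : ℕ} (e : DExpr k l) {p p' q q' N M : ℕ} (hp : p = p') (hq : q = q')
    (hN : N = p + k + q) (hM : M = p + l + q) :
    e.real p q N M hN hM = e.real p' q' N M (by omega) (by omega) := by
  subst hp hq; rfl

theorem real_eqToHom_left {k l : ℕ} (e : DExpr k l) {p q N N' M : ℕ} (h : N' = N)
    (hN : N = p + k + q) (hM : M = p + l + q) (h' : Lam.fin N' = Lam.fin N) :
    eqToHom h' ≫ e.real p q N M hN hM = e.real p q N' M (by omega) hM := by
  subst h; simp

theorem real_eqToHom_right {k l : ℕ} (e : DExpr k l) {p q N M M' : ℕ} (h : M = M')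
    (hN : N = p + k + q) (hM : M = p + l + q) (h' : Lam.fin M = Lam.fin M') :
    e.real p q N M hN hM ≫ eqToHom h' = e.real p q N M' hN (by omega) := by
  subst h; simp

theorem real_comp {k l m : ℕ} (e : DExpr k l) (f : DExpr l m) (p q N K M : ℕ)
    (hN : N = p + k + q) (hK : K = p + l + q) (hM : M = p + m + q) :
    (comp e f).real p q N M hN hM = e.real p q N K hN hK ≫ f.real p q K M hK hM := by
  subst hK; rfl

/-- Expressions at disjoint places commute. -/
theorem interchange {k l k' l' : ℕ} (e : DExpr k l) (e' : DExpr k' l') :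
    ∀ (p r q N N₁ N₂ M : ℕ) (hN : N = p + k + (r + k' + q)) (h₁ : N₁ = p + l + (r + k' + q))
      (h₂ : N₂ = p + k + (r + l' + q)) (hM : M = p + l + (r + l' + q)),
      e.real p (r + k' + q) N N₁ hN h₁ ≫ e'.real (p + l + r) q N₁ M (by omega) (by omega) =
        e'.real (p + k + r) q N N₂ (by omega) (by omega) ≫ e.real p (r + l' + q) N₂ M h₂ hM := by
  induction e with
  | cast h =>
    intro p r q N N₁ N₂ M hN h₁ h₂ hM
    subst h
    obtain rfl : N = N₁ := by omega
    obtain rfl : N₂ = M := by omega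
    simp [real]
  | comp e f ihe ihf =>
    rename_i a b c
    intro p r q N N₁ N₂ M hN h₁ h₂ hM
    rw [real_comp e f _ _ _ (p + b + (r + k' + q)) _ hN rfl h₁,
      real_comp e f _ _ _ (p + b + (r + l' + q)) _ h₂ rfl hM, Category.assoc,
      ihf p r q _ N₁ (p + b + (r + l' + q)) M rfl h₁ rfl hM, ← Category.assoc,
      ihe p r q N _ N₂ _ hN rfl h₂ rfl, Category.assoc]
  | addLeft a e ih =>
    rename_i k l
    intro p r q N N₁ N₂ M hN h₁ h₂ hM
    have := ih (p + a) r q N N₁ N₂ M (by omega) (by omega) (by omega) (by omega)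
    simp only [real]
    rw [real_congr e' (show p + (a + l) + r = p + a + l + r by omega) rfl,
      real_congr e' (show p + (a + k) + r = p + a + k + r by omega) rfl]
    exact this
  | addRight e b ih =>
    rename_i k l
    intro p r q N N₁ N₂ M hN h₁ h₂ hM
    have := ih p (b + r) q N N₁ N₂ M (by omega) (by omega) (by omega) (by omega)
    simp only [real]
    rw [real_congr e' (show p + (l + b) + r = p + l + (b + r) by omega) rfl,
      real_congr e' (show p + (k + b) + r = p + k + (b + r) by omega) rfl,
      real_congr e rfl (show b + (r + k' + q) = b + r + k' + q by omega),
      real_congr e rfl (show b + (r + l' + q) = b + r + l' + q by omega)]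
    exact this
  | face =>
    induction e' with
    | cast h =>
      intro p r q N N₁ N₂ M hN h₁ h₂ hM
      subst h
      obtain rfl : N = N₂ := by omega
      obtain rfl : N₁ = M := by omega
      simp [real]
    | comp e f ihe ihf =>
      rename_i a b c
      intro p r q N N₁ N₂ M hN h₁ h₂ hM
      rw [real_comp e f _ _ _ (p + 1 + (r + b + q)) _ (by omega) (by omega) (by omega),
        real_comp e f _ _ _ (p + 0 + (r + b + q)) _ (by omega) (by omega) (by omega),
        Category.assoc, ← ihf p r q (p + 0 + (r + b + q)) _ N₂ M rfl rfl h₂ hM, ← Category.assoc,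
        ihe p r q N _ _ _ hN h₁ rfl rfl, Category.assoc]
    | addLeft a e ih =>
      rename_i k l
      intro p r q N N₁ N₂ M hN h₁ h₂ hM
      have := ih p (r + a) q N N₁ N₂ M (by omega) (by omega) (by omega) (by omega)
      simp only [real] at this ⊢
      rw [real_congr e (show p + 1 + r + a = p + 1 + (r + a) by omega) rfl,
        real_congr e (show p + 0 + r + a = p + 0 + (r + a) by omega) rfl]
      exact this
    | addRight e b ih =>
      rename_i k l
      intro p r q N N₁ N₂ M hN h₁ h₂ hM
      exact ih p r (b + q) N N₁ N₂ M (by omega) (by omega) (by omega) (by omega)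
    | face =>
      intro p r q N N₁ N₂ M hN h₁ h₂ hM
      simp only [real]
      have := Lam.d_d N N₂ M (p + 1) (p + 0 + r + 1) (by omega) (by omega) (by omega) (by omega)
        (by omega)
      obtain rfl : N₁ = N₂ := by omega
      rw [this]
      congr 2; omega
    | deg =>
      intro p r q N N₁ N₂ M hN h₁ h₂ hM
      simp only [real]
      have := Lam.d_s_lt N N₁ M N₂ (p + 1) (p + 0 + r + 1) (by omega) (by omega) (by omega)
        (by omega) (by omega) (by omega) (by omega)
      rw [← this]
      congr 2; omega
  | deg =>
    induction e' with
    | cast h =>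
      intro p r q N N₁ N₂ M hN h₁ h₂ hM
      subst h
      obtain rfl : N = N₂ := by omega
      obtain rfl : N₁ = M := by omega
      simp [real]
    | comp e f ihe ihf =>
      rename_i a b c
      intro p r q N N₁ N₂ M hN h₁ h₂ hM
      rw [real_comp e f _ _ _ (p + 1 + (r + b + q)) _ (by omega) (by omega) (by omega),
        real_comp e f _ _ _ (p + 2 + (r + b + q)) _ (by omega) (by omega) (by omega),
        Category.assoc, ← ihf p r q (p + 2 + (r + b + q)) _ N₂ M rfl rfl h₂ hM, ← Category.assoc,
        ihe p r q N _ _ _ hN h₁ rfl rfl, Category.assoc]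
    | addLeft a e ih =>
      rename_i k l
      intro p r q N N₁ N₂ M hN h₁ h₂ hM
      have := ih p (r + a) q N N₁ N₂ M (by omega) (by omega) (by omega) (by omega)
      simp only [real] at this ⊢
      rw [real_congr e (show p + 1 + r + a = p + 1 + (r + a) by omega) rfl,
        real_congr e (show p + 2 + r + a = p + 2 + (r + a) by omega) rfl]
      exact this
    | addRight e b ih =>
      rename_i k l
      intro p r q N N₁ N₂ M hN h₁ h₂ hM
      exact ih p r (b + q) N N₁ N₂ M (by omega) (by omega) (by omega) (by omega)
    | face =>
      intro p r q N N₁ N₂ M hN h₁ h₂ hM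
      simp only [real]
      have := Lam.d_s_gt N N₂ M N₁ (p + 1 + r + 1) (p + 1) (by omega) (by omega) (by omega)
        (by omega) (by omega) (by omega) (by omega)
      rw [← this]
      congr 2; omega
    | deg =>
      intro p r q N N₁ N₂ M hN h₁ h₂ hM
      simp only [real]
      obtain rfl : N₁ = N₂ := by omega
      have := Lam.s_s N N₁ M (p + 1) (p + 1 + r + 1) (by omega) (by omega) (by omega) (by omega)
        (by omega)
      rw [this]
      congr 2; omega

theorem _root_.LaxShadow.Lam.d_rot (N M : ℕ) (hM : M = N + 1) (i c : ℕ) (hi : 1 ≤ i)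
    (h : i + c ≤ N + 1) :
    Lam.d N M (i + c) hM (by omega) h ≫ Lam.rot M c =
      Lam.rot N c ≫ Lam.d N M i hM hi (by omega) := by
  induction c with
  | zero => simp [Lam.rot]
  | succ c ih =>
    have h1 := Lam.d_cyc N M (i + c) hM (by omega) (by omega)
    simp only [Lam.rot, Category.assoc]
    rw [← ih (by omega), ← Category.assoc, ← Category.assoc, ← h1]
    rfl

theorem _root_.LaxShadow.Lam.s_rot (N M : ℕ) (hN : N = M + 1) (i c : ℕ) (hi : 1 ≤ i)
    (h : i + c ≤ M) :
    Lam.s N M (i + c) hN (by omega) h ≫ Lam.rot M c =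
      Lam.rot N c ≫ Lam.s N M i hN hi (by omega) := by
  induction c with
  | zero => simp [Lam.rot]
  | succ c ih =>
    have h1 := Lam.s_cyc N M (i + c) hN (by omega) (by omega)
    simp only [Lam.rot, Category.assoc]
    rw [← ih (by omega), ← Category.assoc, ← Category.assoc, ← h1]
    rfl

theorem _root_.LaxShadow.Lam.d_rot_past (N M p q r : ℕ) (hN : N = p + q + r) (hM : M = N + 1) :
    Lam.d N M (p + 1) hM (by omega) (by omega) ≫ Lam.rot M (p + 1 + q) =
      Lam.rot N (p + q) ≫ Lam.d N M (r + p + 1) hM (by omega) (by omega) := by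
  have h1 := Lam.d_rot N M hM 1 p le_rfl (by omega)
  have h2 := Lam.d_one_cyc N M hM
  have h3 := Lam.d_rot N M hM (r + p + 1) q (by omega) (by omega)
  have e1 : Lam.d N M (p + 1) hM (by omega) (by omega) =
      Lam.d N M (1 + p) hM (by omega) (by omega) := by congr 1; omega
  have e2 : Lam.d N M (N + 1) hM (by omega) le_rfl =
      Lam.d N M (r + p + 1 + q) hM (by omega) (by omega) := by congr 1; omega
  rw [e1, Lam.rot_add, Lam.rot_add, ← Category.assoc, ← Category.assoc, h1, Category.assoc,
    Category.assoc]
  rw [Lam.rot_add N, Category.assoc, ← h3, ← e2, ← h2]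
  simp [Lam.rot]

theorem _root_.LaxShadow.Lam.s_rot_past (N M p q r : ℕ) (hM : M = p + 1 + q + r) (hN : N = M + 1) :
    Lam.s N M (p + 1) hN (by omega) (by omega) ≫ Lam.rot M (p + 1 + q) =
      Lam.rot N (p + 2 + q) ≫ Lam.s N M (r + p + 1) hN (by omega) (by omega) := by
  have h1 := Lam.s_rot N M hN 1 p le_rfl (by omega)
  have h2 := Lam.s_one_cyc N M hN (by omega)
  have h3 := Lam.s_rot N M hN (r + p + 1) q (by omega) (by omega)
  have e1 : Lam.s N M (p + 1) hN (by omega) (by omega) =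
      Lam.s N M (1 + p) hN (by omega) (by omega) := by congr 1; omega
  have e2 : Lam.s N M M hN (by omega) le_rfl =
      Lam.s N M (r + p + 1 + q) hN (by omega) (by omega) := by congr 1; omega
  rw [e1, Lam.rot_add, Lam.rot_add, ← Category.assoc, ← Category.assoc, h1]
  rw [Lam.rot_add N (p + 2), Lam.rot_add N p, Category.assoc, Category.assoc _ (Lam.rot N q),
    ← h3, ← e2]
  simp only [Lam.rot, Category.assoc, Category.comp_id, Category.id_comp]
  rw [← Category.assoc (Lam.s N M 1 _ _ _), h2]
  simp only [Category.assoc]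

/-- Rotating an expression past the end. -/
theorem real_rot {k l : ℕ} (e : DExpr k l) : ∀ (p q r N M : ℕ) (hN : N = p + k + (q + r))
    (hM : M = p + l + (q + r)),
    e.real p (q + r) N M hN hM ≫ Lam.rot M (p + l + q) =
      Lam.rot N (p + k + q) ≫ e.real (r + p) q N M (by omega) (by omega) := by
  induction e with
  | cast h =>
    intro p q r N M hN hM
    subst h
    obtain rfl : N = M := by omega
    simp [real]
  | comp e f ihe ihf =>
    rename_i a b c
    intro p q r N M hN hM
    rw [real_comp e f _ _ _ (p + b + (q + r)) _ hN rfl hM,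
      real_comp e f _ _ _ (p + b + (q + r)) _ (by omega) (by omega) (by omega),
      Category.assoc, ihf _ _ _ _ _ rfl hM, ← Category.assoc, ihe _ _ _ _ _ hN rfl, Category.assoc]
  | addLeft a e ih =>
    rename_i k l
    intro p q r N M hN hM
    have := ih (p + a) q r N M (by omega) (by omega)
    simp only [real]
    rw [show p + (a + l) + q = p + a + l + q by omega,
      show p + (a + k) + q = p + a + k + q by omega, this,
      real_congr e (show r + (p + a) = r + p + a by omega) rfl]
  | addRight e b ih =>
    rename_i k l
    intro p q r N M hN hM
    have := ih p (b + q) r N M (by omega) (by omega)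
    simp only [real]
    rw [show p + (l + b) + q = p + l + (b + q) by omega,
      show p + (k + b) + q = p + k + (b + q) by omega, ← this,
      real_congr e rfl (show b + (q + r) = b + q + r by omega)]
  | face =>
    intro p q r N M hN hM
    exact Lam.d_rot_past N M p q r (by omega) (by omega)
  | deg =>
    intro p q r N M hN hM
    exact Lam.s_rot_past N M p q r (by omega) (by omega)

end DExpr

open Bicategory

/-! ### Bicategories with shadow and lax shadow functors -/

/-- A shadow on a bicategory `B` with values in a category `T`. -/
structure Shadow (B : Type u₁) [Bicategory.{w₁, v₁} B] (T : Type u₂) [Category.{v₂} T] where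
  /-- The shadow functors `⟨-⟩`. -/
  sh (a : B) : (a ⟶ a) ⥤ T
  /-- The rotators `θ`. -/
  rot {a b : B} (f : a ⟶ b) (g : b ⟶ a) : (sh a).obj (f ≫ g) ≅ (sh b).obj (g ≫ f)
  rot_naturality_left {a b : B} {f f' : a ⟶ b} (η : f ⟶ f') (g : b ⟶ a) :
    (sh a).map (η ▷ g) ≫ (rot f' g).hom = (rot f g).hom ≫ (sh b).map (g ◁ η)
  rot_naturality_right {a b : B} (f : a ⟶ b) {g g' : b ⟶ a} (η : g ⟶ g') :
    (sh a).map (f ◁ η) ≫ (rot f g').hom = (rot f g).hom ≫ (sh b).map (η ▷ f)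
  rot_assoc {a b c : B} (f : a ⟶ b) (g : b ⟶ c) (h : c ⟶ a) :
    (rot (f ≫ g) h).hom ≫ (sh c).map (α_ h f g).inv ≫ (rot (h ≫ f) g).hom =
      (sh a).map (α_ f g h).hom ≫ (rot f (g ≫ h)).hom ≫ (sh b).map (α_ g h f).hom
  rot_id_right {a : B} (f : a ⟶ a) :
    (rot f (𝟙 a)).hom ≫ (sh a).map (λ_ f).hom = (sh a).map (ρ_ f).hom
  rot_id_left {a : B} (f : a ⟶ a) :
    (rot (𝟙 a) f).hom ≫ (sh a).map (ρ_ f).hom = (sh a).map (λ_ f).hom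

/-- A lax shadow functor `(F, H)` between bicategories with shadow. -/
structure LaxShadowFunctor {C : Type u₁} [Bicategory.{w₁, v₁} C] {C' : Type u₂} [Category.{v₂} C']
    (S : Shadow C C') {D : Type u₃} [Bicategory.{w₂, v₃} D] {D' : Type u₄} [Category.{v₄} D']
    (T : Shadow D D') where
  /-- The lax functor on bicategories. -/
  F : LaxFunctor C D
  /-- The functor on shadow categories. -/
  H : C' ⥤ D'
  /-- The shadow commutation maps. -/
  s {a : C} (f : a ⟶ a) : (T.sh (F.obj a)).obj (F.map f) ⟶ H.obj ((S.sh a).obj f)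
  s_naturality {a : C} {f g : a ⟶ a} (η : f ⟶ g) :
    (T.sh (F.obj a)).map (F.map₂ η) ≫ s g = s f ≫ H.map ((S.sh a).map η)
  s_rot {a b : C} (f : a ⟶ b) (g : b ⟶ a) :
    (T.rot (F.map f) (F.map g)).hom ≫ (T.sh (F.obj b)).map (F.mapComp g f) ≫ s (g ≫ f) =
      (T.sh (F.obj a)).map (F.mapComp f g) ≫ s (f ≫ g) ≫ H.map (S.rot f g).hom

/-- An oplax shadow functor `(F, H)` between bicategories with shadow: the constraints of `F` and
the shadow commutation maps point the other way. -/
structure OplaxShadowFunctor {C : Type u₁} [Bicategory.{w₁, v₁} C] {C' : Type u₂}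
    [Category.{v₂} C'] (S : Shadow C C') {D : Type u₃} [Bicategory.{w₂, v₃} D] {D' : Type u₄}
    [Category.{v₄} D'] (T : Shadow D D') where
  /-- The oplax functor on bicategories. -/
  F : OplaxFunctor C D
  /-- The functor on shadow categories. -/
  H : C' ⥤ D'
  /-- The shadow commutation maps. -/
  s {a : C} (f : a ⟶ a) : H.obj ((S.sh a).obj f) ⟶ (T.sh (F.obj a)).obj (F.map f)
  s_naturality {a : C} {f g : a ⟶ a} (η : f ⟶ g) :
    H.map ((S.sh a).map η) ≫ s g = s f ≫ (T.sh (F.obj a)).map (F.map₂ η)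
  s_rot {a b : C} (f : a ⟶ b) (g : b ⟶ a) :
    H.map (S.rot f g).hom ≫ s (g ≫ f) ≫ (T.sh (F.obj b)).map (F.mapComp g f) =
      s (f ≫ g) ≫ (T.sh (F.obj a)).map (F.mapComp f g) ≫ (T.rot (F.map f) (F.map g)).hom

/-! ### The free shadow on a bicategory -/

section FreeShadow

variable (B : Type u₁) [Bicategory.{w₁, v₁} B]

/-- Endomorphism 1-cells of a bicategory, written `⟨f⟩`. -/
structure ShObj : Type (max u₁ v₁) where
  {pt : B}
  cell : pt ⟶ pt

variable {B}

/-- Generators: `⟨η⟩` for every 2-cell `η`, rotators and their inverses. -/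
inductive ShGen : ShObj B → ShObj B → Type (max u₁ v₁ w₁)
  | sh {a : B} {f g : a ⟶ a} (η : f ⟶ g) : ShGen ⟨f⟩ ⟨g⟩
  | rot {a b : B} (f : a ⟶ b) (g : b ⟶ a) : ShGen ⟨f ≫ g⟩ ⟨g ≫ f⟩
  | rotInv {a b : B} (f : a ⟶ b) (g : b ⟶ a) : ShGen ⟨g ≫ f⟩ ⟨f ≫ g⟩

instance : Quiver (ShObj B) := ⟨ShGen⟩

/-- The one-letter word on a generator. -/
def ShGen.w {x y : ShObj B} (g : ShGen x y) : (Paths.of (ShObj B)).obj x ⟶ (Paths.of _).obj y :=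
  (Paths.of (ShObj B)).map g

open ShGen in
/-- The relations of the free shadow on a bicategory. -/
inductive ShRel : HomRel (Paths (ShObj B))
  | sh_id {a : B} (f : a ⟶ a) : ShRel (sh (𝟙 f)).w (𝟙 _)
  | sh_comp {a : B} {f g h : a ⟶ a} (η : f ⟶ g) (θ : g ⟶ h) :
      ShRel (sh (η ≫ θ)).w ((sh η).w ≫ (sh θ).w)
  | rot_rotInv {a b : B} (f : a ⟶ b) (g : b ⟶ a) :
      ShRel ((rot f g).w ≫ (rotInv f g).w) (𝟙 _)
  | rotInv_rot {a b : B} (f : a ⟶ b) (g : b ⟶ a) :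
      ShRel ((rotInv f g).w ≫ (rot f g).w) (𝟙 _)
  | rot_naturality_left {a b : B} {f f' : a ⟶ b} (η : f ⟶ f') (g : b ⟶ a) :
      ShRel ((sh (η ▷ g)).w ≫ (rot f' g).w) ((rot f g).w ≫ (sh (g ◁ η)).w)
  | rot_naturality_right {a b : B} (f : a ⟶ b) {g g' : b ⟶ a} (η : g ⟶ g') :
      ShRel ((sh (f ◁ η)).w ≫ (rot f g').w) ((rot f g).w ≫ (sh (η ▷ f)).w)
  | rot_assoc {a b c : B} (f : a ⟶ b) (g : b ⟶ c) (h : c ⟶ a) :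
      ShRel ((rot (f ≫ g) h).w ≫ (sh (α_ h f g).inv).w ≫ (rot (h ≫ f) g).w)
        ((sh (α_ f g h).hom).w ≫ (rot f (g ≫ h)).w ≫ (sh (α_ g h f).hom).w)
  | rot_id_right {a : B} (f : a ⟶ a) :
      ShRel ((rot f (𝟙 a)).w ≫ (sh (λ_ f).hom).w) (sh (ρ_ f).hom).w
  | rot_id_left {a : B} (f : a ⟶ a) :
      ShRel ((rot (𝟙 a) f).w ≫ (sh (ρ_ f).hom).w) (sh (λ_ f).hom).w

variable (B) in
/-- The target category of the free shadow on a bicategory. -/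
abbrev FreeSh : Type (max u₁ v₁) := CategoryTheory.Quotient (ShRel (B := B))

/-- An endomorphism 1-cell as an object of the free shadow category. -/
abbrev FreeSh.ob {a : B} (f : a ⟶ a) : FreeSh B :=
  (Quotient.functor ShRel).obj ((Paths.of _).obj ⟨f⟩)

/-- A generator as a morphism of the free shadow category. -/
def FreeSh.gen {x y : ShObj B} (g : ShGen x y) : FreeSh.ob x.cell ⟶ FreeSh.ob y.cell :=
  (Quotient.functor ShRel).map g.w

variable (B) in
/-- The free shadow on a bicategory. -/
def freeShadow : Shadow B (FreeSh B) where
  sh a :=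
    { obj := fun f => FreeSh.ob f
      map := fun η => FreeSh.gen (.sh η)
      map_id := fun f => CategoryTheory.Quotient.sound ShRel (.sh_id f)
      map_comp := fun η θ => CategoryTheory.Quotient.sound ShRel (.sh_comp η θ) }
  rot f g :=
    { hom := FreeSh.gen (.rot f g)
      inv := FreeSh.gen (.rotInv f g)
      hom_inv_id := CategoryTheory.Quotient.sound ShRel (.rot_rotInv f g)
      inv_hom_id := CategoryTheory.Quotient.sound ShRel (.rotInv_rot f g) }
  rot_naturality_left η g := CategoryTheory.Quotient.sound ShRel (.rot_naturality_left η g)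
  rot_naturality_right f _ _ η := CategoryTheory.Quotient.sound ShRel (.rot_naturality_right f η)
  rot_assoc f g h := CategoryTheory.Quotient.sound ShRel (.rot_assoc f g h)
  rot_id_right f := CategoryTheory.Quotient.sound ShRel (.rot_id_right f)
  rot_id_left f := CategoryTheory.Quotient.sound ShRel (.rot_id_left f)

end FreeShadow

/-! ### The free shadow category under a lax functor -/

section LaxSh

variable {B : Type u₁} [Bicategory.{w₁, v₁} B] {D : Type u₂} [Bicategory.{w₂, v₂} D]
variable {B' : Type u₃} [Category.{v₃} B'] (S : Shadow B B') (F : LaxFunctor B D)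

/-- The objects `H x`, for objects `x` of the shadow category of the source, and `⟨f⟩`, for
endomorphism 1-cells `f` of the target of a lax functor. -/
inductive LaxShObj (S : Shadow B B') (F : LaxFunctor B D) : Type (max u₂ v₂ u₃)
  | out (x : B') : LaxShObj S F
  | inn {a : D} (f : a ⟶ a) : LaxShObj S F

/-- Generators: the morphisms of the shadow category of the source under `H`; the 2-cells of the
target inside `⟨-⟩`; rotators and their inverses; shadow commutation maps. -/
inductive LaxShGen : LaxShObj S F → LaxShObj S F → Type (max u₁ v₁ u₂ v₂ w₂ u₃ v₃)
  | hmap {x y : B'} (φ : x ⟶ y) : LaxShGen (.out x) (.out y)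
  | sh {a : D} {f g : a ⟶ a} (η : f ⟶ g) : LaxShGen (.inn f) (.inn g)
  | rot {a b : D} (f : a ⟶ b) (g : b ⟶ a) : LaxShGen (.inn (f ≫ g)) (.inn (g ≫ f))
  | rotInv {a b : D} (f : a ⟶ b) (g : b ⟶ a) : LaxShGen (.inn (g ≫ f)) (.inn (f ≫ g))
  | s {a : B} (f : a ⟶ a) : LaxShGen (.inn (F.map f)) (.out ((S.sh a).obj f))

instance : Quiver (LaxShObj S F) := ⟨LaxShGen S F⟩

variable {S F} in
/-- The one-letter word on a generator. -/
def LaxShGen.w {x y : LaxShObj S F} (g : LaxShGen S F x y) :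
    (Paths.of (LaxShObj S F)).obj x ⟶ (Paths.of _).obj y :=
  (Paths.of (LaxShObj S F)).map g

open LaxShGen in
/-- The relations: `H` is a functor, `⟨-⟩` is a shadow, `s` is natural and compatible with the
rotators. -/
inductive LaxShRel : HomRel (Paths (LaxShObj S F))
  | map_id (x : B') : LaxShRel (hmap (𝟙 x)).w (𝟙 _)
  | map_comp {x y z : B'} (φ : x ⟶ y) (ψ : y ⟶ z) :
      LaxShRel (hmap (φ ≫ ψ)).w ((hmap φ).w ≫ (hmap ψ).w)
  | sh_id {a : D} (f : a ⟶ a) : LaxShRel (sh (𝟙 f)).w (𝟙 _)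
  | sh_comp {a : D} {f g h : a ⟶ a} (η : f ⟶ g) (θ : g ⟶ h) :
      LaxShRel (sh (η ≫ θ)).w ((sh η).w ≫ (sh θ).w)
  | rot_rotInv {a b : D} (f : a ⟶ b) (g : b ⟶ a) :
      LaxShRel ((rot f g).w ≫ (rotInv f g).w) (𝟙 _)
  | rotInv_rot {a b : D} (f : a ⟶ b) (g : b ⟶ a) :
      LaxShRel ((rotInv f g).w ≫ (rot f g).w) (𝟙 _)
  | rot_naturality_left {a b : D} {f f' : a ⟶ b} (η : f ⟶ f') (g : b ⟶ a) :
      LaxShRel ((sh (η ▷ g)).w ≫ (rot f' g).w) ((rot f g).w ≫ (sh (g ◁ η)).w)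
  | rot_naturality_right {a b : D} (f : a ⟶ b) {g g' : b ⟶ a} (η : g ⟶ g') :
      LaxShRel ((sh (f ◁ η)).w ≫ (rot f g').w) ((rot f g).w ≫ (sh (η ▷ f)).w)
  | rot_assoc {a b c : D} (f : a ⟶ b) (g : b ⟶ c) (h : c ⟶ a) :
      LaxShRel ((rot (f ≫ g) h).w ≫ (sh (α_ h f g).inv).w ≫ (rot (h ≫ f) g).w)
        ((sh (α_ f g h).hom).w ≫ (rot f (g ≫ h)).w ≫ (sh (α_ g h f).hom).w)
  | rot_id_right {a : D} (f : a ⟶ a) :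
      LaxShRel ((rot f (𝟙 a)).w ≫ (sh (λ_ f).hom).w) (sh (ρ_ f).hom).w
  | rot_id_left {a : D} (f : a ⟶ a) :
      LaxShRel ((rot (𝟙 a) f).w ≫ (sh (ρ_ f).hom).w) (sh (λ_ f).hom).w
  | s_naturality {a : B} {f g : a ⟶ a} (η : f ⟶ g) :
      LaxShRel ((sh (F.map₂ η)).w ≫ (s g).w) ((s f).w ≫ (hmap ((S.sh a).map η)).w)
  | s_rot {a b : B} (f : a ⟶ b) (g : b ⟶ a) :
      LaxShRel ((rot (F.map f) (F.map g)).w ≫ (sh (F.mapComp g f)).w ≫ (s (g ≫ f)).w)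
        ((sh (F.mapComp f g)).w ≫ (s (f ≫ g)).w ≫ (hmap (S.rot f g).hom).w)

/-- The shadow category obtained from a lax functor by freely adding a shadow on its target, a
functor on shadow categories and shadow commutation maps. -/
abbrev LaxSh : Type (max u₂ v₂ u₃) := CategoryTheory.Quotient (LaxShRel S F)

variable {S F}

/-- An object of `LaxShObj` as an object of the category `LaxSh`. -/
abbrev LaxSh.ob (x : LaxShObj S F) : LaxSh S F :=
  (Quotient.functor (LaxShRel S F)).obj ((Paths.of _).obj x)

/-- A generator as a morphism of `LaxSh`. -/
def LaxSh.gen {x y : LaxShObj S F} (g : LaxShGen S F x y) : LaxSh.ob x ⟶ LaxSh.ob y :=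
  (Quotient.functor (LaxShRel S F)).map g.w

variable (S F)

/-- The shadow of `LaxSh`. -/
def laxShShadow : Shadow D (LaxSh S F) where
  sh a :=
    { obj := fun f => LaxSh.ob (.inn f)
      map := fun η => LaxSh.gen (.sh η)
      map_id := fun f => CategoryTheory.Quotient.sound _ (.sh_id f)
      map_comp := fun η θ => CategoryTheory.Quotient.sound _ (.sh_comp η θ) }
  rot f g :=
    { hom := LaxSh.gen (.rot f g)
      inv := LaxSh.gen (.rotInv f g)
      hom_inv_id := CategoryTheory.Quotient.sound _ (.rot_rotInv f g)
      inv_hom_id := CategoryTheory.Quotient.sound _ (.rotInv_rot f g) }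
  rot_naturality_left η g := CategoryTheory.Quotient.sound _ (.rot_naturality_left η g)
  rot_naturality_right f _ _ η := CategoryTheory.Quotient.sound _ (.rot_naturality_right f η)
  rot_assoc f g h := CategoryTheory.Quotient.sound _ (.rot_assoc f g h)
  rot_id_right f := CategoryTheory.Quotient.sound _ (.rot_id_right f)
  rot_id_left f := CategoryTheory.Quotient.sound _ (.rot_id_left f)

/-- The lax shadow functor extending a lax functor. -/
def laxShFunctor : LaxShadowFunctor S (laxShShadow S F) where
  F := F
  H :=
    { obj := fun x => LaxSh.ob (.out x)
      map := fun φ => LaxSh.gen (.hmap φ)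
      map_id := fun x => CategoryTheory.Quotient.sound _ (.map_id x)
      map_comp := fun φ ψ => CategoryTheory.Quotient.sound _ (.map_comp φ ψ) }
  s f := LaxSh.gen (.s f)
  s_naturality η := CategoryTheory.Quotient.sound _ (.s_naturality η)
  s_rot f g := CategoryTheory.Quotient.sound _ (.s_rot f g)

end LaxSh

/-! ### The free lax functor on a graph -/

/-- The target bicategory of the free lax functor on a graph. Its objects are the vertices. -/
structure FreeLax (G : Type u₁) [Quiver.{v₁} G] : Type u₁ where
  pt : FreeBicategory G

namespace FreeLax

variable {G : Type u₁} [Quiver.{v₁} G]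

/-- The 1-cells: words in the symbols `F(W)`, for 1-cells `W` of the free bicategory, and formal
units. -/
inductive Hom : FreeLax G → FreeLax G → Type (max u₁ v₁)
  | blk {a b : FreeBicategory G} (W : a ⟶ b) : Hom ⟨a⟩ ⟨b⟩
  | id (a : FreeLax G) : Hom a a
  | comp {a b c : FreeLax G} (f : Hom a b) (g : Hom b c) : Hom a c

instance : CategoryStruct.{max u₁ v₁} (FreeLax G) where
  Hom a b := Hom a b
  id a := Hom.id a
  comp f g := Hom.comp f g

/-- The symbol `F(W)`. -/
def block {a b : FreeBicategory G} (W : a ⟶ b) : (⟨a⟩ : FreeLax G) ⟶ ⟨b⟩ := Hom.blk W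

/-- Representatives of 2-cells. -/
inductive Hom₂ : ∀ {a b : FreeLax G}, (a ⟶ b) → (a ⟶ b) → Type (max u₁ v₁)
  | refl {a b : FreeLax G} (f : a ⟶ b) : Hom₂ f f
  | vcomp {a b : FreeLax G} {f g h : a ⟶ b} (η : Hom₂ f g) (θ : Hom₂ g h) : Hom₂ f h
  | whiskerLeft {a b c : FreeLax G} (f : a ⟶ b) {g h : b ⟶ c} (η : Hom₂ g h) :
      Hom₂ (f ≫ g) (f ≫ h)
  | whiskerRight {a b c : FreeLax G} {f g : a ⟶ b} (η : Hom₂ f g) (h : b ⟶ c) :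
      Hom₂ (f ≫ h) (g ≫ h)
  | associator {a b c d : FreeLax G} (f : a ⟶ b) (g : b ⟶ c) (h : c ⟶ d) :
      Hom₂ ((f ≫ g) ≫ h) (f ≫ (g ≫ h))
  | associatorInv {a b c d : FreeLax G} (f : a ⟶ b) (g : b ⟶ c) (h : c ⟶ d) :
      Hom₂ (f ≫ (g ≫ h)) ((f ≫ g) ≫ h)
  | rightUnitor {a b : FreeLax G} (f : a ⟶ b) : Hom₂ (f ≫ 𝟙 b) f
  | rightUnitorInv {a b : FreeLax G} (f : a ⟶ b) : Hom₂ f (f ≫ 𝟙 b)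
  | leftUnitor {a b : FreeLax G} (f : a ⟶ b) : Hom₂ (𝟙 a ≫ f) f
  | leftUnitorInv {a b : FreeLax G} (f : a ⟶ b) : Hom₂ f (𝟙 a ≫ f)
  | map₂ {a b : FreeBicategory G} {W W' : a ⟶ b} (η : W ⟶ W') : Hom₂ (block W) (block W')
  | unit (a : FreeBicategory G) : Hom₂ (𝟙 (⟨a⟩ : FreeLax G)) (block (𝟙 a))
  | mul {a b c : FreeBicategory G} (W : a ⟶ b) (W' : b ⟶ c) :
      Hom₂ (block W ≫ block W') (block (W ≫ W'))

open Hom₂ in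
/-- Relations between representatives: the axioms of a bicategory and of a lax functor. -/
inductive Rel : ∀ {a b : FreeLax G} {f g : a ⟶ b}, Hom₂ f g → Hom₂ f g → Prop
  | vcomp_right {a b : FreeLax G} {f g h : a ⟶ b} (η : Hom₂ f g) (θ₁ θ₂ : Hom₂ g h) :
      Rel θ₁ θ₂ → Rel (η.vcomp θ₁) (η.vcomp θ₂)
  | vcomp_left {a b : FreeLax G} {f g h : a ⟶ b} (η₁ η₂ : Hom₂ f g) (θ : Hom₂ g h) :
      Rel η₁ η₂ → Rel (η₁.vcomp θ) (η₂.vcomp θ)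
  | id_comp {a b : FreeLax G} {f g : a ⟶ b} (η : Hom₂ f g) : Rel ((refl f).vcomp η) η
  | comp_id {a b : FreeLax G} {f g : a ⟶ b} (η : Hom₂ f g) : Rel (η.vcomp (refl g)) η
  | assoc {a b : FreeLax G} {f g h i : a ⟶ b} (η : Hom₂ f g) (θ : Hom₂ g h) (ι : Hom₂ h i) :
      Rel ((η.vcomp θ).vcomp ι) (η.vcomp (θ.vcomp ι))
  | whiskerLeft_congr {a b c : FreeLax G} (f : a ⟶ b) (g h : b ⟶ c) (η η' : Hom₂ g h) :
      Rel η η' → Rel (whiskerLeft f η) (whiskerLeft f η')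
  | whiskerLeft_id {a b c : FreeLax G} (f : a ⟶ b) (g : b ⟶ c) :
      Rel (whiskerLeft f (refl g)) (refl (f ≫ g))
  | whiskerLeft_comp {a b c : FreeLax G} (f : a ⟶ b) {g h i : b ⟶ c} (η : Hom₂ g h)
      (θ : Hom₂ h i) :
      Rel (whiskerLeft f (η.vcomp θ)) ((whiskerLeft f η).vcomp (whiskerLeft f θ))
  | id_whiskerLeft {a b : FreeLax G} {f g : a ⟶ b} (η : Hom₂ f g) :
      Rel (whiskerLeft (𝟙 a) η) ((leftUnitor f).vcomp (η.vcomp (leftUnitorInv g)))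
  | comp_whiskerLeft {a b c d : FreeLax G} (f : a ⟶ b) (g : b ⟶ c) {h h' : c ⟶ d}
      (η : Hom₂ h h') :
      Rel (whiskerLeft (f ≫ g) η) ((associator f g h).vcomp
        ((whiskerLeft f (whiskerLeft g η)).vcomp (associatorInv f g h')))
  | whiskerRight_congr {a b c : FreeLax G} (f g : a ⟶ b) (h : b ⟶ c) (η η' : Hom₂ f g) :
      Rel η η' → Rel (whiskerRight η h) (whiskerRight η' h)
  | id_whiskerRight {a b c : FreeLax G} (f : a ⟶ b) (g : b ⟶ c) :
      Rel (whiskerRight (refl f) g) (refl (f ≫ g))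
  | comp_whiskerRight {a b c : FreeLax G} {f g h : a ⟶ b} (i : b ⟶ c) (η : Hom₂ f g)
      (θ : Hom₂ g h) :
      Rel (whiskerRight (η.vcomp θ) i) ((whiskerRight η i).vcomp (whiskerRight θ i))
  | whiskerRight_id {a b : FreeLax G} {f g : a ⟶ b} (η : Hom₂ f g) :
      Rel (whiskerRight η (𝟙 b)) ((rightUnitor f).vcomp (η.vcomp (rightUnitorInv g)))
  | whiskerRight_comp {a b c d : FreeLax G} {f f' : a ⟶ b} (g : b ⟶ c) (h : c ⟶ d)
      (η : Hom₂ f f') :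
      Rel (whiskerRight η (g ≫ h)) ((associatorInv f g h).vcomp
        ((whiskerRight (whiskerRight η g) h).vcomp (associator f' g h)))
  | whisker_assoc {a b c d : FreeLax G} (f : a ⟶ b) {g g' : b ⟶ c} (η : Hom₂ g g') (h : c ⟶ d) :
      Rel (whiskerRight (whiskerLeft f η) h) ((associator f g h).vcomp
        ((whiskerLeft f (whiskerRight η h)).vcomp (associatorInv f g' h)))
  | whisker_exchange {a b c : FreeLax G} {f g : a ⟶ b} {h i : b ⟶ c} (η : Hom₂ f g)
      (θ : Hom₂ h i) :
      Rel ((whiskerLeft f θ).vcomp (whiskerRight η i))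
        ((whiskerRight η h).vcomp (whiskerLeft g θ))
  | associator_hom_inv {a b c d : FreeLax G} (f : a ⟶ b) (g : b ⟶ c) (h : c ⟶ d) :
      Rel ((associator f g h).vcomp (associatorInv f g h)) (refl ((f ≫ g) ≫ h))
  | associator_inv_hom {a b c d : FreeLax G} (f : a ⟶ b) (g : b ⟶ c) (h : c ⟶ d) :
      Rel ((associatorInv f g h).vcomp (associator f g h)) (refl (f ≫ (g ≫ h)))
  | leftUnitor_hom_inv {a b : FreeLax G} (f : a ⟶ b) :
      Rel ((leftUnitor f).vcomp (leftUnitorInv f)) (refl (𝟙 a ≫ f))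
  | leftUnitor_inv_hom {a b : FreeLax G} (f : a ⟶ b) :
      Rel ((leftUnitorInv f).vcomp (leftUnitor f)) (refl f)
  | rightUnitor_hom_inv {a b : FreeLax G} (f : a ⟶ b) :
      Rel ((rightUnitor f).vcomp (rightUnitorInv f)) (refl (f ≫ 𝟙 b))
  | rightUnitor_inv_hom {a b : FreeLax G} (f : a ⟶ b) :
      Rel ((rightUnitorInv f).vcomp (rightUnitor f)) (refl f)
  | pentagon {a b c d e : FreeLax G} (f : a ⟶ b) (g : b ⟶ c) (h : c ⟶ d) (i : d ⟶ e) :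
      Rel ((whiskerRight (associator f g h) i).vcomp
          ((associator f (g ≫ h) i).vcomp (whiskerLeft f (associator g h i))))
        ((associator (f ≫ g) h i).vcomp (associator f g (h ≫ i)))
  | triangle {a b c : FreeLax G} (f : a ⟶ b) (g : b ⟶ c) :
      Rel ((associator f (𝟙 b) g).vcomp (whiskerLeft f (leftUnitor g)))
        (whiskerRight (rightUnitor f) g)
  | map₂_id {a b : FreeBicategory G} (W : a ⟶ b) : Rel (map₂ (𝟙 W)) (refl (block W))
  | map₂_comp {a b : FreeBicategory G} {W W' W'' : a ⟶ b} (η : W ⟶ W') (θ : W' ⟶ W'') :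
      Rel (map₂ (η ≫ θ)) ((map₂ η).vcomp (map₂ θ))
  | mul_naturality_left {a b c : FreeBicategory G} {W W' : a ⟶ b} (η : W ⟶ W') (V : b ⟶ c) :
      Rel ((mul W V).vcomp (map₂ (η ▷ V))) ((whiskerRight (map₂ η) (block V)).vcomp (mul W' V))
  | mul_naturality_right {a b c : FreeBicategory G} (W : a ⟶ b) {V V' : b ⟶ c} (η : V ⟶ V') :
      Rel ((mul W V).vcomp (map₂ (W ◁ η))) ((whiskerLeft (block W) (map₂ η)).vcomp (mul W V'))
  | mul_assoc {a b c d : FreeBicategory G} (W₁ : a ⟶ b) (W₂ : b ⟶ c) (W₃ : c ⟶ d) :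
      Rel ((whiskerRight (mul W₁ W₂) (block W₃)).vcomp
          ((mul (W₁ ≫ W₂) W₃).vcomp (map₂ (α_ W₁ W₂ W₃).hom)))
        ((associator (block W₁) (block W₂) (block W₃)).vcomp
          ((whiskerLeft (block W₁) (mul W₂ W₃)).vcomp (mul W₁ (W₂ ≫ W₃))))
  | unit_mul {a b : FreeBicategory G} (W : a ⟶ b) :
      Rel (map₂ (λ_ W).inv) ((leftUnitorInv (block W)).vcomp
        ((whiskerRight (unit a) (block W)).vcomp (mul (𝟙 a) W)))
  | mul_unit {a b : FreeBicategory G} (W : a ⟶ b) :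
      Rel (map₂ (ρ_ W).inv) ((rightUnitorInv (block W)).vcomp
        ((whiskerLeft (block W) (unit b)).vcomp (mul W (𝟙 b))))

instance homCategory (a b : FreeLax G) : Category (a ⟶ b) where
  Hom f g := Quot (@Rel G _ a b f g)
  id f := Quot.mk _ (Hom₂.refl f)
  comp := Quot.map₂ Hom₂.vcomp Rel.vcomp_right Rel.vcomp_left
  id_comp := by rintro f g ⟨η⟩; exact Quot.sound (Rel.id_comp η)
  comp_id := by rintro f g ⟨η⟩; exact Quot.sound (Rel.comp_id η)
  assoc := by rintro f g h i ⟨η⟩ ⟨θ⟩ ⟨ι⟩; exact Quot.sound (Rel.assoc η θ ι)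

/-- The 2-cell with a given representative. -/
def Hom₂.mk {a b : FreeLax G} {f g : a ⟶ b} (η : Hom₂ f g) : f ⟶ g := Quot.mk Rel η

instance bicategory : Bicategory (FreeLax G) where
  homCategory := homCategory
  whiskerLeft f g h η := Quot.map (Hom₂.whiskerLeft f) (Rel.whiskerLeft_congr f g h) η
  whiskerRight {_ _ _ f g} η h :=
    Quot.map (fun η => Hom₂.whiskerRight η h) (Rel.whiskerRight_congr f g h) η
  associator f g h :=
    { hom := Quot.mk _ (Hom₂.associator f g h)
      inv := Quot.mk _ (Hom₂.associatorInv f g h)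
      hom_inv_id := Quot.sound (Rel.associator_hom_inv f g h)
      inv_hom_id := Quot.sound (Rel.associator_inv_hom f g h) }
  leftUnitor f :=
    { hom := Quot.mk _ (Hom₂.leftUnitor f)
      inv := Quot.mk _ (Hom₂.leftUnitorInv f)
      hom_inv_id := Quot.sound (Rel.leftUnitor_hom_inv f)
      inv_hom_id := Quot.sound (Rel.leftUnitor_inv_hom f) }
  rightUnitor f :=
    { hom := Quot.mk _ (Hom₂.rightUnitor f)
      inv := Quot.mk _ (Hom₂.rightUnitorInv f)
      hom_inv_id := Quot.sound (Rel.rightUnitor_hom_inv f)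
      inv_hom_id := Quot.sound (Rel.rightUnitor_inv_hom f) }
  whiskerLeft_id f g := Quot.sound (Rel.whiskerLeft_id f g)
  whiskerLeft_comp := by
    rintro a b c f g h i ⟨η⟩ ⟨θ⟩; exact Quot.sound (Rel.whiskerLeft_comp f η θ)
  id_whiskerLeft := by rintro a b f g ⟨η⟩; exact Quot.sound (Rel.id_whiskerLeft η)
  comp_whiskerLeft := by
    rintro a b c d f g h h' ⟨η⟩; exact Quot.sound (Rel.comp_whiskerLeft f g η)
  id_whiskerRight f g := Quot.sound (Rel.id_whiskerRight f g)
  comp_whiskerRight := by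
    rintro a b c f g h ⟨η⟩ ⟨θ⟩ i; exact Quot.sound (Rel.comp_whiskerRight i η θ)
  whiskerRight_id := by rintro a b f g ⟨η⟩; exact Quot.sound (Rel.whiskerRight_id η)
  whiskerRight_comp := by
    rintro a b c d f f' ⟨η⟩ g h; exact Quot.sound (Rel.whiskerRight_comp g h η)
  whisker_assoc := by
    rintro a b c d f g g' ⟨η⟩ h; exact Quot.sound (Rel.whisker_assoc f η h)
  whisker_exchange := by
    rintro a b c f g h i ⟨η⟩ ⟨θ⟩; exact Quot.sound (Rel.whisker_exchange η θ)
  pentagon f g h i := Quot.sound (Rel.pentagon f g h i)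
  triangle f g := Quot.sound (Rel.triangle f g)

variable (G) in
/-- The free lax functor on a graph. -/
def functor : LaxFunctor (FreeBicategory G) (FreeLax G) where
  obj a := ⟨a⟩
  map W := block W
  map₂ η := (Hom₂.map₂ η).mk
  map₂_id W := Quot.sound (Rel.map₂_id W)
  map₂_comp η θ := Quot.sound (Rel.map₂_comp η θ)
  mapId a := (Hom₂.unit a).mk
  mapComp W W' := (Hom₂.mul W W').mk
  mapComp_naturality_left η V := Quot.sound (Rel.mul_naturality_left η V)
  mapComp_naturality_right W _ _ η := Quot.sound (Rel.mul_naturality_right W η)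
  map₂_associator W₁ W₂ W₃ := Quot.sound (Rel.mul_assoc W₁ W₂ W₃)
  map₂_leftUnitor W := Quot.sound (Rel.unit_mul W)
  map₂_rightUnitor W := Quot.sound (Rel.mul_unit W)

end FreeLax

/-- The shadow category of the target of the free lax shadow functor on a graph. -/
abbrev FreeLaxSh (G : Type u₁) [Quiver.{v₁} G] : Type (max u₁ v₁) :=
  LaxSh (freeShadow (FreeBicategory G)) (FreeLax.functor G)

/-- The free lax shadow functor on a graph. -/
def freeLaxShadowFunctor (G : Type u₁) [Quiver.{v₁} G] :
    LaxShadowFunctor (freeShadow (FreeBicategory G))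
      (laxShShadow (freeShadow (FreeBicategory G)) (FreeLax.functor G)) :=
  laxShFunctor _ _

/-! ### Edges and blocks of formal words -/

section Words

variable {G : Type u₁} [Quiver.{v₁} G]

/-- The edges occurring in a 1-cell of the free bicategory, in order. -/
def bicatEdges : {a b : FreeBicategory G} → (a ⟶ b) → List (Σ x y : G, x ⟶ y)
  | _, _, .of f => [⟨_, _, f⟩]
  | _, _, .id _ => []
  | _, _, .comp f g => bicatEdges f ++ bicatEdges g

/-- The number of edges occurring in a 1-cell of the free bicategory. -/
def bicatNum : {a b : FreeBicategory G} → (a ⟶ b) → ℕ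
  | _, _, .of _ => 1
  | _, _, .id _ => 0
  | _, _, .comp f g => bicatNum f + bicatNum g

theorem length_bicatEdges : ∀ {a b : FreeBicategory G} (W : a ⟶ b),
    (bicatEdges W).length = bicatNum W
  | _, _, .of f => rfl
  | _, _, .id a => rfl
  | _, _, .comp f g => (List.length_append).trans
      (congrArg₂ (· + ·) (length_bicatEdges f) (length_bicatEdges g))

theorem bicatEdges_eq {a b : FreeBicategory G} {W W' : a ⟶ b} (η : W ⟶ W') :
    bicatEdges W = bicatEdges W' := by
  induction η using Quot.ind with
  | mk η =>
    induction η with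
    | id f => rfl
    | vcomp η θ h h' => exact h.trans h'
    | whisker_left f η h => exact congrArg (bicatEdges f ++ ·) h
    | whisker_right g η h => exact congrArg (· ++ bicatEdges g) h
    | associator f g h => exact List.append_assoc _ _ _
    | associator_inv f g h => exact (List.append_assoc _ _ _).symm
    | right_unitor f => exact List.append_nil _
    | right_unitor_inv f => exact (List.append_nil _).symm
    | left_unitor f => rfl
    | left_unitor_inv f => rfl

theorem bicatNum_eq {a b : FreeBicategory G} {W W' : a ⟶ b} (η : W ⟶ W') :
    bicatNum W = bicatNum W' := by
  rw [← length_bicatEdges, ← length_bicatEdges, bicatEdges_eq η]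

namespace FreeLax

/-- The edges occurring in a word, in order. -/
def edges : {a b : FreeLax G} → (a ⟶ b) → List (Σ x y : G, x ⟶ y)
  | _, _, Hom.blk W => bicatEdges W
  | _, _, Hom.id _ => []
  | _, _, Hom.comp f g => edges f ++ edges g

/-- The number of edges occurring in a word. -/
def num : {a b : FreeLax G} → (a ⟶ b) → ℕ
  | _, _, Hom.blk W => bicatNum W
  | _, _, Hom.id _ => 0
  | _, _, Hom.comp f g => num f + num g

/-- The number of symbols `F(W)` occurring in a word. -/
def blocks : {a b : FreeLax G} → (a ⟶ b) → ℕ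
  | _, _, Hom.blk _ => 1
  | _, _, Hom.id _ => 0
  | _, _, Hom.comp f g => blocks f + blocks g

theorem length_edges : ∀ {a b : FreeLax G} (f : a ⟶ b), (edges f).length = num f
  | _, _, Hom.blk W => length_bicatEdges W
  | _, _, Hom.id a => rfl
  | _, _, Hom.comp f g => (List.length_append).trans
      (congrArg₂ (· + ·) (length_edges f) (length_edges g))

theorem edges_eq {a b : FreeLax G} {f g : a ⟶ b} (η : f ⟶ g) : edges f = edges g := by
  induction η using Quot.ind with
  | mk η =>
    induction η with
    | refl f => rfl
    | vcomp η θ h h' => exact h.trans h'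
    | whiskerLeft f η h => exact congrArg (edges f ++ ·) h
    | whiskerRight η g h => exact congrArg (· ++ edges g) h
    | associator f g h => exact List.append_assoc _ _ _
    | associatorInv f g h => exact (List.append_assoc _ _ _).symm
    | rightUnitor f => exact List.append_nil _
    | rightUnitorInv f => exact (List.append_nil _).symm
    | leftUnitor f => rfl
    | leftUnitorInv f => rfl
    | map₂ η => exact bicatEdges_eq η
    | unit a => rfl
    | mul W W' => rfl

theorem num_eq {a b : FreeLax G} {f g : a ⟶ b} (η : f ⟶ g) : num f = num g := by
  rw [← length_edges, ← length_edges, edges_eq η]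

/-- The effect of a 2-cell on the ordered set of symbols `F(W)`: a unit `I ⟶ F(I)` inserts a new
point, a multiplication `F(W) F(W') ⟶ F(W W')` identifies two adjacent points, and all other
generators act trivially. -/
def Hom₂.onBlocks : {a b : FreeLax G} → {f g : a ⟶ b} → Hom₂ f g → DExpr (blocks f) (blocks g)
  | _, _, _, _, .refl f => .cast rfl
  | _, _, _, _, .vcomp η θ => .comp η.onBlocks θ.onBlocks
  | _, _, _, _, .whiskerLeft f η => .addLeft (blocks f) η.onBlocks
  | _, _, _, _, .whiskerRight η h => .addRight η.onBlocks (blocks h)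
  | _, _, _, _, .associator f g h => .cast (Nat.add_assoc (blocks f) (blocks g) (blocks h))
  | _, _, _, _, .associatorInv f g h =>
      .cast (Nat.add_assoc (blocks f) (blocks g) (blocks h)).symm
  | _, _, _, _, .rightUnitor f => .cast (Nat.add_zero (blocks f))
  | _, _, _, _, .rightUnitorInv f => .cast (Nat.add_zero (blocks f)).symm
  | _, _, _, _, .leftUnitor f => .cast (Nat.zero_add (blocks f))
  | _, _, _, _, .leftUnitorInv f => .cast (Nat.zero_add (blocks f)).symm
  | _, _, _, _, .map₂ _ => .cast rfl
  | _, _, _, _, .unit _ => .face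
  | _, _, _, _, .mul _ _ => .deg

@[simp] theorem blocks_comp {a b c : FreeLax G} (f : a ⟶ b) (g : b ⟶ c) :
    blocks (f ≫ g) = blocks f + blocks g := rfl

@[simp] theorem blocks_id (a : FreeLax G) : blocks (𝟙 a) = 0 := rfl

@[simp] theorem blocks_block {a b : FreeBicategory G} (W : a ⟶ b) : blocks (block W) = 1 := rfl

theorem onBlocks_congr {a b : FreeLax G} {f g : a ⟶ b} {η θ : Hom₂ f g} (h : Rel η θ) :
    ∀ (p q N M : ℕ) (hN : N = p + blocks f + q) (hM : M = p + blocks g + q),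
      η.onBlocks.real p q N M hN hM = θ.onBlocks.real p q N M hN hM := by
  induction h with
  | vcomp_right η θ₁ θ₂ _ ih =>
    intro p q N M hN hM
    simp only [Hom₂.onBlocks, DExpr.real, ih]
  | vcomp_left η₁ η₂ θ _ ih =>
    intro p q N M hN hM
    simp only [Hom₂.onBlocks, DExpr.real, ih]
  | whiskerLeft_congr f g h η η' _ ih =>
    intro p q N M hN hM
    exact ih _ _ _ _ _ _
  | whiskerRight_congr f g h η η' _ ih =>
    intro p q N M hN hM
    exact ih _ _ _ _ _ _
  | whisker_exchange η θ =>
    rename_i f g h i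
    intro p q N M hN hM
    have := DExpr.interchange η.onBlocks θ.onBlocks p 0 q N (p + (blocks g + blocks h) + q)
      (p + (blocks f + blocks i) + q) M (by simp at hN; omega) (by omega) (by omega)
      (by simp at hM; omega)
    simp only [Hom₂.onBlocks, DExpr.real, blocks_comp]
    rw [DExpr.real_congr η.onBlocks rfl (show blocks i + q = 0 + blocks i + q by omega),
      DExpr.real_congr η.onBlocks rfl (show blocks h + q = 0 + blocks h + q by omega)]
    exact this.symm
  | id_comp η =>
    intro p q N M hN hM; subst hN hM
    simp [Hom₂.onBlocks, DExpr.real]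
  | comp_id η =>
    intro p q N M hN hM; subst hN hM
    simp [Hom₂.onBlocks, DExpr.real]
  | assoc η θ ι => intro p q N M hN hM; simp [Hom₂.onBlocks, DExpr.real]
  | whiskerLeft_id f g => intro p q N M hN hM; simp [Hom₂.onBlocks, DExpr.real]
  | id_whiskerRight f g => intro p q N M hN hM; simp [Hom₂.onBlocks, DExpr.real]
  | whiskerLeft_comp f η θ =>
    intro p q N M hN hM
    rename_i g h i
    simp only [blocks_comp] at hN hM
    exact DExpr.real_comp η.onBlocks θ.onBlocks (p + blocks f) q N
      (p + (blocks f + blocks h) + q) M (by omega) (by omega) (by omega)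
  | comp_whiskerRight i η θ =>
    intro p q N M hN hM
    rename_i f g h
    simp only [blocks_comp] at hN hM
    exact DExpr.real_comp η.onBlocks θ.onBlocks p (blocks i + q) N
      (p + (blocks g + blocks i) + q) M (by omega) (by omega) (by omega)
  | id_whiskerLeft η =>
    intro p q N M hN hM
    simp only [Hom₂.onBlocks, DExpr.real, blocks_id, blocks_comp] at hN hM ⊢
    rw [DExpr.real_eqToHom_right _ (by omega), DExpr.real_eqToHom_left _ (by omega)]
    rfl
  | whiskerRight_id η =>
    intro p q N M hN hM
    simp only [Hom₂.onBlocks, DExpr.real, blocks_id, blocks_comp] at hN hM ⊢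
    rw [DExpr.real_eqToHom_right _ (by omega), DExpr.real_eqToHom_left _ (by omega)]
    exact DExpr.real_congr _ rfl (by omega) _ _
  | comp_whiskerLeft f g η =>
    intro p q N M hN hM
    simp only [Hom₂.onBlocks, DExpr.real, blocks_comp] at hN hM ⊢
    rw [DExpr.real_eqToHom_right _ (by omega), DExpr.real_eqToHom_left _ (by omega)]
    exact DExpr.real_congr _ (by omega) rfl _ _
  | whiskerRight_comp g h η =>
    intro p q N M hN hM
    simp only [Hom₂.onBlocks, DExpr.real, blocks_comp] at hN hM ⊢
    rw [DExpr.real_eqToHom_right _ (by omega), DExpr.real_eqToHom_left _ (by omega)]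
    exact DExpr.real_congr _ rfl (by omega) _ _
  | whisker_assoc f η h =>
    intro p q N M hN hM
    simp only [Hom₂.onBlocks, DExpr.real, blocks_comp] at hN hM ⊢
    rw [DExpr.real_eqToHom_right _ (by omega), DExpr.real_eqToHom_left _ (by omega)]
  | mul_naturality_left η V =>
    intro p q N M hN hM
    simp only [blocks_comp, blocks_block] at hN hM
    subst hN hM
    simp [Hom₂.onBlocks, DExpr.real]
  | mul_naturality_right W η =>
    intro p q N M hN hM
    simp only [blocks_comp, blocks_block] at hN hM
    subst hN hM
    simp [Hom₂.onBlocks, DExpr.real]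
  | mul_assoc W₁ W₂ W₃ =>
    intro p q N M hN hM
    simp only [blocks_comp, blocks_block] at hN hM
    subst hN hM
    have := Lam.s_s (p + (1 + 1 + 1) + q) (p + (1 + 1) + q) (p + 1 + q) (p + 1) (p + 1)
      (by omega) (by omega) (by omega) (by omega) (by omega)
    simpa [Hom₂.onBlocks, DExpr.real] using this
  | unit_mul W =>
    intro p q N M hN hM
    simp only [blocks_block] at hN hM
    subst hN hM
    have := Lam.d_s_eq (p + 1 + q) (p + (1 + 1) + q) (p + 1)
      (by omega) (by omega) (by omega)
    simp [Hom₂.onBlocks, DExpr.real]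
    exact this.symm
  | mul_unit W =>
    intro p q N M hN hM
    simp only [blocks_block] at hN hM
    subst hN hM
    have := Lam.d_s_succ (p + 1 + q) (p + (1 + 1) + q) (p + 1)
      (by omega) (by omega) (by omega)
    simp [Hom₂.onBlocks, DExpr.real]
    exact this.symm
  | _ => intro p q N M hN hM; simp [Hom₂.onBlocks, DExpr.real]

end FreeLax
end Words

/-! ### The supporting functor and the underlying permutation functor -/

/-- The map `n ⟶ 1` of ordered sets. -/
def DExpr.fold : (n : ℕ) → DExpr n 1
  | 0 => .face
  | n + 1 => .comp (.addRight (fold n) 1) .deg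

theorem DExpr.cast_real {k l : ℕ} (h : k = l) (p q N M : ℕ) (hN : N = p + k + q)
    (hM : M = p + l + q) : (cast h).real p q N M hN hM = eqToHom (by rw [hN, hM, h]) := rfl

theorem DExpr.fold_zero_real (p q N M : ℕ) (hN : N = p + 0 + q) (hM : M = p + 1 + q) :
    (fold 0).real p q N M hN hM = Lam.d N M (p + 1) (by omega) (by omega) (by omega) := rfl

theorem DExpr.fold_succ_real (n p q N K M : ℕ) (hN : N = p + (n + 1) + q) (hK : K = p + 2 + q)
    (hM : M = p + 1 + q) :
    (fold (n + 1)).real p q N M hN hM =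
      (fold n).real p (1 + q) N K (by omega) (by omega) ≫
        Lam.s K M (p + 1) (by omega) (by omega) (by omega) := by
  subst hK; rfl

theorem DExpr.fold_add_real (a b : ℕ) : ∀ (p q N K L M : ℕ) (hN : N = p + (a + b) + q)
    (hK : K = p + 1 + b + q) (hL : L = p + 2 + q) (hM : M = p + 1 + q),
    (fold a).real p (b + q) N K (by omega) (by omega) ≫
      (fold b).real (p + 1) q K L (by omega) (by omega) ≫
        Lam.s L M (p + 1) (by omega) (by omega) (by omega) =
      (fold (a + b)).real p q N M hN hM := by
  induction b with
  | zero =>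
    intro p q N K L M hN hK hL hM
    obtain rfl : K = M := by omega
    rw [fold_zero_real, Lam.d_s_succ K L (p + 1) (by omega) (by omega) (by omega), Category.comp_id]
    exact real_congr _ rfl (by omega) _ _
  | succ b ih =>
    intro p q N K L M hN hK hL hM
    rw [fold_succ_real b (p + 1) q K (L + 1) L (by omega) (by omega) (by omega), Category.assoc,
      ← Lam.s_s (L + 1) L M (p + 1) (p + 1) (by omega) (by omega) (by omega) (by omega) (by omega)]
    have := ih p (1 + q) N K (L + 1) L (by omega) (by omega) (by omega) (by omega)
    have h2 := fold_succ_real (a + b) p q N L M (by omega) (by omega) (by omega)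
    rw [← this] at h2
    rw [real_congr (fold a) rfl (show b + 1 + q = b + (1 + q) by omega)]
    simp only [Category.assoc] at h2 ⊢
    exact h2.symm

section Supporting

variable {G : Type u₁} [Quiver.{v₁} G]

namespace FreeLax

/-- The map of ordered sets from the edges of a word to its symbols `F(W)`, sending an edge to the
symbol containing it. -/
def groups : {a b : FreeLax G} → (f : a ⟶ b) → DExpr (num f) (blocks f)
  | _, _, Hom.blk W => .fold (bicatNum W)
  | _, _, Hom.id _ => .cast rfl
  | _, _, Hom.comp f g => .comp (.addRight (groups f) (num g)) (.addLeft (blocks f) (groups g))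

@[simp] theorem num_comp {a b c : FreeLax G} (f : a ⟶ b) (g : b ⟶ c) :
    num (f ≫ g) = num f + num g := rfl

@[simp] theorem num_id (a : FreeLax G) : num (𝟙 a) = 0 := rfl

@[simp] theorem num_block {a b : FreeBicategory G} (W : a ⟶ b) : num (block W) = bicatNum W := rfl

@[simp] theorem bicatNum_comp {a b c : FreeBicategory G} (W : a ⟶ b) (W' : b ⟶ c) :
    bicatNum (W ≫ W') = bicatNum W + bicatNum W' := rfl

theorem groups_comp_real {a b c : FreeLax G} (f : a ⟶ b) (g : b ⟶ c) (p q N K M : ℕ)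
    (hN : N = p + num (f ≫ g) + q) (hK : K = p + blocks f + num g + q)
    (hM : M = p + blocks (f ≫ g) + q) :
    (groups (f ≫ g)).real p q N M hN hM =
      (groups f).real p (num g + q) N K (by rw [hN, num_comp]; omega) (by omega) ≫
        (groups g).real (p + blocks f) q K M hK (by rw [hM, blocks_comp]; omega) :=
  DExpr.real_comp (.addRight (groups f) (num g)) (.addLeft (blocks f) (groups g)) p q N K M
    hN (by omega) hM

theorem groups_id_real (a : FreeLax G) (p q N M : ℕ) (hN : N = p + num (𝟙 a) + q)
    (hM : M = p + blocks (𝟙 a) + q) :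
    (groups (𝟙 a)).real p q N M hN hM = eqToHom (by rw [hN, hM]; rfl) := rfl

theorem groups_block_real {a b : FreeBicategory G} (W : a ⟶ b) (p q N M : ℕ)
    (hN : N = p + num (block W) + q) (hM : M = p + blocks (block W) + q) :
    (groups (block W)).real p q N M hN hM = (DExpr.fold (bicatNum W)).real p q N M hN hM := rfl

theorem groups_comp_id_real {a b : FreeLax G} (f : a ⟶ b) (p q N M : ℕ)
    (hN : N = p + num (f ≫ 𝟙 b) + q) (hM : M = p + blocks (f ≫ 𝟙 b) + q) :
    (groups (f ≫ 𝟙 b)).real p q N M hN hM =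
      (groups f).real p q N M (by rw [hN, num_comp, num_id]; omega)
        (by rw [hM, blocks_comp, blocks_id]; omega) := by
  rw [groups_comp_real f (𝟙 b) p q N M M hN (by rw [hM, blocks_comp, blocks_id, num_id]; omega) hM,
    groups_id_real, eqToHom_refl, Category.comp_id]
  exact DExpr.real_congr _ rfl (by rw [num_id]; omega) _ _

theorem groups_id_comp_real {a b : FreeLax G} (f : a ⟶ b) (p q N M : ℕ)
    (hN : N = p + num (𝟙 a ≫ f) + q) (hM : M = p + blocks (𝟙 a ≫ f) + q) :
    (groups (𝟙 a ≫ f)).real p q N M hN hM =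
      (groups f).real p q N M (by rw [hN, num_comp, num_id]; omega)
        (by rw [hM, blocks_comp, blocks_id]; omega) := by
  rw [groups_comp_real (𝟙 a) f p q N N M hN (by rw [hN, num_comp, num_id, blocks_id]; omega) hM,
    groups_id_real, eqToHom_refl, Category.id_comp]
  rfl

theorem groups_assoc_real {a b c d : FreeLax G} (f : a ⟶ b) (g : b ⟶ c) (h : c ⟶ d)
    (p q N M : ℕ) (hN : N = p + num ((f ≫ g) ≫ h) + q) (hM : M = p + blocks ((f ≫ g) ≫ h) + q)
    (hN' : N = p + num (f ≫ g ≫ h) + q) (hM' : M = p + blocks (f ≫ g ≫ h) + q) :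
    (groups ((f ≫ g) ≫ h)).real p q N M hN hM = (groups (f ≫ g ≫ h)).real p q N M hN' hM' := by
  rw [groups_comp_real (f ≫ g) h p q N _ M hN rfl hM,
    groups_comp_real f g p (num h + q) N (p + blocks f + num (g ≫ h) + q) _
      (by rw [hN, num_comp]; omega) (by rw [num_comp]; omega) (by omega),
    groups_comp_real f (g ≫ h) p q N _ M hN' rfl hM',
    groups_comp_real g h (p + blocks f) q (p + blocks f + num (g ≫ h) + q)
      (p + blocks (f ≫ g) + num h + q) M rfl (by rw [blocks_comp]; omega)
      (by rw [hM', blocks_comp]; omega), Category.assoc]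
  rw [DExpr.real_congr (groups f) rfl (show num g + (num h + q) = num (g ≫ h) + q by
      rw [num_comp]; omega),
    DExpr.real_congr (groups h) (show p + blocks (f ≫ g) = p + blocks f + blocks g by
      rw [blocks_comp]; omega) rfl]

theorem fold_real_congr {m n : ℕ} (h : m = n) (p q N M : ℕ) (hN : N = p + m + q)
    (hM : M = p + 1 + q) :
    (DExpr.fold m).real p q N M hN hM = (DExpr.fold n).real p q N M (by omega) hM := by
  subst h; rfl

theorem groups_natural {a b : FreeLax G} {f g : a ⟶ b} (η : Hom₂ f g) :
    ∀ (p q N K M : ℕ) (hN : N = p + num f + q) (hN' : N = p + num g + q)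
      (hK : K = p + blocks f + q) (hM : M = p + blocks g + q),
      (groups f).real p q N K hN hK ≫ η.onBlocks.real p q K M hK hM =
        (groups g).real p q N M hN' hM := by
  induction η with
  | refl f =>
    intro p q N K M hN hN' hK hM
    subst hK hM
    simp [Hom₂.onBlocks, DExpr.real]
  | vcomp η θ ih ih' =>
    rename_i f g h
    intro p q N K M hN hN' hK hM
    have := num_eq η.mk
    rw [Hom₂.onBlocks, DExpr.real_comp _ _ p q K (p + blocks g + q) M hK rfl hM,
      ← Category.assoc, ih p q N K _ hN (by omega) hK rfl, ih' p q N _ M (by omega) hN' rfl hM]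
  | whiskerLeft f η ih =>
    rename_i g h
    intro p q N K M hN hN' hK hM
    have e := num_eq η.mk
    have hN₁ := hN; have hN₂ := hN'; have hK₁ := hK; have hM₁ := hM
    simp only [num_comp, blocks_comp] at hN₁ hN₂ hK₁ hM₁
    rw [groups_comp_real f g p q N (p + blocks f + num g + q) K hN rfl hK,
      groups_comp_real f h p q N (p + blocks f + num g + q) M hN' (by omega) hM, Category.assoc]
    have := ih (p + blocks f) q (p + blocks f + num g + q) K M rfl (by omega) (by omega) (by omega)
    rw [← this]
    exact congrArg (· ≫ _) (DExpr.real_congr _ rfl (by omega) _ _)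
  | whiskerRight η h ih =>
    rename_i f g
    intro p q N K M hN hN' hK hM
    have e := num_eq η.mk
    have hN₁ := hN; have hN₂ := hN'; have hK₁ := hK; have hM₁ := hM
    simp only [num_comp, blocks_comp] at hN₁ hN₂ hK₁ hM₁
    rw [groups_comp_real f h p q N (p + blocks f + num h + q) K hN rfl hK,
      groups_comp_real g h p q N (p + blocks g + num h + q) M hN' rfl hM, Category.assoc,
      ← ih p (num h + q) N (p + blocks f + num h + q) (p + blocks g + num h + q) (by omega)
        (by omega) (by omega) (by omega), Category.assoc]
    have := DExpr.interchange η.onBlocks (groups h) p 0 q (p + blocks f + num h + q)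
      (p + blocks g + num h + q) K M (by omega) (by omega) (by omega) (by omega)
    rw [DExpr.real_congr η.onBlocks rfl (show 0 + num h + q = num h + q by omega),
      DExpr.real_congr η.onBlocks rfl (show 0 + blocks h + q = blocks h + q by omega)] at this
    exact congrArg (_ ≫ ·) this.symm
  | associator f g h =>
    intro p q N K M hN hN' hK hM
    have hM₁ := hM
    simp only [blocks_comp, blocks_id, blocks_block] at hK hM₁
    refine (DExpr.real_eqToHom_right _ (by omega) _ _ _).trans ?_
    exact groups_assoc_real f g h p q N M _ _ _ _
  | associatorInv f g h =>
    intro p q N K M hN hN' hK hM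
    have hM₁ := hM
    simp only [blocks_comp, blocks_id, blocks_block] at hK hM₁
    refine (DExpr.real_eqToHom_right _ (by omega) _ _ _).trans ?_
    exact (groups_assoc_real f g h p q N M _ _ _ _).symm
  | rightUnitor f =>
    intro p q N K M hN hN' hK hM
    have hM₁ := hM
    simp only [blocks_comp, blocks_id, blocks_block] at hK hM₁
    refine (DExpr.real_eqToHom_right _ (by omega) _ _ _).trans ?_
    exact groups_comp_id_real f p q N M _ _
  | rightUnitorInv f =>
    intro p q N K M hN hN' hK hM
    have hM₁ := hM
    simp only [blocks_comp, blocks_id, blocks_block] at hK hM₁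
    refine (DExpr.real_eqToHom_right _ (by omega) _ _ _).trans ?_
    exact (groups_comp_id_real f p q N M _ _).symm
  | leftUnitor f =>
    intro p q N K M hN hN' hK hM
    have hM₁ := hM
    simp only [blocks_comp, blocks_id, blocks_block] at hK hM₁
    refine (DExpr.real_eqToHom_right _ (by omega) _ _ _).trans ?_
    exact groups_id_comp_real f p q N M _ _
  | leftUnitorInv f =>
    intro p q N K M hN hN' hK hM
    have hM₁ := hM
    simp only [blocks_comp, blocks_id, blocks_block] at hK hM₁
    refine (DExpr.real_eqToHom_right _ (by omega) _ _ _).trans ?_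
    exact (groups_id_comp_real f p q N M _ _).symm
  | map₂ η =>
    intro p q N K M hN hN' hK hM
    have hM₁ := hM
    simp only [blocks_comp, blocks_id, blocks_block] at hK hM₁
    refine (DExpr.real_eqToHom_right _ (by omega) _ _ _).trans ?_
    exact fold_real_congr (bicatNum_eq η) p q N M _ _
  | unit a =>
    intro p q N K M hN hN' hK hM
    obtain rfl : N = K := by rw [hN, hK, num_id, blocks_id]
    rw [groups_id_real, eqToHom_refl]
    exact Category.id_comp _
  | mul W W' =>
    intro p q N K M hN hN' hK hM
    have hN₁ := hN; have hN₂ := hN'; have hK₁ := hK; have hM₁ := hM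
    simp only [num_comp, num_block, blocks_comp, blocks_block, bicatNum_comp] at hN₁ hN₂ hK₁ hM₁
    rw [groups_comp_real (block W) (block W') p q N (p + 1 + bicatNum W' + q) K hN rfl hK,
      Category.assoc]
    exact DExpr.fold_add_real (bicatNum W) (bicatNum W') p q N (p + 1 + bicatNum W' + q) K M
      (by rw [hN₁]) rfl (by omega) (by omega)

end FreeLax
end Supporting

section SupportAndPermutation

variable (G : Type u₁) [Quiver.{v₁} G]

theorem lift_w {V : Type u₁} [Quiver.{v₁} V] {C : Type u₂} [Category.{v₂} C] (φ : V ⥤q C) {x y : V}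
    (g : x ⟶ y) : (Paths.lift φ).map ((Paths.of V).map g) = φ.map g :=
  Paths.lift_toPath φ g

namespace FreeLax

variable {G}

/-- The map of `Λ'` given by the effect of a 2-cell on the symbols `F(W)`. -/
def onBlocks {a b : FreeLax G} {f g : a ⟶ b} (η : f ⟶ g) :
    Lam.fin (blocks f) ⟶ Lam.fin (blocks g) :=
  Quot.lift (fun η : Hom₂ f g => η.onBlocks.real 0 0 _ _ (by omega) (by omega))
    (fun _ _ h => onBlocks_congr h 0 0 _ _ _ _) η

/-- The cycle of `k + l` points that moves the first `k` of them to the end. -/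
def cycleFlip (k l : ℕ) : Lam.fin (k + l) ⟶ Lam.fin (l + k) :=
  Lam.rot (k + l) k ≫ eqToHom (by rw [Nat.add_comm])

theorem rot_eqToHom {n m : ℕ} (h : n = m) (k : ℕ) (h' : Lam.fin n = Lam.fin m) :
    Lam.rot n k ≫ eqToHom h' = eqToHom h' ≫ Lam.rot m k := by
  subst h; simp

theorem cycleFlip_cycleFlip (k l : ℕ) : cycleFlip k l ≫ cycleFlip l k = 𝟙 _ := by
  rw [cycleFlip, cycleFlip, Category.assoc, ← Category.assoc (eqToHom _),
    ← rot_eqToHom (Nat.add_comm k l)]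
  rw [Category.assoc, ← Category.assoc (Lam.rot _ _), ← Lam.rot_add, Lam.rot_self]
  simp

theorem real_cycleFlip {k l : ℕ} (e : DExpr k l) (r : ℕ) :
    e.real 0 r (k + r) (l + r) (by omega) (by omega) ≫ cycleFlip l r =
      cycleFlip k r ≫ e.real r 0 (r + k) (r + l) (by omega) (by omega) := by
  have := e.real_rot 0 0 r (k + r) (l + r) (by omega) (by omega)
  rw [cycleFlip, cycleFlip, Category.assoc, DExpr.real_eqToHom_left e (Nat.add_comm k r),
    DExpr.real_congr e rfl (show r = 0 + r by omega)]
  have h2 : 0 + l + 0 = l := by omega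
  have h3 : 0 + k + 0 = k := by omega
  rw [h2, h3] at this
  rw [← Category.assoc, this, Category.assoc, DExpr.real_eqToHom_right e (Nat.add_comm l r)]
  rfl

theorem real_cycleFlip' {k l : ℕ} (e : DExpr k l) (r : ℕ) :
    e.real r 0 (r + k) (r + l) (by omega) (by omega) ≫ cycleFlip r l =
      cycleFlip r k ≫ e.real 0 r (k + r) (l + r) (by omega) (by omega) := by
  have := congrArg (fun z => cycleFlip r k ≫ z ≫ cycleFlip r l) (real_cycleFlip e r)
  simp only [Category.assoc, cycleFlip_cycleFlip, Category.comp_id] at this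
  rw [← Category.assoc (cycleFlip r k) (cycleFlip k r), cycleFlip_cycleFlip,
    Category.id_comp] at this
  exact this.symm

theorem cycleFlip_assoc (k l m : ℕ) (h₁ : Lam.fin (m + (k + l)) = Lam.fin ((m + k) + l))
    (h₂ : Lam.fin ((k + l) + m) = Lam.fin (k + (l + m)))
    (h₃ : Lam.fin ((l + m) + k) = Lam.fin (l + (m + k))) :
    cycleFlip (k + l) m ≫ eqToHom h₁ ≫ cycleFlip (m + k) l =
      eqToHom h₂ ≫ cycleFlip k (l + m) ≫ eqToHom h₃ := by
  have key : ∀ (n n' : ℕ) (h : n = n') (h' : Lam.fin n = Lam.fin n') (a : ℕ),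
      eqToHom h' ≫ Lam.rot n' a = Lam.rot n a ≫ eqToHom h' := by
    intro n n' h h' a; subst h; simp
  simp only [cycleFlip, Category.assoc, eqToHom_trans, eqToHom_trans_assoc]
  rw [← Category.assoc (eqToHom _) (Lam.rot _ _), ← Category.assoc (eqToHom _) (Lam.rot _ _),
    key _ _ (by omega), key _ _ (by omega)]
  simp only [Category.assoc, eqToHom_trans]
  rw [← Category.assoc, ← Lam.rot_add, show k + l + (m + k) = (k + l + m) + k by omega,
    Lam.rot_add, Lam.rot_self, Category.id_comp]

theorem cycleFlip_zero_right (k : ℕ) : cycleFlip k 0 = eqToHom (by rw [Nat.add_comm]) := by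
  rw [cycleFlip]
  exact (congrArg (· ≫ _) (Lam.rot_self k)).trans (Category.id_comp _)

theorem cycleFlip_zero_left (k : ℕ) : cycleFlip 0 k = eqToHom (by rw [Nat.add_comm]) := by
  simp [cycleFlip, Lam.rot]

theorem cycleFlip_one_one :
    cycleFlip 1 1 ≫ Lam.s 2 1 1 rfl le_rfl le_rfl ≫ Lam.t =
      Lam.s 2 1 1 rfl le_rfl le_rfl ≫ Lam.t := by
  rw [Lam.s_t]
  have : cycleFlip 1 1 = Lam.cyc 2 := by
    simp [cycleFlip, Lam.rot]
  rw [this, ← Category.assoc (Lam.cyc 2) (Lam.cyc 2),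
    show Lam.cyc 2 ≫ Lam.cyc 2 = Lam.rot 2 2 by simp [Lam.rot], Lam.rot_self]
  rw [Category.id_comp, ← Lam.s_t]

/-- The object of `Λ'` supporting an object of the free lax shadow category: the number of symbols
`F(W)` inside `⟨-⟩`, or `*` for an object in the image of `H`. -/
def supportObj : LaxShObj (freeShadow (FreeBicategory G)) (functor G) → Lam
  | .out _ => Lam.star
  | .inn f => Lam.fin (blocks f)

/-- The map of `Λ'` supporting a generator. -/
def supportMap : {x y : LaxShObj (freeShadow (FreeBicategory G)) (functor G)} →
    LaxShGen _ _ x y → (supportObj x ⟶ supportObj y)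
  | _, _, .hmap _ => 𝟙 Lam.star
  | _, _, .sh η => onBlocks η
  | _, _, .rot f g => cycleFlip (blocks f) (blocks g)
  | _, _, .rotInv f g => cycleFlip (blocks g) (blocks f)
  | _, _, .s _ => Lam.t

end FreeLax

open FreeLax in
/-- The functor sending a morphism to its supporting map in `Λ'`. -/
def support : FreeLaxSh G ⥤ Lam :=
  CategoryTheory.Quotient.lift _ (Paths.lift { obj := supportObj, map := supportMap }) (by
    rintro x y p q h
    induction h with
    | map_id x => 
      simp only [Functor.map_comp, Functor.map_id, LaxShGen.w, lift_w]; rfl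
    | map_comp φ ψ =>
      simp only [Functor.map_comp, Functor.map_id, LaxShGen.w, lift_w]
      exact (Category.id_comp _).symm
    | sh_id f => 
      simp only [Functor.map_comp, Functor.map_id, LaxShGen.w, lift_w]; rfl
    | sh_comp η θ =>
      simp only [Functor.map_comp, Functor.map_id, LaxShGen.w, lift_w]
      induction η using Quot.ind with | mk η
      induction θ using Quot.ind with | mk θ
      exact DExpr.real_comp _ _ 0 0 _ _ _ _ _ _
    | rot_rotInv f g =>
      simp only [Functor.map_comp, Functor.map_id, LaxShGen.w, lift_w]
      exact cycleFlip_cycleFlip _ _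
    | rotInv_rot f g =>
      simp only [Functor.map_comp, Functor.map_id, LaxShGen.w, lift_w]
      exact cycleFlip_cycleFlip _ _
    | rot_naturality_left η g =>
      simp only [Functor.map_comp, Functor.map_id, LaxShGen.w, lift_w]
      induction η using Quot.ind with | mk η
      refine Eq.trans ?_ ((real_cycleFlip η.onBlocks (blocks g)).trans ?_)
      · exact congrArg (· ≫ _) (DExpr.real_congr _ rfl rfl _ _)
      · exact congrArg (_ ≫ ·) (DExpr.real_congr η.onBlocks (Nat.zero_add (blocks g)).symm rfl _ _)
    | rot_naturality_right f η =>
      simp only [Functor.map_comp, Functor.map_id, LaxShGen.w, lift_w]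
      induction η using Quot.ind with | mk η
      refine Eq.trans ?_ ((real_cycleFlip' η.onBlocks (blocks f)).trans ?_)
      · exact congrArg (· ≫ _) (DExpr.real_congr η.onBlocks (Nat.zero_add (blocks f)) rfl _ _)
      · exact congrArg (_ ≫ ·) (DExpr.real_congr _ rfl rfl _ _)
    | rot_assoc f g h =>
      simp only [Functor.map_comp, Functor.map_id, LaxShGen.w, lift_w]
      exact cycleFlip_assoc (blocks f) (blocks g) (blocks h) (by rw [Nat.add_assoc])
        (by rw [Nat.add_assoc]) (by rw [Nat.add_assoc])
    | rot_id_right f =>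
      simp only [Functor.map_comp, Functor.map_id, LaxShGen.w, lift_w]
      refine (congrArg (· ≫ onBlocks (λ_ f).hom) (cycleFlip_zero_right (blocks f))).trans ?_
      exact eqToHom_trans (congrArg Lam.fin (Nat.add_comm (blocks f) 0))
        (congrArg Lam.fin (Nat.zero_add (blocks f)))
    | rot_id_left f =>
      simp only [Functor.map_comp, Functor.map_id, LaxShGen.w, lift_w]
      refine (congrArg (· ≫ onBlocks (ρ_ f).hom) (cycleFlip_zero_left (blocks f))).trans ?_
      exact eqToHom_trans (congrArg Lam.fin (Nat.add_comm 0 (blocks f)))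
        (congrArg Lam.fin (Nat.add_zero (blocks f)))
    | s_naturality η =>
      simp only [Functor.map_comp, Functor.map_id, LaxShGen.w, lift_w]
      exact (Category.id_comp _).trans (Category.comp_id _).symm
    | s_rot f g =>
      simp only [Functor.map_comp, Functor.map_id, LaxShGen.w, lift_w]
      refine cycleFlip_one_one.trans ?_
      exact congrArg (_ ≫ ·) (Category.comp_id _).symm)

/-- Finite sets `{0, …, n - 1}`, with bijections as morphisms. -/
structure FinBij : Type where
  card : ℕ

instance : Category FinBij where
  Hom x y := Fin x.card ≃ Fin y.card
  id x := Equiv.refl _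
  comp e f := e.trans f

namespace FinBij

theorem hom_ext {x y : FinBij} {e f : x ⟶ y}
    (h : ∀ i : Fin x.card, (e.toFun i).val = (f.toFun i).val) : e = f :=
  Equiv.ext fun i => Fin.ext (h i)

/-- The identity map of positions. -/
def ofEq {k l : ℕ} (h : k = l) : (⟨k⟩ : FinBij) ⟶ ⟨l⟩ := finCongr h

/-- The bijection that moves the first `k` of `k + l` positions to the end. -/
def flip (k l : ℕ) : (⟨k + l⟩ : FinBij) ⟶ ⟨l + k⟩ := finAddFlip (m := k) (n := l)

theorem ofEq_val {k l : ℕ} (h : k = l) (i : Fin k) : ((ofEq h).toFun i).val = i.val := rfl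

theorem flip_val (k l : ℕ) (i : Fin (k + l)) :
    ((flip k l).toFun i).val = if i.val < k then l + i.val else i.val - k := by
  show (finAddFlip (m := k) (n := l) i).val = _
  refine Fin.addCases (fun j => ?_) (fun j => ?_) i <;> simp

theorem comp_val {x y z : FinBij} (e : x ⟶ y) (f : y ⟶ z) (i : Fin x.card) :
    ((e ≫ f).toFun i).val = (f.toFun (e.toFun i)).val := rfl

theorem flip_flip (k l : ℕ) : flip k l ≫ flip l k = 𝟙 _ := by
  refine hom_ext fun i => ?_
  have hi : i.val < k + l := i.isLt
  rw [comp_val, flip_val, flip_val]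
  change _ = i.val
  split_ifs <;> omega

theorem ofEq_flip {k k' : ℕ} (h : k = k') (l : ℕ) (h₁ : k + l = k' + l) (h₂ : l + k = l + k') :
    ofEq h₁ ≫ flip k' l = flip k l ≫ ofEq h₂ := by
  subst h; rfl

theorem ofEq_flip' {k k' : ℕ} (h : k = k') (l : ℕ) (h₁ : l + k = l + k') (h₂ : k + l = k' + l) :
    ofEq h₁ ≫ flip l k' = flip l k ≫ ofEq h₂ := by
  subst h; rfl

theorem flip_assoc (k l m : ℕ) :
    flip (k + l) m ≫ ofEq (Nat.add_assoc m k l).symm ≫ flip (m + k) l =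
      ofEq (Nat.add_assoc k l m) ≫ flip k (l + m) ≫ ofEq (Nat.add_assoc l m k) := by
  refine hom_ext fun i => ?_
  have hi : i.val < k + l + m := i.isLt
  have e : ((ofEq (Nat.add_assoc k l m)).toFun i).val = i.val := rfl
  have e' : ((ofEq (Nat.add_assoc m k l).symm).toFun ((flip (k + l) m).toFun i)).val =
    ((flip (k + l) m).toFun i).val := rfl
  rw [comp_val, comp_val, comp_val, comp_val, ofEq_val (Nat.add_assoc l m k), flip_val (m + k) l,
    flip_val k (l + m)]
  rw [flip_val (k + l) m i] at e'
  split_ifs at e' ⊢ <;> omega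

theorem flip_zero_right (k : ℕ) : flip k 0 ≫ ofEq (Nat.zero_add k) = ofEq (Nat.add_zero k) := by
  refine hom_ext fun i => ?_
  have hi : i.val < k + 0 := i.isLt
  simp only [comp_val, flip_val, ofEq_val]
  split_ifs <;> omega

theorem flip_zero_left (k : ℕ) : flip 0 k ≫ ofEq (Nat.add_zero k) = ofEq (Nat.zero_add k) := by
  refine hom_ext fun i => ?_
  have hi : i.val < 0 + k := i.isLt
  simp only [comp_val, flip_val, ofEq_val]
  split_ifs <;> omega

end FinBij

variable {G} in
/-- The bijection of edges underlying a generator of the free shadow on a free bicategory. -/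
def shadowPermutationMap : {x y : ShObj (FreeBicategory G)} → ShGen x y →
    ((⟨bicatNum x.cell⟩ : FinBij) ⟶ ⟨bicatNum y.cell⟩)
  | _, _, .sh η => FinBij.ofEq (bicatNum_eq η)
  | _, _, .rot f g => FinBij.flip (bicatNum f) (bicatNum g)
  | _, _, .rotInv f g => FinBij.flip (bicatNum g) (bicatNum f)

/-- The functor sending a morphism of the free shadow category on a free bicategory to its
underlying cyclic permutation of edges. -/
def shadowPermutation : FreeSh (FreeBicategory G) ⥤ FinBij :=
  CategoryTheory.Quotient.lift _
    (Paths.lift { obj := fun x => ⟨bicatNum x.cell⟩, map := shadowPermutationMap }) (by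
    have key : ∀ {x y : ShObj (FreeBicategory G)} (g : ShGen x y),
        (Paths.lift (V := ShObj (FreeBicategory G)) (C := FinBij)
          { obj := fun x => ⟨bicatNum x.cell⟩, map := shadowPermutationMap }).map g.w =
          shadowPermutationMap g := fun g => lift_w (V := ShObj (FreeBicategory G)) (C := FinBij)
            { obj := fun x => ⟨bicatNum x.cell⟩, map := shadowPermutationMap } g
    rintro x y p q h
    induction h <;> simp only [Functor.map_comp, Functor.map_id, key]
    case sh_id => rfl
    case sh_comp => rfl
    case rot_rotInv => exact FinBij.flip_flip _ _
    case rotInv_rot => exact FinBij.flip_flip _ _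
    case rot_naturality_left η g => exact FinBij.ofEq_flip (bicatNum_eq η) _ _ _
    case rot_naturality_right f _ _ η => exact FinBij.ofEq_flip' (bicatNum_eq η) _ _ _
    case rot_assoc => exact FinBij.flip_assoc _ _ _
    case rot_id_right => exact FinBij.flip_zero_right _
    case rot_id_left => exact FinBij.flip_zero_left _)

namespace FreeLax

variable {G}

/-- The number of edges in an object of the free lax shadow category. -/
def permutationObj : LaxShObj (freeShadow (FreeBicategory G)) (functor G) → FinBij
  | .out x => (shadowPermutation G).obj x
  | .inn f => ⟨num f⟩

/-- The bijection of edges underlying a generator. -/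
def permutationMap : {x y : LaxShObj (freeShadow (FreeBicategory G)) (functor G)} →
    LaxShGen _ _ x y → (permutationObj x ⟶ permutationObj y)
  | _, _, .hmap φ => (shadowPermutation G).map φ
  | _, _, .sh η => FinBij.ofEq (num_eq η)
  | _, _, .rot f g => FinBij.flip (num f) (num g)
  | _, _, .rotInv f g => FinBij.flip (num g) (num f)
  | _, _, .s f => 𝟙 (⟨bicatNum f⟩ : FinBij)

end FreeLax

open FreeLax in
/-- The functor sending a morphism of the free lax shadow category to its underlying cyclic
permutation of edges. -/
def permutation : FreeLaxSh G ⥤ FinBij :=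
  CategoryTheory.Quotient.lift _ (Paths.lift { obj := permutationObj, map := permutationMap }) (by
    rintro x y p q h
    induction h <;> simp only [Functor.map_comp, Functor.map_id, LaxShGen.w, lift_w]
    case map_id x => exact (shadowPermutation G).map_id x
    case map_comp φ ψ => exact (shadowPermutation G).map_comp φ ψ
    case sh_id => rfl
    case sh_comp => rfl
    case rot_rotInv => exact FinBij.flip_flip _ _
    case rotInv_rot => exact FinBij.flip_flip _ _
    case rot_naturality_left η g => exact FinBij.ofEq_flip (num_eq η) _ _ _
    case rot_naturality_right f _ _ η => exact FinBij.ofEq_flip' (num_eq η) _ _ _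
    case rot_assoc => exact FinBij.flip_assoc _ _ _
    case rot_id_right => exact FinBij.flip_zero_right _
    case rot_id_left => exact FinBij.flip_zero_left _
    case s_naturality η => rfl
    case s_rot => rfl)

end SupportAndPermutation

/-! ### The supporting functor on the component of an aperiodic list -/

section Component

variable {G : Type u₁} [Quiver.{v₁} G]

/-- No nontrivial rotation of the list returns the same list. -/
def Aperiodic {X : Type u₂} (l : List X) : Prop :=
  ∀ r, 0 < r → r < l.length → l.rotate r ≠ l

theorem Aperiodic.rot_eq {X : Type u₂} {l : List X} (h : Aperiodic l) {a b : ℕ}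
    (hab : l.rotate a = l.rotate b) : Lam.rot l.length a = Lam.rot l.length b := by
  rcases Nat.eq_zero_or_pos l.length with h0 | h0
  · have : ∀ n c, n = 0 → Lam.rot n c = 𝟙 _ := by
      rintro n c rfl
      induction c with
      | zero => rfl
      | succ c ih => simp [Lam.rot, Lam.cyc, ih]
    rw [this _ a h0, this _ b h0]
  · have main : ∀ a b, a ≤ b → b < l.length → l.rotate a = l.rotate b → a = b := by
      intro a b hle hb hab
      by_contra hne
      refine h (b - a) (by omega) (by omega) ?_
      have h2 : (l.rotate (b - a)).rotate a = l.rotate a := by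
        rw [List.rotate_rotate, Nat.sub_add_cancel hle, hab]
      exact List.rotate_injective a h2
    rw [← Lam.rot_mod _ a, ← Lam.rot_mod _ b]
    rw [← List.rotate_mod l a, ← List.rotate_mod l b] at hab
    have ha := Nat.mod_lt a h0
    have hb := Nat.mod_lt b h0
    rcases Nat.le_total (a % l.length) (b % l.length) with hl | hl
    · rw [main _ _ hl hb hab]
    · rw [main _ _ hl ha hab.symm]

/-- The edges of an object of the free shadow category on a free bicategory. -/
def shadowEdges (x : FreeSh (FreeBicategory G)) : List (Σ a b : G, a ⟶ b) :=
  bicatEdges (ShObj.cell (show ShObj (FreeBicategory G) from x.as))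

theorem quotientPaths_induction {V : Type u₂} [Quiver.{v₂} V] (r : HomRel (Paths V))
    (P : ∀ a b : V, ((Quotient.functor r).obj ((Paths.of V).obj a) ⟶
      (Quotient.functor r).obj ((Paths.of V).obj b)) → Prop)
    (nil : ∀ a, P a a (𝟙 _))
    (cons : ∀ a b c φ (g : b ⟶ c), P a b φ →
      P a c (φ ≫ (Quotient.functor r).map ((Paths.of V).map g))) :
    ∀ a b φ, P a b φ := by
  intro a b φ
  obtain ⟨p, rfl⟩ := (Quotient.functor r).map_surjective φ
  change Quiver.Path a b at p
  induction p with
  | nil => exact nil a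
  | cons p g ih => exact cons _ _ _ _ g ih

theorem exists_rotate {x y : FreeSh (FreeBicategory G)} (φ : x ⟶ y) :
    ∃ c, shadowEdges y = (shadowEdges x).rotate c := by
  refine quotientPaths_induction (ShRel (B := FreeBicategory G))
    (fun a b _ => ∃ c, bicatEdges b.cell = (bicatEdges a.cell).rotate c)
    (fun a => ⟨0, by simp⟩) ?_ x.as y.as φ
  rintro a b c φ g ⟨n, hn⟩
  change ShGen b c at g
  cases g with
  | sh η => exact ⟨n, (bicatEdges_eq η).symm.trans hn⟩
  | rot f g =>
    refine ⟨n + (bicatEdges f).length, ?_⟩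
    rw [← List.rotate_rotate, ← hn]
    exact (List.rotate_append_length_eq (bicatEdges f) (bicatEdges g)).symm
  | rotInv f g =>
    refine ⟨n + (bicatEdges g).length, ?_⟩
    rw [← List.rotate_rotate, ← hn]
    exact (List.rotate_append_length_eq (bicatEdges g) (bicatEdges f)).symm

theorem fold_one_real (p q N M : ℕ) (hN : N = p + 1 + q) (hM : M = p + 1 + q) :
    (DExpr.fold 1).real p q N M hN hM = eqToHom (by rw [hN, hM]) := by
  obtain rfl : N = M := by omega
  rw [DExpr.fold_succ_real 0 p q N (N + 1) N hN (by omega) hM, DExpr.fold_zero_real]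
  exact Lam.d_s_eq N (N + 1) (p + 1) (by omega) (by omega) (by omega)

/-- The map `n ⟶ *` of `Λ'`. -/
def toStar (n : ℕ) : Lam.fin n ⟶ Lam.star :=
  (DExpr.fold n).real 0 0 n 1 (by omega) (by omega) ≫ Lam.t

theorem cyc_toStar (n : ℕ) : Lam.cyc n ≫ toStar n = toStar n := by
  cases n with
  | zero => exact Category.id_comp _
  | succ b =>
    have key : Lam.rot (b + 1) b ≫ toStar (b + 1) = toStar (b + 1) := by
      have h1 := DExpr.fold_add_real 1 b 0 0 (b + 1) (b + 1) 2 1 (by omega) (by omega) (by omega)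
        (by omega)
      rw [fold_one_real, eqToHom_refl, Category.id_comp] at h1
      have h2 := DExpr.fold_succ_real b 0 0 (b + 1) 2 1 (by omega) (by omega) (by omega)
      have h3 := (DExpr.fold b).real_rot 0 0 1 (b + 1) 2 (by omega) (by omega)
      have h4 : (DExpr.fold (1 + b)).real 0 0 (b + 1) 1 (by omega) (by omega) =
          (DExpr.fold (b + 1)).real 0 0 (b + 1) 1 (by omega) (by omega) :=
        FreeLax.fold_real_congr (by omega) _ _ _ _ _ _
      have h5 : Lam.rot 2 1 ≫ Lam.s 2 1 1 rfl le_rfl le_rfl ≫ Lam.t =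
          Lam.s 2 1 1 rfl le_rfl le_rfl ≫ Lam.t := by
        rw [Lam.s_t]; simp only [Lam.rot, Category.comp_id]
        rw [← Category.assoc, show Lam.cyc 2 ≫ Lam.cyc 2 = Lam.rot 2 2 by simp [Lam.rot],
          Lam.rot_self, Category.id_comp, ← Lam.s_t]
      have h6 : toStar (b + 1) = (DExpr.fold b).real 1 0 (b + 1) 2 (by omega) (by omega) ≫
          Lam.s 2 1 1 rfl le_rfl le_rfl ≫ Lam.t := by
        rw [toStar, ← h4, ← h1, Category.assoc]
      have h7 : toStar (b + 1) = (DExpr.fold b).real 0 1 (b + 1) 2 (by omega) (by omega) ≫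
          Lam.s 2 1 1 rfl le_rfl le_rfl ≫ Lam.t := by
        rw [toStar, h2, Category.assoc]
      have h8 : (DExpr.fold b).real 0 1 (b + 1) 2 (by omega) (by omega) ≫ Lam.rot 2 1 =
          Lam.rot (b + 1) b ≫ (DExpr.fold b).real 1 0 (b + 1) 2 (by omega) (by omega) := by
        have e : 0 + b + 0 = b := by omega
        rw [e] at h3
        exact h3
      conv_lhs => rw [h6]
      rw [← Category.assoc, ← h8, Category.assoc, h5, h7]
    conv_lhs => rw [← key]
    rw [← Category.assoc, show Lam.cyc (b + 1) ≫ Lam.rot (b + 1) b = Lam.rot (b + 1) (b + 1) from rfl,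
      Lam.rot_self, Category.id_comp]

theorem rot_toStar (n c : ℕ) : Lam.rot n c ≫ toStar n = toStar n := by
  induction c with
  | zero => exact Category.id_comp _
  | succ c ih => rw [Lam.rot, Category.assoc, ih, cyc_toStar]

namespace FreeLax

/-- The edges of an object of the free lax shadow category, in order. -/
def objEdges : LaxShObj (freeShadow (FreeBicategory G)) (functor G) → List (Σ a b : G, a ⟶ b)
  | .out x => shadowEdges x
  | .inn f => edges f

/-- The map of `Λ'` from the edges of an object: an edge goes to the symbol `F(W)` containing it,
or to `*`. -/
def objGroups : (x : LaxShObj (freeShadow (FreeBicategory G)) (functor G)) → (N : ℕ) →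
    N = (objEdges x).length → (Lam.fin N ⟶ supportObj x)
  | .out _, N, _ => toStar N
  | .inn f, N, h => (groups f).real 0 0 N (blocks f)
      (by rw [h, objEdges, length_edges]; omega) (by omega)

theorem groups_cycleFlip {a b : FreeLax G} (f : a ⟶ b) (g : b ⟶ a) :
    (groups (f ≫ g)).real 0 0 (num f + num g) (blocks f + blocks g)
        (by rw [num_comp]; omega) (by rw [blocks_comp]; omega) ≫ cycleFlip (blocks f) (blocks g) =
      cycleFlip (num f) (num g) ≫
        (groups (g ≫ f)).real 0 0 (num g + num f) (blocks g + blocks f)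
          (by rw [num_comp]; omega) (by rw [blocks_comp]; omega) := by
  have h1 := groups_comp_real f g 0 0 (num f + num g) (blocks f + num g) (blocks f + blocks g)
    (by rw [num_comp]; omega) (by omega) (by rw [blocks_comp]; omega)
  have h2 := groups_comp_real g f 0 0 (num g + num f) (blocks g + num f) (blocks g + blocks f)
    (by rw [num_comp]; omega) (by omega) (by rw [blocks_comp]; omega)
  have h3 := real_cycleFlip' (groups g) (blocks f)
  have h4 := real_cycleFlip (groups f) (num g)
  have h5 := DExpr.interchange (groups g) (groups f) 0 0 0 (num g + num f) (blocks g + num f)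
    (num g + blocks f) (blocks g + blocks f) (by omega) (by omega) (by omega) (by omega)
  rw [h1, h2, DExpr.real_congr (groups g) (Nat.zero_add (blocks f)) rfl, Category.assoc, h3,
    ← Category.assoc]
  refine (congrArg (· ≫ _) h4).trans ?_
  rw [Category.assoc]
  refine congrArg (_ ≫ ·) ?_
  refine Eq.trans ?_ (h5.symm.trans ?_)
  · rw [DExpr.real_congr (groups f) (show 0 + num g + 0 = num g by omega) rfl,
      DExpr.real_congr (groups g) rfl (show 0 + blocks f + 0 = blocks f by omega)]
  · rw [DExpr.real_congr (groups g) rfl (show 0 + num f + 0 = num f + 0 by omega),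
      DExpr.real_congr (groups f) (show 0 + blocks g + 0 = 0 + blocks g by omega) rfl]

theorem objGroups_rot {a b : FreeLax G} (f : a ⟶ b) (g : b ⟶ a) (N : ℕ)
    (h : N = (objEdges (.inn (f ≫ g))).length) (h' : N = (objEdges (.inn (g ≫ f))).length) :
    objGroups (.inn (f ≫ g)) N h ≫ supportMap (.rot f g) =
      Lam.rot N (num f) ≫ objGroups (.inn (g ≫ f)) N h' := by
  have hN : N = num f + num g := by rw [h, objEdges, length_edges, num_comp]
  subst hN
  refine (groups_cycleFlip f g).trans ?_
  rw [cycleFlip, Category.assoc]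
  exact congrArg (_ ≫ ·) (DExpr.real_eqToHom_left _ (Nat.add_comm (num f) (num g)) _ _ _)

theorem objGroups_gen {x y : LaxShObj (freeShadow (FreeBicategory G)) (functor G)}
    (g : LaxShGen _ _ x y) :
    ∃ c, objEdges y = (objEdges x).rotate c ∧
      ∀ N (h : N = (objEdges x).length) (h' : N = (objEdges y).length),
        objGroups x N h ≫ supportMap g = Lam.rot N c ≫ objGroups y N h' := by
  cases g with
  | hmap φ =>
    obtain ⟨c, hc⟩ := exists_rotate φ
    refine ⟨c, hc, fun N h h' => ?_⟩
    exact (Category.comp_id _).trans (rot_toStar N c).symm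
  | sh η =>
    rename_i a f g
    refine ⟨0, (edges_eq η).symm.trans (List.rotate_zero _).symm, fun N h h' => ?_⟩
    refine Eq.trans ?_ (Category.id_comp _).symm
    induction η using Quot.ind with
    | mk η =>
      exact groups_natural η 0 0 N (blocks f) (blocks g) (by rw [h, objEdges, length_edges]; omega)
        (by rw [h', objEdges, length_edges]; omega) (by omega) (by omega)
  | rot f g =>
    refine ⟨num f, ?_, objGroups_rot f g⟩
    rw [← length_edges]
    exact (List.rotate_append_length_eq (edges f) (edges g)).symm
  | rotInv f g =>
    refine ⟨num g, ?_, objGroups_rot g f⟩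
    rw [← length_edges]
    exact (List.rotate_append_length_eq (edges g) (edges f)).symm
  | s f =>
    refine ⟨0, (List.rotate_zero _).symm, fun N h h' => ?_⟩
    refine Eq.trans ?_ (Category.id_comp _).symm
    exact congrArg (· ≫ Lam.t) (fold_real_congr
      (show bicatNum f = N by rw [h, objEdges, length_edges]; rfl) 0 0 N 1 _ _)

/-- The edges of an object of the free lax shadow category, in order. -/
def listOf (x : FreeLaxSh G) : List (Σ a b : G, a ⟶ b) :=
  objEdges (show LaxShObj (freeShadow (FreeBicategory G)) (functor G) from x.as)

/-- The map of `Λ'` from the edges of an object to its symbols `F(W)`, or to `*`. -/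
def groupsOf (x : FreeLaxSh G) (N : ℕ) (h : N = (listOf x).length) :
    Lam.fin N ⟶ (support G).obj x :=
  objGroups (show LaxShObj (freeShadow (FreeBicategory G)) (functor G) from x.as) N h

theorem comp_square {C : Type u₂} [Category.{v₂} C] {n x y z : C} {a : n ⟶ x} {b : n ⟶ y}
    {c : n ⟶ z} {u : x ⟶ y} {v : y ⟶ z} {r s : n ⟶ n} (h : a ≫ u = r ≫ b) (h' : b ≫ v = s ≫ c) :
    a ≫ u ≫ v = (r ≫ s) ≫ c := by
  rw [← Category.assoc, h, Category.assoc, h', Category.assoc]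

theorem exists_support {x y : FreeLaxSh G} (φ : x ⟶ y) :
    ∃ c, listOf y = (listOf x).rotate c ∧
      ∀ N (h : N = (listOf x).length) (h' : N = (listOf y).length),
        groupsOf x N h ≫ (support G).map φ = Lam.rot N c ≫ groupsOf y N h' := by
  refine quotientPaths_induction
    (LaxShRel (freeShadow (FreeBicategory G)) (functor G))
    (fun a b φ => ∃ c, objEdges b = (objEdges a).rotate c ∧
      ∀ N (h : N = (objEdges a).length) (h' : N = (objEdges b).length),
        groupsOf (LaxSh.ob a) N h ≫ (support G).map φ = Lam.rot N c ≫ groupsOf (LaxSh.ob b) N h') ?_ ?_ x.as y.as φ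
  · intro a
    refine ⟨0, (List.rotate_zero _).symm, fun N h h' => ?_⟩
    refine Eq.trans ?_ (Category.id_comp _).symm
    exact (congrArg (groupsOf (LaxSh.ob a) N h ≫ ·) ((support G).map_id _)).trans
      (Category.comp_id _)
  · rintro a b c φ g ⟨n, hn, hn'⟩
    obtain ⟨m, hm, hm'⟩ := objGroups_gen g
    refine ⟨n + m, by rw [hm, hn, List.rotate_rotate], fun N h h' => ?_⟩
    have e : N = (objEdges b).length := by rw [h, hn, List.length_rotate]
    have e' : (support G).map ((Quotient.functor _).map ((Paths.of _).map g)) = supportMap g :=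
      lift_w _ g
    refine (congrArg (groupsOf (LaxSh.ob a) N h ≫ ·)
      (((support G).map_comp φ _).trans (congrArg (_ ≫ ·) e'))).trans ?_
    rw [Lam.rot_add]
    exact comp_square (hn' N h e) (hm' N e h')

theorem exists_rotation {x y : FreeLaxSh G} (h : Zigzag x y) :
    ∃ r, (listOf x).rotate r = listOf y := by
  change listOf x ~r listOf y
  induction h with
  | refl => exact List.IsRotated.refl _
  | tail _ h ih =>
    refine ih.trans ?_
    rcases h with ⟨⟨φ⟩⟩ | ⟨⟨φ⟩⟩
    · obtain ⟨c, hc, -⟩ := exists_support φ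
      exact ⟨c, hc.symm⟩
    · obtain ⟨c, hc, -⟩ := exists_support φ
      exact List.IsRotated.symm ⟨c, hc.symm⟩

end FreeLax

open FreeLax in
/-- An object `y` of the component of `x` has the same edges as `x` up to a rotation `r`. -/
theorem exists_rotation_component {x : FreeLaxSh G} (y : (CategoryTheory.ConnectedComponents.mk x).Component) :
    ∃ r, (listOf x).rotate r = listOf y.obj :=
  exists_rotation (Zigzag.symm (Quotient.exact y.property))

open FreeLax in
/-- The supporting functor from the component of an object `x` with an aperiodic list of `n` edges
to the comma category `n ↓ Λ'`. An object `y` of the component is sent to the map from the edges of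
`x`, identified with the edges of `y` by a rotation, to the symbols `F(W)` of `y`. -/
noncomputable def componentSupport (x : FreeLaxSh G) (hx : Aperiodic (listOf x)) :
    (CategoryTheory.ConnectedComponents.mk x).Component ⥤ Under (Lam.fin (listOf x).length) where
  obj y := Under.mk (Lam.rot (listOf x).length (exists_rotation_component y).choose ≫
    groupsOf y.obj (listOf x).length
      (by rw [← (exists_rotation_component y).choose_spec, List.length_rotate]))
  map {y z} φ := Under.homMk ((support G).map φ.hom) (by
    obtain ⟨c, hc, hc'⟩ := exists_support φ.hom
    have hy := (exists_rotation_component y).choose_spec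
    have hz := (exists_rotation_component z).choose_spec
    rw [← hy, List.rotate_rotate] at hc
    have hr := hx.rot_eq (hz.trans hc)
    have := hc' (listOf x).length (by rw [← hy, List.length_rotate])
      (by rw [← hz, List.length_rotate])
    simp only [Under.mk_hom, Category.assoc]
    refine (congrArg (_ ≫ ·) this).trans ?_
    rw [← Category.assoc, ← Lam.rot_add]
    exact congrArg (· ≫ _) hr.symm)
  map_id y := by ext; exact (support G).map_id _
  map_comp φ ψ := by ext; exact (support G).map_comp _ _

end Component

/-! ### Formal evaluation -/

section Evaluation

namespace FreeLax

variable {G : Type u₁} [Quiver.{v₁} G] {D : Type u₃} [Bicategory.{w₂, v₃} D]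
variable (K : LaxFunctor (FreeBicategory G) D)

/-- Evaluation of words along a lax functor. -/
def evalHom : {a b : FreeLax G} → (a ⟶ b) → (K.obj a.pt ⟶ K.obj b.pt)
  | _, _, Hom.blk W => K.map W
  | _, _, Hom.id a => 𝟙 (K.obj a.pt)
  | _, _, Hom.comp f g => evalHom f ≫ evalHom g

/-- Evaluation of representatives of 2-cells along a lax functor. -/
def evalHom₂ : {a b : FreeLax G} → {f g : a ⟶ b} → Hom₂ f g → (evalHom K f ⟶ evalHom K g)
  | _, _, _, _, .refl f => 𝟙 (evalHom K f)
  | _, _, _, _, .vcomp η θ => evalHom₂ η ≫ evalHom₂ θ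
  | _, _, _, _, .whiskerLeft f η => evalHom K f ◁ evalHom₂ η
  | _, _, _, _, .whiskerRight η h => evalHom₂ η ▷ evalHom K h
  | _, _, _, _, .associator f g h => (α_ (evalHom K f) (evalHom K g) (evalHom K h)).hom
  | _, _, _, _, .associatorInv f g h => (α_ (evalHom K f) (evalHom K g) (evalHom K h)).inv
  | _, _, _, _, .rightUnitor f => (ρ_ (evalHom K f)).hom
  | _, _, _, _, .rightUnitorInv f => (ρ_ (evalHom K f)).inv
  | _, _, _, _, .leftUnitor f => (λ_ (evalHom K f)).hom
  | _, _, _, _, .leftUnitorInv f => (λ_ (evalHom K f)).inv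
  | _, _, _, _, .map₂ η => K.map₂ η
  | _, _, _, _, .unit a => K.mapId a
  | _, _, _, _, .mul W W' => K.mapComp W W'

theorem evalHom₂_congr {a b : FreeLax G} {f g : a ⟶ b} {η θ : Hom₂ f g} (h : Rel η θ) :
    evalHom₂ K η = evalHom₂ K θ := by
  induction h with
  | vcomp_right η θ₁ θ₂ _ ih => exact congrArg (evalHom₂ K η ≫ ·) ih
  | vcomp_left η₁ η₂ θ _ ih => exact congrArg (· ≫ evalHom₂ K θ) ih
  | id_comp η => exact Category.id_comp _
  | comp_id η => exact Category.comp_id _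
  | assoc η θ ι => exact Category.assoc _ _ _
  | whiskerLeft_congr f g h η η' _ ih => exact congrArg (evalHom K f ◁ ·) ih
  | whiskerLeft_id f g => exact whiskerLeft_id _ _
  | whiskerLeft_comp f η θ => exact whiskerLeft_comp _ _ _
  | id_whiskerLeft η => exact id_whiskerLeft _
  | comp_whiskerLeft f g η => exact comp_whiskerLeft _ _ _
  | whiskerRight_congr f g h η η' _ ih => exact congrArg (· ▷ evalHom K h) ih
  | id_whiskerRight f g => exact id_whiskerRight _ _
  | comp_whiskerRight i η θ => exact comp_whiskerRight _ _ _
  | whiskerRight_id η => exact whiskerRight_id _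
  | whiskerRight_comp g h η => exact whiskerRight_comp _ _ _
  | whisker_assoc f η h => exact whisker_assoc _ _ _
  | whisker_exchange η θ => exact whisker_exchange _ _
  | associator_hom_inv f g h => exact Iso.hom_inv_id _
  | associator_inv_hom f g h => exact Iso.inv_hom_id _
  | leftUnitor_hom_inv f => exact Iso.hom_inv_id _
  | leftUnitor_inv_hom f => exact Iso.inv_hom_id _
  | rightUnitor_hom_inv f => exact Iso.hom_inv_id _
  | rightUnitor_inv_hom f => exact Iso.inv_hom_id _
  | pentagon f g h i => exact pentagon _ _ _ _
  | triangle f g => exact triangle _ _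
  | map₂_id W => exact K.map₂_id W
  | map₂_comp η θ => exact K.map₂_comp η θ
  | mul_naturality_left η V => exact K.mapComp_naturality_left η V
  | mul_naturality_right W η => exact K.mapComp_naturality_right W η
  | mul_assoc W₁ W₂ W₃ => exact K.map₂_associator W₁ W₂ W₃
  | unit_mul W => exact K.map₂_leftUnitor W
  | mul_unit W => exact K.map₂_rightUnitor W

/-- Evaluation of 2-cells along a lax functor. -/
def eval₂ {a b : FreeLax G} {f g : a ⟶ b} (η : f ⟶ g) : evalHom K f ⟶ evalHom K g :=
  Quot.lift (evalHom₂ K) (fun _ _ h => evalHom₂_congr K h) η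

theorem eval₂_id {a b : FreeLax G} (f : a ⟶ b) : eval₂ K (𝟙 f) = 𝟙 (evalHom K f) := rfl

theorem eval₂_comp {a b : FreeLax G} {f g h : a ⟶ b} (η : f ⟶ g) (θ : g ⟶ h) :
    eval₂ K (η ≫ θ) = eval₂ K η ≫ eval₂ K θ := by
  induction η using Quot.ind
  induction θ using Quot.ind
  rfl

theorem eval₂_whiskerLeft {a b c : FreeLax G} (f : a ⟶ b) {g h : b ⟶ c} (η : g ⟶ h) :
    eval₂ K (f ◁ η) = evalHom K f ◁ eval₂ K η := by
  induction η using Quot.ind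
  rfl

theorem eval₂_whiskerRight {a b c : FreeLax G} {f g : a ⟶ b} (η : f ⟶ g) (h : b ⟶ c) :
    eval₂ K (η ▷ h) = eval₂ K η ▷ evalHom K h := by
  induction η using Quot.ind
  rfl

end FreeLax

namespace LaxShadowFunctor

open FreeLax

variable {G : Type u₁} [Quiver.{v₁} G] {D : Type u₃} [Bicategory.{w₂, v₃} D] {D' : Type u₄}
  [Category.{v₄} D'] {T : Shadow D D'}
variable (Ψ : LaxShadowFunctor (freeShadow (FreeBicategory G)) T)

/-- The object named by an object of the free lax shadow category. -/
def evalObj : LaxShObj (freeShadow (FreeBicategory G)) (functor G) → D'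
  | .out x => Ψ.H.obj x
  | .inn (a := a) f => (T.sh (Ψ.F.obj a.pt)).obj (evalHom Ψ.F f)

/-- The morphism named by a generator. -/
def evalMap : {x y : LaxShObj (freeShadow (FreeBicategory G)) (functor G)} → LaxShGen _ _ x y →
    (Ψ.evalObj x ⟶ Ψ.evalObj y)
  | _, _, .hmap φ => Ψ.H.map φ
  | _, _, .sh η => (T.sh _).map (eval₂ Ψ.F η)
  | _, _, .rot f g => (T.rot (evalHom Ψ.F f) (evalHom Ψ.F g)).hom
  | _, _, .rotInv f g => (T.rot (evalHom Ψ.F f) (evalHom Ψ.F g)).inv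
  | _, _, .s W => Ψ.s W

/-- The functor from the free lax shadow category induced by a lax shadow functor on the free
bicategory with shadow. -/
def extend : FreeLaxSh G ⥤ D' :=
  CategoryTheory.Quotient.lift _ (Paths.lift { obj := Ψ.evalObj, map := Ψ.evalMap }) (by
    rintro x y p q h
    induction h <;> simp only [Functor.map_comp, Functor.map_id, LaxShGen.w, lift_w]
    case map_id x => exact Ψ.H.map_id x
    case map_comp φ ψ => exact Ψ.H.map_comp φ ψ
    case sh_id => exact (T.sh _).map_id _
    case sh_comp η θ =>
      exact (congrArg (T.sh _).map (eval₂_comp Ψ.F η θ)).trans ((T.sh _).map_comp _ _)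
    case rot_rotInv => exact Iso.hom_inv_id _
    case rotInv_rot => exact Iso.inv_hom_id _
    case rot_naturality_left f f' η g =>
      have := T.rot_naturality_left (eval₂ Ψ.F η) (evalHom Ψ.F g)
      rw [← eval₂_whiskerLeft, ← eval₂_whiskerRight] at this
      exact this
    case rot_naturality_right f _ _ η =>
      have := T.rot_naturality_right (evalHom Ψ.F f) (eval₂ Ψ.F η)
      rw [← eval₂_whiskerLeft, ← eval₂_whiskerRight] at this
      exact this
    case rot_assoc f g h => exact T.rot_assoc (evalHom Ψ.F f) (evalHom Ψ.F g) (evalHom Ψ.F h)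
    case rot_id_right f => exact T.rot_id_right (evalHom Ψ.F f)
    case rot_id_left f => exact T.rot_id_left (evalHom Ψ.F f)
    case s_naturality η => exact Ψ.s_naturality η
    case s_rot f g => exact Ψ.s_rot f g)

end LaxShadowFunctor

section Counit

variable (C : Type u₁) [Bicategory.{w₁, v₁} C]

/-- The pseudofunctor to `C` from the free bicategory on its underlying graph. -/
abbrev counit : Pseudofunctor (FreeBicategory C) C := FreeBicategory.lift (Prefunctor.id C)

variable {C} {C' : Type u₂} [Category.{v₂} C'] (S : Shadow C C')

/-- The morphism named by a generator of the free shadow category. -/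
def Shadow.evalMap : {x y : ShObj (FreeBicategory C)} → ShGen x y →
    ((S.sh ((counit C).obj x.pt)).obj ((counit C).map x.cell) ⟶
      (S.sh ((counit C).obj y.pt)).obj ((counit C).map y.cell))
  | _, _, .sh η => (S.sh _).map ((counit C).map₂ η)
  | _, _, .rot f g => (S.rot ((counit C).map f) ((counit C).map g)).hom
  | _, _, .rotInv f g => (S.rot ((counit C).map f) ((counit C).map g)).inv

/-- The functor to the shadow category of `C` from the free shadow category on the underlying graph
of `C`. -/
def Shadow.counit : FreeSh (FreeBicategory C) ⥤ C' :=
  CategoryTheory.Quotient.lift _ (Paths.lift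
    { obj := fun x => (S.sh ((LaxShadow.counit C).obj x.pt)).obj ((LaxShadow.counit C).map x.cell)
      map := S.evalMap }) (by
    have key : ∀ {x y : ShObj (FreeBicategory C)} (g : ShGen x y),
        (Paths.lift (V := ShObj (FreeBicategory C)) (C := C')
          { obj := fun x =>
              (S.sh ((LaxShadow.counit C).obj x.pt)).obj ((LaxShadow.counit C).map x.cell)
            map := S.evalMap }).map g.w = S.evalMap g :=
      fun g => lift_w (V := ShObj (FreeBicategory C)) (C := C') _ g
    rintro x y p q h
    induction h <;> simp only [Functor.map_comp, Functor.map_id, key]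
    case sh_id f =>
      exact (congrArg (S.sh _).map ((LaxShadow.counit C).map₂_id f)).trans ((S.sh _).map_id _)
    case sh_comp η θ =>
      exact (congrArg (S.sh _).map ((LaxShadow.counit C).map₂_comp η θ)).trans
        ((S.sh _).map_comp _ _)
    case rot_rotInv => exact Iso.hom_inv_id _
    case rotInv_rot => exact Iso.inv_hom_id _
    case rot_naturality_left f f' η g =>
      induction η using Quot.ind with | mk η
      exact S.rot_naturality_left (FreeBicategory.liftHom₂ (Prefunctor.id C) η)
        (FreeBicategory.liftHom (Prefunctor.id C) g)
    case rot_naturality_right f _ _ η =>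
      induction η using Quot.ind with | mk η
      exact S.rot_naturality_right (FreeBicategory.liftHom (Prefunctor.id C) f)
        (FreeBicategory.liftHom₂ (Prefunctor.id C) η)
    case rot_assoc f g h => exact S.rot_assoc _ _ _
    case rot_id_right f => exact S.rot_id_right _
    case rot_id_left f => exact S.rot_id_left _)

theorem Shadow.counit_map {x y : ShObj (FreeBicategory C)} (g : ShGen x y) :
    S.counit.map (FreeSh.gen g) = S.evalMap g :=
  lift_w (V := ShObj (FreeBicategory C)) (C := C') _ g

variable {S} {D : Type u₃} [Bicategory.{w₂, v₃} D] {D' : Type u₄} [Category.{v₄} D']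
  {T : Shadow D D'} (Φ : LaxShadowFunctor S T)

/-- The restriction of a lax shadow functor to the free bicategory with shadow on the underlying
graph of its source. -/
def LaxShadowFunctor.restrict : LaxShadowFunctor (freeShadow (FreeBicategory C)) T where
  F := (counit C).toLax.comp Φ.F
  H := S.counit ⋙ Φ.H
  s f := Φ.s ((counit C).map f)
  s_naturality {a f g} η :=
    (Φ.s_naturality ((counit C).map₂ η)).trans
      (congrArg (fun z => Φ.s ((counit C).map f) ≫ Φ.H.map z) (S.counit_map (.sh η)).symm)
  s_rot {a b} f g := by
    have h : ∀ {c d e : FreeBicategory C} (f : c ⟶ d) (g : d ⟶ e),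
        ((counit C).toLax.comp Φ.F).mapComp f g =
          Φ.F.mapComp ((counit C).map f) ((counit C).map g) := fun f g =>
      (congrArg (Φ.F.mapComp ((counit C).map f) ((counit C).map g) ≫ ·) (Φ.F.map₂_id _)).trans
        (Category.comp_id _)
    rw [h, h]
    exact (Φ.s_rot ((counit C).map f) ((counit C).map g)).trans
      (congrArg (fun z => _ ≫ Φ.s ((counit C).map (f ≫ g)) ≫ Φ.H.map z)
        (S.counit_map (.rot f g)).symm)

/-- The evaluation functor along which formal diagrams of a lax shadow functor lift. -/
def LaxShadowFunctor.eval : FreeLaxSh C ⥤ D' := Φ.restrict.extend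

end Counit

end Evaluation

/-! ### Reversing 2-cells -/

section Dual

/-- The bicategory `B` with its 2-cells reversed. -/
structure Co (B : Type u₁) : Type u₁ where
  pt : B

namespace Co

variable {B : Type u₁} [Bicategory.{w₁, v₁} B]

/-- The 1-cells of `Co B` are those of `B`. -/
structure Hom₁ (a b : Co B) : Type v₁ where
  cell : a.pt ⟶ b.pt

/-- A 2-cell `f ⟶ g` of `Co B` is a 2-cell `g ⟶ f` of `B`. -/
@[ext]
structure Hom₂ {a b : Co B} (f g : Hom₁ a b) : Type w₁ where
  cell : g.cell ⟶ f.cell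

instance : CategoryStruct.{v₁} (Co B) where
  Hom a b := Hom₁ a b
  id a := ⟨𝟙 a.pt⟩
  comp f g := ⟨f.cell ≫ g.cell⟩

instance homCategory (a b : Co B) : Category.{w₁} (a ⟶ b) where
  Hom f g := Hom₂ f g
  id f := ⟨𝟙 f.cell⟩
  comp η θ := ⟨θ.cell ≫ η.cell⟩
  id_comp η := Hom₂.ext (Category.comp_id η.cell)
  comp_id η := Hom₂.ext (Category.id_comp η.cell)
  assoc η θ ι := Hom₂.ext (Category.assoc ι.cell θ.cell η.cell).symm

/-- An invertible 2-cell of `B` as an invertible 2-cell of `Co B`. -/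
def iso {a b : Co B} {f g : a ⟶ b} (e : f.cell ≅ g.cell) : f ≅ g where
  hom := ⟨e.inv⟩
  inv := ⟨e.hom⟩
  hom_inv_id := Hom₂.ext e.hom_inv_id
  inv_hom_id := Hom₂.ext e.inv_hom_id

instance bicategory : Bicategory.{w₁, v₁} (Co B) where
  homCategory := homCategory
  whiskerLeft f _ _ η := ⟨f.cell ◁ η.cell⟩
  whiskerRight η h := ⟨η.cell ▷ h.cell⟩
  associator f g h := iso (α_ f.cell g.cell h.cell)
  leftUnitor f := iso (λ_ f.cell)
  rightUnitor f := iso (ρ_ f.cell)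
  whiskerLeft_id f g := Hom₂.ext (whiskerLeft_id f.cell g.cell)
  whiskerLeft_comp f _ _ _ η θ := Hom₂.ext (whiskerLeft_comp f.cell θ.cell η.cell)
  id_whiskerLeft η := Hom₂.ext ((id_whiskerLeft η.cell).trans (Category.assoc _ _ _).symm)
  comp_whiskerLeft f g _ _ η :=
    Hom₂.ext ((comp_whiskerLeft f.cell g.cell η.cell).trans (Category.assoc _ _ _).symm)
  id_whiskerRight f g := Hom₂.ext (id_whiskerRight f.cell g.cell)
  comp_whiskerRight η θ i := Hom₂.ext (comp_whiskerRight θ.cell η.cell i.cell)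
  whiskerRight_id η := Hom₂.ext ((whiskerRight_id η.cell).trans (Category.assoc _ _ _).symm)
  whiskerRight_comp η g h :=
    Hom₂.ext ((whiskerRight_comp η.cell g.cell h.cell).trans (Category.assoc _ _ _).symm)
  whisker_assoc f _ _ η h :=
    Hom₂.ext ((whisker_assoc f.cell η.cell h.cell).trans (Category.assoc _ _ _).symm)
  whisker_exchange η θ := Hom₂.ext (whisker_exchange η.cell θ.cell).symm
  pentagon f g h i :=
    Hom₂.ext ((Category.assoc _ _ _).trans (pentagon_inv f.cell g.cell h.cell i.cell))
  triangle f g := Hom₂.ext (triangle_assoc_comp_left_inv f.cell g.cell)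

end Co

variable {B : Type u₁} [Bicategory.{w₁, v₁} B]

theorem conj_inv {T : Type u₂} [Category.{v₂} T] {x y x' y' : T} (e : x ≅ y) (e' : x' ≅ y')
    (m : x ⟶ x') (m' : y ⟶ y') (h : m ≫ e'.hom = e.hom ≫ m') : e.inv ≫ m = m' ≫ e'.inv := by
  rw [Iso.inv_comp_eq, ← Category.assoc, ← h, Category.assoc, e'.hom_inv_id, Category.comp_id]

theorem inv_eq {T : Type u₂} [Category.{v₂} T] {x y : T} {e e' : x ≅ y} (h : e.hom = e'.hom) :
    e.inv = e'.inv := by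
  rw [Iso.ext h]

/-- A shadow on `B` gives a shadow on `B` with its 2-cells reversed. -/
def Shadow.co {T : Type u₂} [Category.{v₂} T] (S : Shadow B T) : Shadow (Co B) Tᵒᵖ where
  sh a :=
    { obj := fun f => Opposite.op ((S.sh a.pt).obj f.cell)
      map := fun η => ((S.sh a.pt).map η.cell).op
      map_id := fun f => congrArg Quiver.Hom.op ((S.sh a.pt).map_id f.cell)
      map_comp := fun η θ => congrArg Quiver.Hom.op ((S.sh a.pt).map_comp θ.cell η.cell) }
  rot f g := (S.rot f.cell g.cell).symm.op
  rot_naturality_left η g :=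
    Quiver.Hom.unop_inj (conj_inv _ _ _ _ (S.rot_naturality_left η.cell g.cell))
  rot_naturality_right f _ _ η :=
    Quiver.Hom.unop_inj (conj_inv _ _ _ _ (S.rot_naturality_right f.cell η.cell))
  rot_assoc {a b c} f g h := Quiver.Hom.unop_inj (by
    have := inv_eq (e := S.rot (f.cell ≫ g.cell) h.cell ≪≫
        (S.sh c.pt).mapIso (α_ h.cell f.cell g.cell).symm ≪≫ S.rot (h.cell ≫ f.cell) g.cell)
      (e' := (S.sh a.pt).mapIso (α_ f.cell g.cell h.cell) ≪≫ S.rot f.cell (g.cell ≫ h.cell) ≪≫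
        (S.sh b.pt).mapIso (α_ g.cell h.cell f.cell)) (S.rot_assoc f.cell g.cell h.cell)
    simp only [Iso.trans_inv] at this
    exact this)
  rot_id_right {a} f := Quiver.Hom.unop_inj (
    inv_eq (e := S.rot f.cell (𝟙 a.pt) ≪≫ (S.sh a.pt).mapIso (λ_ f.cell))
      (e' := (S.sh a.pt).mapIso (ρ_ f.cell)) (S.rot_id_right f.cell))
  rot_id_left {a} f := Quiver.Hom.unop_inj (
    inv_eq (e := S.rot (𝟙 a.pt) f.cell ≪≫ (S.sh a.pt).mapIso (ρ_ f.cell))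
      (e' := (S.sh a.pt).mapIso (λ_ f.cell)) (S.rot_id_left f.cell))

variable {B' : Type u₂} [Category.{v₂} B'] {S : Shadow B B'} {D : Type u₃} [Bicategory.{w₂, v₃} D]
  {D' : Type u₄} [Category.{v₄} D'] {T : Shadow D D'}

/-- An oplax functor is a lax functor after reversing 2-cells. -/
def coOplax (F : OplaxFunctor B D) : LaxFunctor (Co B) (Co D) where
  obj a := ⟨F.obj a.pt⟩
  map f := ⟨F.map f.cell⟩
  map₂ η := ⟨F.map₂ η.cell⟩
  map₂_id f := Co.Hom₂.ext (F.map₂_id f.cell)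
  map₂_comp η θ := Co.Hom₂.ext (F.map₂_comp θ.cell η.cell)
  mapId a := ⟨F.mapId a.pt⟩
  mapComp f g := ⟨F.mapComp f.cell g.cell⟩
  mapComp_naturality_left η g := Co.Hom₂.ext (F.mapComp_naturality_left η.cell g.cell)
  mapComp_naturality_right f _ _ η := Co.Hom₂.ext (F.mapComp_naturality_right f.cell η.cell)
  map₂_associator f g h := Co.Hom₂.ext (by
    have e := F.map₂_associator f.cell g.cell h.cell
    have e' : (F.map₂ (α_ f.cell g.cell h.cell).inv) ≫ F.map₂ (α_ f.cell g.cell h.cell).hom =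
        𝟙 _ := by rw [← F.map₂_comp, Iso.inv_hom_id, F.map₂_id]
    have key : (F.map₂ (α_ f.cell g.cell h.cell).inv ≫ F.mapComp (f.cell ≫ g.cell) h.cell) ≫
        F.mapComp f.cell g.cell ▷ F.map h.cell =
        (F.mapComp f.cell (g.cell ≫ h.cell) ≫ F.map f.cell ◁ F.mapComp g.cell h.cell) ≫
          (α_ (F.map f.cell) (F.map g.cell) (F.map h.cell)).inv := by
      rw [Iso.eq_comp_inv, Category.assoc, Category.assoc, ← e, ← Category.assoc, e',
        Category.id_comp]
    exact key)
  map₂_leftUnitor f :=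
    Co.Hom₂.ext ((F.map₂_leftUnitor f.cell).trans (Category.assoc _ _ _).symm)
  map₂_rightUnitor f :=
    Co.Hom₂.ext ((F.map₂_rightUnitor f.cell).trans (Category.assoc _ _ _).symm)

/-- An oplax shadow functor is a lax shadow functor after reversing 2-cells and the morphisms of
the shadow categories. -/
def OplaxShadowFunctor.co (Φ : OplaxShadowFunctor S T) : LaxShadowFunctor S.co T.co where
  F := coOplax Φ.F
  H := Φ.H.op
  s f := (Φ.s f.cell).op
  s_naturality η := congrArg Quiver.Hom.op (Φ.s_naturality η.cell).symm
  s_rot f g := Quiver.Hom.unop_inj (by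
    have h := Φ.s_rot f.cell g.cell
    have key : (Φ.s (g.cell ≫ f.cell) ≫ (T.sh _).map (Φ.F.mapComp g.cell f.cell)) ≫
        (T.rot (Φ.F.map f.cell) (Φ.F.map g.cell)).inv =
        (Φ.H.map (S.rot f.cell g.cell).inv ≫ Φ.s (f.cell ≫ g.cell)) ≫
          (T.sh _).map (Φ.F.mapComp f.cell g.cell) := by
      rw [Iso.comp_inv_eq, Category.assoc, Category.assoc, ← h, ← Category.assoc (Φ.H.map _),
        ← Φ.H.map_comp, Iso.inv_hom_id, Φ.H.map_id, Category.id_comp]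
    exact key)

end Dual

/-! ### Black-tie diagrams -/

section Diagrams

/-- A diagram commutes if parallel composites are equal. -/
def Commutes {J : Type u₅} [Quiver.{v₅} J] {C : Type u₂} [Category.{v₂} C] (X : J ⥤q C) : Prop :=
  ∀ (a b : Paths J) (p q : a ⟶ b), (Paths.lift X).map p = (Paths.lift X).map q

variable {C : Type u₁} [Bicategory.{w₁, v₁} C] {C' : Type u₂} [Category.{v₂} C'] {S : Shadow C C'}
  {D : Type u₃} [Bicategory.{w₂, v₃} D] {D' : Type u₄} [Category.{v₄} D'] {T : Shadow D D'}

/-- A diagram in the shadow category of the target of a lax shadow functor is a black-tie diagram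
if it is formal (it lifts to the free lax shadow category) and, in the lift, parallel composites
have the same supporting map and the same underlying cyclic permutation. -/
def LaxShadowFunctor.IsBlackTie (Φ : LaxShadowFunctor S T) {J : Type u₅} [Quiver.{v₅} J]
    (X : J ⥤q D') : Prop :=
  ∃ K : J ⥤q FreeLaxSh C, K ⋙q Φ.eval.toPrefunctor = X ∧
    Commutes (K ⋙q (support C).toPrefunctor) ∧ Commutes (K ⋙q (permutation C).toPrefunctor)

/-- The evaluation functor along which formal diagrams of an oplax shadow functor lift. The free
oplax shadow category is the opposite of the free lax shadow category. -/
def OplaxShadowFunctor.eval (Φ : OplaxShadowFunctor S T) : (FreeLaxSh (Co C))ᵒᵖ ⥤ D' :=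
  Φ.co.eval.leftOp

/-- A diagram in the shadow category of the target of an oplax shadow functor is a black-tie diagram
if it is formal (it lifts to the free oplax shadow category) and, in the lift, parallel composites
have the same supporting map and the same underlying cyclic permutation. -/
def OplaxShadowFunctor.IsBlackTie (Φ : OplaxShadowFunctor S T) {J : Type u₅} [Quiver.{v₅} J]
    (X : J ⥤q D') : Prop :=
  ∃ K : J ⥤q (FreeLaxSh (Co C))ᵒᵖ, K ⋙q Φ.eval.toPrefunctor = X ∧
    Commutes (K ⋙q (support (Co C)).op.toPrefunctor) ∧
    Commutes (K ⋙q (permutation (Co C)).op.toPrefunctor)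

end Diagrams

end LaxShadow

namespace LaxShadow

open Bicategory

/-! ### Coherence for the free bicategory -/

section FreeBicategoryCoherence

variable {G : Type u₁} [Quiver.{v₁} G]

/-! Everything rests on one fact about the free shadow category: the supporting map and the
underlying permutation together determine a morphism (`hom_ext_support_permutation`). Evaluation is
a functor, so a black-tie lift already commutes in the free shadow category and its image commutes
too. The oplax case is the same argument in the opposite categories.

Joint faithfulness comes from normal forms. Coherence of free bicategories is used twice, for the
1-cells inside `F` and for words whose letters are whole symbols `F(W)`. It yields canonical 2-cells
`can` between words with the same list of symbols. Every 2-cell splits along any splitting of its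
target (`splits`), so a rotator following a 2-cell can be moved in front of it. Two consecutive
rotators merge into one by the hexagon and the identity that a rotator followed by the opposite
rotator is trivial. Hence a morphism between bracketed words is one rotator followed by one 2-cell,
a morphism into the image of `H` multiplies out all symbols and then applies `H`, and no morphism
leads from the image of `H` back to a bracket (`normalForm`).

Each ingredient is then recovered from the invariants. Into a single symbol there is at most one
2-cell, because multiplying out is natural (`fold_natural`, `hom_block_ext`); by splitting, a
general 2-cell is determined by where it sends symbols (`hom_ext_of_hasPos`). Since `Λ'` is given by
generators and relations, reading data off its morphisms needs a model: it acts on pairs of points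
of the universal cover of a cyclic set, up to translation (`posFunctor`). The jump of the winding
shows the rotation, and the function on points shows the rest (`Lam.rot_comp_injective`). Morphisms
under `H` are recovered from their permutation.

For the equivalence, aperiodicity makes the permutation a consequence of the edge lists, so the
support alone is faithful on the component. Every map of `Λ'` out of the support of an object lifts
(`exists_lift`), and two objects of the component with the same structure map are joined by a
morphism supported on an identity (`exists_supp_eq`); together these give fullness. The word with
one symbol per edge has an invertible structure map, so lifting from it reaches every object of the
comma category. -/

/-- The list of edges of a path. -/
def pathEdges {a : G} : {b : G} → Quiver.Path a b → List (Σ x y : G, x ⟶ y)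
  | _, .nil => []
  | _, .cons p f => pathEdges p ++ [⟨_, _, f⟩]

/-- Each entry of the list carries its own endpoints, so the last entry fixes the last intermediate
vertex and the induction can peel edges off at the end. -/
theorem pathEdges_injective {a b : G} (p q : Quiver.Path a b) (h : pathEdges p = pathEdges q) :
    p = q := by
  induction p with
  | nil =>
    cases q with
    | nil => rfl
    | cons q g => simp [pathEdges] at h
  | cons p f ih =>
    cases q with
    | nil => simp [pathEdges] at h
    | cons q g =>
      obtain ⟨h₁, h₂⟩ := List.append_inj' h rfl
      simp only [List.cons.injEq, and_true] at h₂
      cases h₂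
      rw [ih q h₁]

theorem pathEdges_normalizeAux {a b c : G} (p : Quiver.Path a b) (V : FreeBicategory.Hom b c) :
    pathEdges (FreeBicategory.normalizeAux p V) =
      pathEdges p ++ bicatEdges (a := (b : FreeBicategory G)) (b := c) V := by
  induction V generalizing a with
  | of f => rfl
  | id b => exact (List.append_nil _).symm
  | comp f g ihf ihg =>
    refine (ihg (FreeBicategory.normalizeAux p f)).trans ?_
    rw [ihf p, List.append_assoc]
    rfl

/-- Both 1-cells are isomorphic, by a unitor and the normalization isomorphism, to the image of one
and the same path. -/
theorem nonempty_hom_of_bicatEdges_eq {a b : FreeBicategory G} {V W : a ⟶ b}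
    (h : bicatEdges V = bicatEdges W) : Nonempty (V ⟶ W) := by
  have e : FreeBicategory.normalizeAux (B := G) (a := a) (b := a) (c := b) .nil V =
      FreeBicategory.normalizeAux (B := G) (a := a) (b := a) (c := b) .nil W := by
    exact pathEdges_injective (G := G) _ _ ((pathEdges_normalizeAux (G := G) _ _).trans
      ((congrArg _ h).trans (pathEdges_normalizeAux (G := G) _ _).symm))
  have i (V : a ⟶ b) : V ≅ (FreeBicategory.preinclusion G).map
      ⟨FreeBicategory.normalizeAux (B := G) (a := a) (b := a) (c := b) .nil V⟩ :=
    (λ_ V).symm ≪≫ FreeBicategory.normalizeIso (B := G) (a := a) (b := a) (c := b) .nil V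
  exact ⟨(i V).hom ≫ eqToHom (by rw [e]) ≫ (i W).inv⟩

/-- The canonical 2-cell between 1-cells of the free bicategory with the same edges. -/
noncomputable def bicatCan {a b : FreeBicategory G} (V W : a ⟶ b)
    (h : bicatEdges V = bicatEdges W) : V ⟶ W :=
  Classical.choice (nonempty_hom_of_bicatEdges_eq h)

/-- Coherence for bicategories in the form of local thinness. All equations between 2-cells of a
free bicategory are settled by it from here on. -/
theorem bicat_hom_ext {a b : FreeBicategory G} {V W : a ⟶ b} (η θ : V ⟶ W) : η = θ :=
  (FreeBicategory.locally_thin (B := G) V W).elim η θ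

/-- The canonical invertible 2-cell between 1-cells of the free bicategory with the same edges. -/
noncomputable def bicatCanIso {a b : FreeBicategory G} (V W : a ⟶ b)
    (h : bicatEdges V = bicatEdges W) : V ≅ W where
  hom := bicatCan V W h
  inv := bicatCan W V h.symm
  hom_inv_id := bicat_hom_ext _ _
  inv_hom_id := bicat_hom_ext _ _

/-- The endpoint of a list of edges starting at a given vertex. -/
def endpoint (a : G) (l : List (Σ x y : G, x ⟶ y)) : G := (l.getLast?.map (·.2.1)).getD a

theorem endpoint_append (a : G) (l m : List (Σ x y : G, x ⟶ y)) :
    endpoint a (l ++ m) = endpoint (endpoint a l) m := by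
  unfold endpoint
  cases h : m.getLast? <;> simp [List.getLast?_append, h]

/-- Source and edges determine the target. This is what identifies the middle vertices when two
splittings of a word are compared. -/
theorem endpoint_bicatEdges : ∀ {a b : FreeBicategory G} (V : a ⟶ b),
    endpoint (G := G) a (bicatEdges V) = b
  | _, _, .of f => rfl
  | _, _, .id _ => rfl
  | _, _, .comp f g => by
    refine (endpoint_append _ _ _).trans ?_
    rw [endpoint_bicatEdges f]
    exact endpoint_bicatEdges g

end FreeBicategoryCoherence

/-! ### Canonical 2-cells of the free lax functor -/

section Conjugation

variable {B : Type u₁} [Bicategory.{w₁, v₁} B] {a b c d : B}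

/-- An expression `F ▷ k ≫ f' ◁ y` is the underlying 2-cell of `compIso`. This and the next four
lemmas say that passing to normalized words turns whiskerings, associators and unitors into the
corresponding 2-cells there, which is what `eq_can` needs as input. -/
theorem whiskerLeft_conj {f f' : a ⟶ b} {g g' k k' : b ⟶ c} (F : f ⟶ f') (x : g ⟶ g') (y : k ⟶ k')
    (s : g ⟶ k) (t : g' ⟶ k') (e : s ≫ y = x ≫ t) :
    f ◁ s ≫ (F ▷ k ≫ f' ◁ y) = (F ▷ g ≫ f' ◁ x) ≫ f' ◁ t := by
  rw [whisker_exchange_assoc, ← whiskerLeft_comp, e, whiskerLeft_comp, Category.assoc]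

theorem whiskerRight_conj {f f' g g' : a ⟶ b} {k k' : b ⟶ c} (K : k ⟶ k') (x : f ⟶ f') (y : g ⟶ g')
    (s : f ⟶ g) (t : f' ⟶ g') (e : s ≫ y = x ≫ t) :
    s ▷ k ≫ (y ▷ k ≫ g' ◁ K) = (x ▷ k ≫ f' ◁ K) ≫ t ▷ k' := by
  rw [← comp_whiskerRight_assoc, e, comp_whiskerRight_assoc, Category.assoc, whisker_exchange]

theorem associator_conj {f f' : a ⟶ b} {g g' : b ⟶ c} {k k' : c ⟶ d} (x : f ⟶ f') (y : g ⟶ g')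
    (z : k ⟶ k') :
    (α_ f g k).hom ≫ x ▷ (g ≫ k) ≫ f' ◁ (y ▷ k ≫ g' ◁ z) =
      ((x ▷ g ≫ f' ◁ y) ▷ k ≫ (f' ≫ g') ◁ z) ≫ (α_ f' g' k').hom := by
  simp

theorem leftUnitor_conj {f f' : a ⟶ b} (x : f ⟶ f') :
    (λ_ f).hom ≫ x = (𝟙 (𝟙 a) ▷ f ≫ 𝟙 a ◁ x) ≫ (λ_ f').hom := by
  simp

theorem rightUnitor_conj {f f' : a ⟶ b} (x : f ⟶ f') :
    (ρ_ f).hom ≫ x = (x ▷ 𝟙 b ≫ f' ◁ 𝟙 (𝟙 b)) ≫ (ρ_ f').hom := by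
  simp

end Conjugation

section CanonicalCells

variable {G : Type u₁} [Quiver.{v₁} G]

/-- The vertices of `G`, with an arrow for every list of edges underlying a 1-cell of the free
bicategory on `G`. -/
def BlockQuiver (G : Type u₁) : Type u₁ := G

instance : Quiver.{max u₁ v₁} (BlockQuiver G) where
  Hom a b := {l : List (Σ x y : G, x ⟶ y) //
    ∃ V : FreeBicategory.Hom (B := G) a b, bicatEdges (G := G) (a := a) (b := b) V = l}

namespace FreeLax

/-- The lists of edges of the symbols `F(W)` of a word. -/
def shape : {a b : FreeLax G} → (a ⟶ b) → List (List (Σ x y : G, x ⟶ y))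
  | _, _, Hom.blk W => [bicatEdges W]
  | _, _, Hom.id _ => []
  | _, _, Hom.comp f g => shape f ++ shape g

@[simp] theorem shape_comp {a b c : FreeLax G} (f : a ⟶ b) (g : b ⟶ c) :
    shape (f ≫ g) = shape f ++ shape g := id rfl

@[simp] theorem shape_id (a : FreeLax G) : shape (𝟙 a) = [] := id rfl

@[simp] theorem shape_block {a b : FreeBicategory G} (W : a ⟶ b) :
    shape (block W) = [bicatEdges W] := id rfl

theorem flatten_shape : ∀ {a b : FreeLax G} (f : a ⟶ b), (shape f).flatten = edges f
  | _, _, Hom.blk W => by simp [shape, edges]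
  | _, _, Hom.id _ => rfl
  | _, _, Hom.comp f g => by simp [shape, edges, flatten_shape f, flatten_shape g]

theorem length_shape : ∀ {a b : FreeLax G} (f : a ⟶ b), (shape f).length = blocks f
  | _, _, Hom.blk W => rfl
  | _, _, Hom.id _ => rfl
  | _, _, Hom.comp f g => by simp [shape, blocks, length_shape f, length_shape g]

theorem endpoint_edges : ∀ {a b : FreeLax G} (f : a ⟶ b),
    endpoint (G := G) a.pt (edges f) = b.pt
  | _, _, Hom.blk W => endpoint_bicatEdges W
  | _, _, Hom.id _ => rfl
  | _, _, Hom.comp f g => by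
    refine (endpoint_append _ _ _).trans ?_
    rw [endpoint_edges f]
    exact endpoint_edges g

/-- The choice of a symbol `F(W)` for every list of edges. -/
noncomputable def ofBlocks (G : Type u₁) [Quiver.{v₁} G] : BlockQuiver G ⥤q FreeLax G where
  obj a := ⟨a⟩
  map l := block l.2.choose

/-- A vertex as a vertex of `BlockQuiver G`. -/
abbrev vert (a : FreeLax G) : FreeBicategory (BlockQuiver G) := a.pt

/-- The normalization of a word. -/
def normWord : {a b : FreeLax G} → (a ⟶ b) → (vert a ⟶ vert b)
  | _, _, Hom.blk W => FreeBicategory.Hom.of (B := BlockQuiver G) ⟨bicatEdges W, W, rfl⟩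
  | _, _, Hom.id a => 𝟙 (vert a)
  | _, _, Hom.comp f g => normWord f ≫ normWord g

/-- The word given by a normalized word. -/
noncomputable def ofNorm {a b : FreeLax G} (f : vert a ⟶ vert b) : a ⟶ b :=
  FreeBicategory.liftHom (ofBlocks G) f

/-- The 2-cell given by a 2-cell between normalized words. -/
noncomputable def ofNorm₂ {a b : FreeLax G} {f g : vert a ⟶ vert b} (η : f ⟶ g) :
    ofNorm (a := a) (b := b) f ⟶ ofNorm g :=
  (FreeBicategory.lift (ofBlocks G)).map₂ η

/-- `F` applied to a 2-cell. -/
def blockMap {a b : FreeBicategory G} {V W : a ⟶ b} (e : V ⟶ W) : block V ⟶ block W :=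
  (Hom₂.map₂ e).mk

theorem blockMap_id {a b : FreeBicategory G} (V : a ⟶ b) : blockMap (𝟙 V) = 𝟙 (block V) :=
  Quot.sound (Rel.map₂_id V)

theorem blockMap_comp {a b : FreeBicategory G} {U V W : a ⟶ b} (e : U ⟶ V) (f : V ⟶ W) :
    blockMap (e ≫ f) = blockMap e ≫ blockMap f :=
  Quot.sound (Rel.map₂_comp e f)

/-- `F` applied to an invertible 2-cell. -/
def blockIso {a b : FreeBicategory G} {V W : a ⟶ b} (e : V ≅ W) : block V ≅ block W where
  hom := blockMap e.hom
  inv := blockMap e.inv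
  hom_inv_id := by rw [← blockMap_comp, e.hom_inv_id, blockMap_id]
  inv_hom_id := by rw [← blockMap_comp, e.inv_hom_id, blockMap_id]

/-- Composites of isomorphic words are isomorphic. -/
def compIso {a b c : FreeLax G} {f f' : a ⟶ b} {g g' : b ⟶ c} (e : f ≅ f') (e' : g ≅ g') :
    f ≫ g ≅ f' ≫ g' :=
  whiskerRightIso e g ≪≫ whiskerLeftIso f' e'

/-- A word is isomorphic to its normalization. -/
noncomputable def normIso : {a b : FreeLax G} → (f : a ⟶ b) → (f ≅ ofNorm (normWord f))
  | _, _, Hom.blk (a := a) (b := b) W => blockIso (bicatCanIso W _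
      (⟨bicatEdges W, W, rfl⟩ : {l // ∃ V : FreeBicategory.Hom (B := G) a b,
        bicatEdges (G := G) (a := a) (b := b) V = l}).2.choose_spec.symm)
  | _, _, Hom.id a => Iso.refl (𝟙 a)
  | _, _, Hom.comp f g => compIso (normIso f) (normIso g)

section
variable {a b c d : FreeLax G}

theorem ofNorm₂_id (f : vert a ⟶ vert b) :
    ofNorm₂ (𝟙 f) = 𝟙 (ofNorm (a := a) (b := b) f) :=
  (FreeBicategory.lift (ofBlocks G)).map₂_id f

theorem ofNorm₂_comp {f g h : vert a ⟶ vert b} (η : f ⟶ g) (θ : g ⟶ h) :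
    ofNorm₂ (a := a) (b := b) (η ≫ θ) = ofNorm₂ η ≫ ofNorm₂ θ :=
  (FreeBicategory.lift (ofBlocks G)).map₂_comp η θ

theorem ofNorm₂_whiskerLeft (f : vert a ⟶ vert b) {g h : vert b ⟶ vert c} (η : g ⟶ h) :
    ofNorm₂ (a := a) (b := c) (f ◁ η) = ofNorm (a := a) (b := b) f ◁ ofNorm₂ η := by
  induction η using Quot.ind
  rfl

theorem ofNorm₂_whiskerRight {f g : vert a ⟶ vert b} (η : f ⟶ g) (h : vert b ⟶ vert c) :
    ofNorm₂ (a := a) (b := c) (η ▷ h) = ofNorm₂ η ▷ ofNorm (a := b) (b := c) h := by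
  induction η using Quot.ind
  rfl

end

/-- Displays the shape as labels of an edge list in a free bicategory, so that coherence applies a
second time with symbols `F(W)` as letters. -/
theorem shape_eq_map : ∀ {a b : FreeLax G} (f : a ⟶ b),
    shape f = (bicatEdges (normWord f)).map fun e => e.2.2.1
  | _, _, Hom.blk W => rfl
  | _, _, Hom.id _ => rfl
  | _, _, Hom.comp f g => by
    refine Eq.trans (congrArg₂ (· ++ ·) (shape_eq_map f) (shape_eq_map g)) ?_
    exact (List.map_append).symm

theorem endpoint_pathEdges {a b : BlockQuiver G} (p : Quiver.Path a b) :
    endpoint (G := G) a ((pathEdges p).map fun e => e.2.2.1).flatten = b := by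
  induction p with
  | nil => rfl
  | cons p q ih =>
    obtain ⟨l, V, rfl⟩ := q
    simp only [pathEdges, List.map_append, List.map_cons, List.map_nil, List.flatten_append,
      List.flatten_cons, List.flatten_nil, List.append_nil]
    refine (endpoint_append _ _ _).trans ?_
    rw [ih]
    exact endpoint_bicatEdges (G := G) V

/-- The type of an arrow of `BlockQuiver` mentions its vertices, so equal labels are not yet equal
arrows. The common source together with the labels fixes every later vertex as the endpoint of a
concatenated list; for the same reason the targets need not be assumed equal. -/
theorem pathEdges_ext {a b b' : BlockQuiver G} (p : Quiver.Path a b) (p' : Quiver.Path a b')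
    (h : ((pathEdges p).map fun e => e.2.2.1) = (pathEdges p').map fun e => e.2.2.1) :
    pathEdges p = pathEdges p' := by
  induction p generalizing b' with
  | nil =>
    cases p' with
    | nil => rfl
    | cons q g => simp [pathEdges] at h
  | cons p f ih =>
    rename_i b c
    cases p' with
    | nil => simp [pathEdges] at h
    | cons q g =>
      rename_i b''
      simp only [pathEdges, List.map_append] at h
      obtain ⟨h₁, h₂⟩ := List.append_inj' h rfl
      obtain rfl : b = b'' := by
        rw [← endpoint_pathEdges p, h₁, endpoint_pathEdges q]
      have h₃ : f.1 = g.1 := by simpa using h₂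
      obtain rfl : c = b' := by
        obtain ⟨l, V, rfl⟩ := f
        obtain ⟨l', V', rfl⟩ := g
        have e := endpoint_bicatEdges (G := G) V
        have e' := endpoint_bicatEdges (G := G) V'
        exact e.symm.trans ((congrArg _ h₃).trans e')
      obtain rfl : f = g := Subtype.ext h₃
      rw [pathEdges, pathEdges, ih q h₁]

/-- Equal shapes force equal edge lists in `BlockQuiver`, and then coherence of the free bicategory
on that quiver supplies the 2-cell. -/
theorem nonempty_normWord_hom {a b : FreeLax G} {f g : a ⟶ b} (h : shape f = shape g) :
    Nonempty (normWord f ⟶ normWord g) := by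
  apply nonempty_hom_of_bicatEdges_eq
  have key (f : a ⟶ b) : pathEdges (G := BlockQuiver G) (FreeBicategory.normalizeAux
      (B := BlockQuiver G) (a := a.pt) (b := a.pt) (c := b.pt) .nil (normWord f)) =
      bicatEdges (normWord f) :=
    pathEdges_normalizeAux (G := BlockQuiver G) .nil (normWord f)
  refine (key f).symm.trans ((pathEdges_ext _ _ ?_).trans (key g))
  rw [key f, key g, ← shape_eq_map, ← shape_eq_map, h]

/-- A word whose edges are the concatenation of two lists of symbols splits accordingly. -/
theorem exists_split : ∀ {a c : FreeLax G} (f : a ⟶ c) (S T : List (List (Σ x y : G, x ⟶ y))),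
    shape f = S ++ T → ∃ (b : FreeLax G) (f₁ : a ⟶ b) (f₂ : b ⟶ c), shape f₁ = S ∧ shape f₂ = T
  | _, _, Hom.blk (a := a) (b := b) W, S, T, h => by
    rcases S with _ | ⟨s, S⟩
    · exact ⟨_, 𝟙 _, block W, rfl, h⟩
    · obtain ⟨h₁, h₂⟩ := List.cons.inj h
      obtain ⟨rfl, rfl⟩ := List.append_eq_nil_iff.mp h₂.symm
      exact ⟨_, block W, 𝟙 _, congrArg (fun x => [x]) h₁, rfl⟩
  | _, _, Hom.id a, S, T, h => by
    obtain ⟨rfl, rfl⟩ := List.append_eq_nil_iff.mp h.symm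
    exact ⟨_, 𝟙 _, 𝟙 _, rfl, rfl⟩
  | _, _, Hom.comp f g, S, T, h => by
    rcases List.append_eq_append_iff.mp h with ⟨U, h₁, h₂⟩ | ⟨U, h₁, h₂⟩
    · obtain ⟨b, g₁, g₂, hg₁, hg₂⟩ := exists_split g U T h₂
      exact ⟨b, f ≫ g₁, g₂, by rw [shape_comp, hg₁, h₁], hg₂⟩
    · obtain ⟨b, f₁, f₂, hf₁, hf₂⟩ := exists_split f S U h₁
      exact ⟨b, f₁, f₂ ≫ g, hf₁, by rw [shape_comp, hf₂, h₂]⟩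

/-- Makes a splitting of a word comparable with another one: pieces with the same edges and source
end at the same object. -/
theorem target_eq {b b' : FreeLax G} {f : a ⟶ b} {g : a ⟶ b'} (h : edges f = edges g) : b = b' := by
  have e := endpoint_edges f
  rw [h, endpoint_edges g] at e
  cases b; cases b'; cases e; rfl

theorem edges_eq_of_shape {a' b' : FreeLax G} {f : a ⟶ b} {g : a' ⟶ b'} (h : shape f = shape g) :
    edges f = edges g := by
  rw [← flatten_shape, ← flatten_shape, h]

attribute [irreducible] shape

/-- The canonical 2-cell between words of the same shape. -/
noncomputable def can {a b : FreeLax G} (f g : a ⟶ b) (h : shape f = shape g) : f ⟶ g :=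
  (normIso f).hom ≫ ofNorm₂ (Classical.choice (nonempty_normWord_hom h)) ≫ (normIso g).inv

section
variable {a b c d : FreeLax G}

/-- The 2-cells between normalized words are unique, so the arbitrary choice in `can` can be
replaced by any `θ`. To recognize a canonical 2-cell it is enough to find one square over a
normalized 2-cell. -/
theorem eq_can {f g : a ⟶ b} (η : f ⟶ g) (h : shape f = shape g) (θ : normWord f ⟶ normWord g)
    (e : η ≫ (normIso g).hom = (normIso f).hom ≫ ofNorm₂ θ) : η = can f g h := by
  rw [can, bicat_hom_ext (Classical.choice (nonempty_normWord_hom h)) θ, ← Category.assoc, ← e,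
    Category.assoc, Iso.hom_inv_id, Category.comp_id]

theorem can_normIso {f g : a ⟶ b} (h : shape f = shape g) (θ : normWord f ⟶ normWord g) :
    can f g h ≫ (normIso g).hom = (normIso f).hom ≫ ofNorm₂ θ := by
  rw [can, bicat_hom_ext (Classical.choice (nonempty_normWord_hom h)) θ]
  simp

theorem can_self (f : a ⟶ b) (h : shape f = shape f) : can f f h = 𝟙 f :=
  (eq_can _ h (𝟙 _) (by rw [ofNorm₂_id, Category.id_comp, Category.comp_id])).symm

theorem can_comp {f g k : a ⟶ b} (h : shape f = shape g) (h' : shape g = shape k) :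
    can f g h ≫ can g k h' = can f k (h.trans h') := by
  obtain ⟨θ⟩ := nonempty_normWord_hom h
  obtain ⟨θ'⟩ := nonempty_normWord_hom h'
  refine eq_can _ _ (θ ≫ θ') ?_
  rw [Category.assoc, can_normIso h' θ', ← Category.assoc, can_normIso h θ, Category.assoc,
    ofNorm₂_comp]

theorem can_comp_assoc {f g k l : a ⟶ b} (h : shape f = shape g) (h' : shape g = shape k)
    (η : k ⟶ l) : can f g h ≫ can g k h' ≫ η = can f k (h.trans h') ≫ η := by
  rw [← Category.assoc, can_comp]

/-- Normalization commutes with composition of words, so the square for the whiskered 2-cell is the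
whiskered square. The next lemmas use the same principle for right whiskering, associators and
unitors. -/
theorem whiskerLeft_can (f : a ⟶ b) {g k : b ⟶ c} (h : shape g = shape k) :
    f ◁ can g k h = can (f ≫ g) (f ≫ k) (by rw [shape_comp, shape_comp, h]) := by
  obtain ⟨θ⟩ := nonempty_normWord_hom h
  exact eq_can _ _ (normWord f ◁ θ) ((whiskerLeft_conj (normIso f).hom (normIso g).hom
    (normIso k).hom _ _ (can_normIso h θ)).trans (congrArg (_ ≫ ·) (ofNorm₂_whiskerLeft _ _).symm))

theorem whiskerRight_can {f g : a ⟶ b} (k : b ⟶ c) (h : shape f = shape g) :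
    can f g h ▷ k = can (f ≫ k) (g ≫ k) (by rw [shape_comp, shape_comp, h]) := by
  obtain ⟨θ⟩ := nonempty_normWord_hom h
  exact eq_can _ _ (θ ▷ normWord k) ((whiskerRight_conj (normIso k).hom (normIso f).hom
    (normIso g).hom _ _ (can_normIso h θ)).trans
      (congrArg (_ ≫ ·) (ofNorm₂_whiskerRight _ _).symm))

theorem associator_hom_eq_can (f : a ⟶ b) (g : b ⟶ c) (k : c ⟶ d)
    (h : shape ((f ≫ g) ≫ k) = shape (f ≫ g ≫ k)) :
    (α_ f g k).hom = can _ _ h :=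
  eq_can _ _ (α_ (normWord f) (normWord g) (normWord k)).hom
    (associator_conj (normIso f).hom (normIso g).hom (normIso k).hom)

theorem leftUnitor_hom_eq_can (f : a ⟶ b) (h : shape (𝟙 a ≫ f) = shape f) :
    (λ_ f).hom = can _ _ h :=
  eq_can _ _ (λ_ (normWord f)).hom (leftUnitor_conj (normIso f).hom)

theorem rightUnitor_hom_eq_can (f : a ⟶ b) (h : shape (f ≫ 𝟙 b) = shape f) :
    (ρ_ f).hom = can _ _ h :=
  eq_can _ _ (ρ_ (normWord f)).hom (rightUnitor_conj (normIso f).hom)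

theorem inv_eq_can {f g : a ⟶ b} (e : f ≅ g) (h : shape f = shape g) (he : e.hom = can f g h) :
    e.inv = can g f h.symm := by
  rw [← Category.comp_id e.inv, ← can_self f rfl, ← can_comp h h.symm, ← he, e.inv_hom_id_assoc]

theorem associator_inv_eq_can (f : a ⟶ b) (g : b ⟶ c) (k : c ⟶ d)
    (h : shape (f ≫ g ≫ k) = shape ((f ≫ g) ≫ k)) :
    (α_ f g k).inv = can _ _ h :=
  inv_eq_can _ h.symm (associator_hom_eq_can f g k h.symm)

theorem leftUnitor_inv_eq_can (f : a ⟶ b) (h : shape f = shape (𝟙 a ≫ f)) :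
    (λ_ f).inv = can _ _ h :=
  inv_eq_can _ h.symm (leftUnitor_hom_eq_can f h.symm)

theorem rightUnitor_inv_eq_can (f : a ⟶ b) (h : shape f = shape (f ≫ 𝟙 b)) :
    (ρ_ f).inv = can _ _ h :=
  inv_eq_can _ h.symm (rightUnitor_hom_eq_can f h.symm)

end

end FreeLax
end CanonicalCells

/-! ### Splitting 2-cells of the free lax functor -/

section HorizontalComposition

variable {B : Type u₁} [Bicategory.{w₁, v₁} B] {a b c d : B}

/-- Horizontal composition of 2-cells. -/
def hcomp {f g : a ⟶ b} {h k : b ⟶ c} (η : f ⟶ g) (θ : h ⟶ k) : f ≫ h ⟶ g ≫ k :=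
  η ▷ h ≫ g ◁ θ

theorem hcomp_id (f : a ⟶ b) (h : b ⟶ c) : hcomp (𝟙 f) (𝟙 h) = 𝟙 (f ≫ h) := by simp [hcomp]

theorem id_hcomp (f : a ⟶ b) {h k : b ⟶ c} (θ : h ⟶ k) : hcomp (𝟙 f) θ = f ◁ θ := by
  simp [hcomp]

theorem hcomp_comp {f g k : a ⟶ b} {f' g' k' : b ⟶ c} (η : f ⟶ g) (η' : g ⟶ k) (θ : f' ⟶ g')
    (θ' : g' ⟶ k') : hcomp η θ ≫ hcomp η' θ' = hcomp (η ≫ η') (θ ≫ θ') := by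
  simp only [hcomp, Category.assoc, comp_whiskerRight, whiskerLeft_comp]
  rw [whisker_exchange_assoc]

theorem whiskerLeft_hcomp (h : a ⟶ b) {f g : b ⟶ c} {f' g' : c ⟶ d} (η : f ⟶ g) (θ : f' ⟶ g') :
    h ◁ hcomp η θ = (α_ h f f').inv ≫ hcomp (h ◁ η) θ ≫ (α_ h g g').hom := by
  simp [hcomp]

theorem hcomp_whiskerRight (h : c ⟶ d) {f g : a ⟶ b} {f' g' : b ⟶ c} (η : f ⟶ g) (θ : f' ⟶ g') :
    hcomp η θ ▷ h = (α_ f f' h).hom ≫ hcomp η (θ ▷ h) ≫ (α_ g g' h).inv := by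
  simp [hcomp]

/-- Moves the whiskering across a factorization of `h` through `l ≫ m`: the interchange law carries
`e` past `η`, where it meets `i`. Only the one-sided relation `e ≫ i = 𝟙 h` is needed. -/
theorem whiskerLeft_eq (h : a ⟶ b) {f g : b ⟶ c} (η : f ⟶ g) (l : a ⟶ d) (m : d ⟶ b)
    (e : h ⟶ l ≫ m) (i : l ≫ m ⟶ h) (he : e ≫ i = 𝟙 h) :
    h ◁ η = e ▷ f ≫ (α_ l m f).hom ≫ l ◁ (m ◁ η) ≫ (α_ l m g).inv ≫ i ▷ g := by
  rw [← comp_whiskerLeft_assoc, whisker_exchange, ← comp_whiskerRight_assoc, he]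
  simp

theorem whiskerRight_eq (h : b ⟶ c) {f g : a ⟶ b} (η : f ⟶ g) (m : b ⟶ d) (l : d ⟶ c)
    (e : h ⟶ m ≫ l) (i : m ≫ l ⟶ h) (he : e ≫ i = 𝟙 h) :
    η ▷ h = f ◁ e ≫ (α_ f m l).inv ≫ (η ▷ m) ▷ l ≫ (α_ g m l).hom ≫ g ◁ i := by
  rw [← whiskerRight_comp_assoc, ← whisker_exchange, ← whiskerLeft_comp_assoc, he]
  simp

end HorizontalComposition

namespace FreeLax

section

variable {G : Type u₁} [Quiver.{v₁} G] {a b c d : FreeLax G}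

theorem hcomp_can {f f' : a ⟶ b} {g g' : b ⟶ c} (h : shape f = shape f') (h' : shape g = shape g') :
    hcomp (can f f' h) (can g g' h') =
      can (f ≫ g) (f' ≫ g') (by rw [shape_comp, shape_comp, h, h']) := by
  rw [hcomp, whiskerRight_can, whiskerLeft_can, can_comp]

theorem hcomp_comp_can {f g g' : a ⟶ b} {k l l' : b ⟶ c} (η : f ⟶ g) (θ : k ⟶ l)
    (h : shape g = shape g') (h' : shape l = shape l') :
    hcomp (η ≫ can g g' h) (θ ≫ can l l' h') =
      hcomp η θ ≫ can (g ≫ l) (g' ≫ l') (by rw [shape_comp, shape_comp, h, h']) := by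
  rw [← hcomp_can h h', hcomp_comp]

theorem hcomp_comp_can_left {f g g' : a ⟶ b} {k l : b ⟶ c} (η : f ⟶ g) (θ : k ⟶ l)
    (h : shape g = shape g') : hcomp (η ≫ can g g' h) θ =
      hcomp η θ ≫ can (g ≫ l) (g' ≫ l) (by rw [shape_comp, shape_comp, h]) := by
  have := hcomp_comp_can η θ h (rfl : shape l = shape l)
  rwa [can_self l, Category.comp_id] at this

theorem hcomp_comp_can_right {f g : a ⟶ b} {k l l' : b ⟶ c} (η : f ⟶ g) (θ : k ⟶ l)
    (h : shape l = shape l') : hcomp η (θ ≫ can l l' h) =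
      hcomp η θ ≫ can (g ≫ l) (g ≫ l') (by rw [shape_comp, shape_comp, h]) := by
  have := hcomp_comp_can η θ (rfl : shape g = shape g) h
  rwa [can_self g, Category.comp_id] at this

theorem can_hcomp {f g : a ⟶ b} {k l : b ⟶ c} (h : shape f = shape g) (θ : k ⟶ l) :
    hcomp (can f g h) θ = f ◁ θ ≫ can (f ≫ l) (g ≫ l) (by rw [shape_comp, shape_comp, h]) := by
  rw [← id_hcomp, ← hcomp_comp_can_left, Category.id_comp]

theorem hcomp_can_right {f g : a ⟶ b} {k l : b ⟶ c} (h : shape k = shape l) (η : f ⟶ g) :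
    hcomp η (can k l h) = η ▷ k ≫ can (g ≫ k) (g ≫ l) (by rw [shape_comp, shape_comp, h]) := by
  rw [hcomp, whiskerLeft_can]

theorem whiskerLeft_hcomp_can (h : a ⟶ b) {f g : b ⟶ c} {f' g' : c ⟶ d} (η : f ⟶ g) (θ : f' ⟶ g') :
    h ◁ hcomp η θ = can (h ≫ f ≫ f') ((h ≫ f) ≫ f') (by simp) ≫ hcomp (h ◁ η) θ ≫
      can ((h ≫ g) ≫ g') (h ≫ g ≫ g') (by simp) := by
  rw [whiskerLeft_hcomp]
  exact congrArg₂ (· ≫ _ ≫ ·) (associator_inv_eq_can _ _ _ _) (associator_hom_eq_can _ _ _ _)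

theorem hcomp_whiskerRight_can (h : c ⟶ d) {f g : a ⟶ b} {f' g' : b ⟶ c} (η : f ⟶ g) (θ : f' ⟶ g') :
    hcomp η θ ▷ h = can ((f ≫ f') ≫ h) (f ≫ f' ≫ h) (by simp) ≫ hcomp η (θ ▷ h) ≫
      can (g ≫ g' ≫ h) ((g ≫ g') ≫ h) (by simp) := by
  rw [hcomp_whiskerRight]
  exact congrArg₂ (· ≫ _ ≫ ·) (associator_hom_eq_can _ _ _ _) (associator_inv_eq_can _ _ _ _)

theorem whiskerLeft_eq_can (h : a ⟶ b) {f g : b ⟶ c} (η : f ⟶ g) (l : a ⟶ d) (m : d ⟶ b)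
    (e : shape h = shape (l ≫ m)) :
    h ◁ η = can (h ≫ f) (l ≫ m ≫ f) (by simp at e; simp [e]) ≫ l ◁ (m ◁ η) ≫
      can (l ≫ m ≫ g) (h ≫ g) (by simp at e; simp [e]) := by
  rw [whiskerLeft_eq h η l m (can _ _ e) (can _ _ e.symm) (by rw [can_comp, can_self])]
  rw [associator_hom_eq_can _ _ _ (by simp), associator_inv_eq_can _ _ _ (by simp),
    whiskerRight_can, whiskerRight_can, can_comp_assoc, can_comp]

theorem whiskerRight_eq_can (h : b ⟶ c) {f g : a ⟶ b} (η : f ⟶ g) (m : b ⟶ d) (l : d ⟶ c)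
    (e : shape h = shape (m ≫ l)) :
    η ▷ h = can (f ≫ h) ((f ≫ m) ≫ l) (by simp at e; simp [e]) ≫ (η ▷ m) ▷ l ≫
      can ((g ≫ m) ≫ l) (g ≫ h) (by simp at e; simp [e]) := by
  rw [whiskerRight_eq h η m l (can _ _ e) (can _ _ e.symm) (by rw [can_comp, can_self])]
  rw [associator_hom_eq_can _ _ _ (by simp), associator_inv_eq_can _ _ _ (by simp),
    whiskerLeft_can, whiskerLeft_can, can_comp_assoc, can_comp]

theorem id_whiskerLeft_can {f g : a ⟶ b} (η : f ⟶ g) :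
    𝟙 a ◁ η = can _ _ (by simp) ≫ η ≫ can _ _ (by simp) := by
  rw [← leftUnitor_hom_eq_can _ (by simp), ← leftUnitor_inv_eq_can _ (by simp)]
  exact id_whiskerLeft η

theorem whiskerRight_id_can {f g : a ⟶ b} (η : f ⟶ g) :
    η ▷ 𝟙 b = can _ _ (by simp) ≫ η ≫ can _ _ (by simp) := by
  rw [← rightUnitor_hom_eq_can _ (by simp), ← rightUnitor_inv_eq_can _ (by simp)]
  exact whiskerRight_id η

/-- A 2-cell splits if its source splits compatibly with any splitting of its target. -/
def Splits {a c : FreeLax G} {f g : a ⟶ c} (η : f ⟶ g) : Prop :=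
  ∀ {b : FreeLax G} (g₁ : a ⟶ b) (g₂ : b ⟶ c) (h : shape (g₁ ≫ g₂) = shape g),
    ∃ (f₁ : a ⟶ b) (f₂ : b ⟶ c) (h' : shape f = shape (f₁ ≫ f₂)) (η₁ : f₁ ⟶ g₁) (η₂ : f₂ ⟶ g₂),
      η = can f (f₁ ≫ f₂) h' ≫ hcomp η₁ η₂ ≫ can (g₁ ≫ g₂) g h

theorem splits_can {f g : a ⟶ c} (h : shape f = shape g) : Splits (can f g h) := by
  intro b g₁ g₂ h'
  refine ⟨g₁, g₂, h.trans h'.symm, 𝟙 _, 𝟙 _, ?_⟩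
  rw [hcomp_id, Category.id_comp, can_comp]

/-- The splitting is pulled back from right to left: the source splitting produced for `θ` serves as
the target splitting for `η`. -/
theorem Splits.comp {f g k : a ⟶ c} {η : f ⟶ g} {θ : g ⟶ k} (hη : Splits η) (hθ : Splits θ) :
    Splits (η ≫ θ) := by
  intro b k₁ k₂ h
  obtain ⟨g₁, g₂, h', θ₁, θ₂, rfl⟩ := hθ k₁ k₂ h
  obtain ⟨f₁, f₂, h'', η₁, η₂, rfl⟩ := hη g₁ g₂ h'.symm
  refine ⟨f₁, f₂, h'', η₁ ≫ θ₁, η₂ ≫ θ₂, ?_⟩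
  simp only [Category.assoc]
  rw [can_comp_assoc, can_self, Category.id_comp, ← hcomp_comp, Category.assoc]

/-- A single symbol can only be split with one side empty. The whole 2-cell goes to the nonempty
side and a canonical 2-cell to the other. -/
theorem splits_block {a b : FreeBicategory G} {f : (⟨a⟩ : FreeLax G) ⟶ ⟨b⟩} {V : a ⟶ b}
    (η : f ⟶ block V) : Splits η := by
  intro c g₁ g₂ h
  have h' := h
  rw [shape_comp, shape_block] at h'
  rcases List.append_eq_singleton_iff.mp h' with ⟨h₁, h₂⟩ | ⟨h₁, h₂⟩
  · obtain rfl : (⟨a⟩ : FreeLax G) = c :=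
      target_eq (f := 𝟙 _) (g := g₁) (edges_eq_of_shape (by rw [h₁, shape_id]))
    refine ⟨𝟙 _, f, by simp, can _ _ (by simp [h₁]), η ≫ can _ _ (by simp [h₂]), ?_⟩
    rw [hcomp_comp_can_right, can_hcomp, id_whiskerLeft_can]
    simp only [Category.assoc, can_comp, can_comp_assoc, can_self, Category.id_comp,
      Category.comp_id]
  · obtain rfl : c = (⟨b⟩ : FreeLax G) :=
      target_eq (f := g₁) (g := block V) (edges_eq_of_shape (by rw [h₁, shape_block]))
    refine ⟨f, 𝟙 _, by simp, η ≫ can _ _ (by simp [h₁]), can _ _ (by simp [h₂]), ?_⟩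
    rw [hcomp_comp_can_left, hcomp_can_right, whiskerRight_id_can]
    simp only [Category.assoc, can_comp, can_comp_assoc, can_self, Category.id_comp,
      Category.comp_id]

/-- The cut of the target falls either inside the spectator word `h`, where `η` stays whole in the
right factor, or inside `g`, where the splitting of `η` itself is used. -/
theorem Splits.whiskerLeft (h : a ⟶ b) {f g : b ⟶ c} {η : f ⟶ g} (hη : Splits η) :
    Splits (h ◁ η) := by
  intro d g₁ g₂ e
  have e' := e
  simp only [shape_comp] at e'
  rcases List.append_eq_append_iff.mp e' with ⟨U, h₁, h₂⟩ | ⟨U, h₁, h₂⟩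
  -- Cut inside `h`: the left factor is a prefix of `h`, and the remainder `m` whiskers `η`.
  · obtain ⟨d', l, m, hl, hm⟩ := exists_split h _ _ h₁
    obtain rfl : d' = d := target_eq (f := l) (g := g₁) (edges_eq_of_shape hl)
    subst hm
    refine ⟨g₁, m ≫ f, by simp [h₁], 𝟙 _, m ◁ η ≫ can (m ≫ g) g₂ (by simp [h₂]), ?_⟩
    rw [hcomp_comp_can_right, id_hcomp, whiskerLeft_eq_can h η g₁ m (by simp [h₁])]
    simp only [Category.assoc, can_comp, can_comp_assoc]
  -- Cut inside `g`: the left factor is `h` followed by a piece `m` of `g`, along which `η` splits.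
  · obtain ⟨d', l, m, hl, hm⟩ := exists_split g₁ _ _ h₁
    obtain rfl : d' = b := target_eq (f := l) (g := h) (edges_eq_of_shape hl)
    subst hm
    obtain ⟨f₁, f₂, h', η₁, η₂, rfl⟩ := hη m g₂ (by simp [h₂])
    refine ⟨h ≫ f₁, f₂, by simp [h'], h ◁ η₁ ≫ can (h ≫ m) g₁ (by simp [h₁, hl]), η₂, ?_⟩
    rw [hcomp_comp_can_left]
    simp only [whiskerLeft_comp, whiskerLeft_can, whiskerLeft_hcomp_can, Category.assoc, can_comp,
      can_comp_assoc]

theorem Splits.whiskerRight (h : b ⟶ c) {f g : a ⟶ b} {η : f ⟶ g} (hη : Splits η) :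
    Splits (η ▷ h) := by
  intro d g₁ g₂ e
  have e' := e.symm
  simp only [shape_comp] at e'
  rcases List.append_eq_append_iff.mp e' with ⟨U, h₁, h₂⟩ | ⟨U, h₁, h₂⟩
  · obtain ⟨d', m, l, hm, hl⟩ := exists_split h _ _ h₂
    obtain rfl : d' = d := target_eq (f := g ≫ m) (g := g₁)
      (edges_eq_of_shape (by rw [shape_comp, hm, h₁]))
    subst hm
    refine ⟨f ≫ m, g₂, by simp [h₂], η ▷ m ≫ can (g ≫ m) g₁ (by simp [h₁]), 𝟙 _, ?_⟩
    rw [hcomp_comp_can_left, whiskerRight_eq_can h η m g₂ (by simp [h₂]), hcomp, whiskerLeft_id,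
      Category.comp_id]
    simp only [Category.assoc, can_comp, can_comp_assoc]
  · obtain ⟨d', m, l, hm, hl⟩ := exists_split g₂ _ _ h₂
    obtain rfl : d' = b := target_eq (f := g₁ ≫ m) (g := g)
      (edges_eq_of_shape (by rw [shape_comp, hm, h₁]))
    subst hm
    obtain ⟨f₁, f₂, h', η₁, η₂, rfl⟩ := hη g₁ m (by simp [h₁])
    refine ⟨f₁, f₂ ≫ h, by simp [h'], η₁, η₂ ▷ h ≫ can (m ≫ h) g₂ (by simp [h₂, hl]), ?_⟩
    rw [hcomp_comp_can_right]
    simp only [comp_whiskerRight, whiskerRight_can, hcomp_whiskerRight_can, Category.assoc,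
      can_comp, can_comp_assoc]

theorem splits_of_eq {f g : a ⟶ c} {η : f ⟶ g} {h : shape f = shape g} (e : η = can f g h) :
    Splits η :=
  e ▸ splits_can h

/-- On symbols a 2-cell is an order-preserving map, and its source is cut at the preimage of the cut
of the target. The generators are either canonical or have a single symbol as target, so the
preceding cases suffice. -/
theorem splits {f g : a ⟶ b} (η : f ⟶ g) : Splits η := by
  induction η using Quot.ind with
  | mk η =>
    induction η with
    | refl f => exact splits_of_eq (can_self f rfl).symm
    | vcomp η θ h h' => exact h.comp h'
    | whiskerLeft f η h => exact h.whiskerLeft f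
    | whiskerRight η g h => exact h.whiskerRight g
    | associator f g h => exact splits_of_eq (associator_hom_eq_can f g h (by simp))
    | associatorInv f g h => exact splits_of_eq (associator_inv_eq_can f g h (by simp))
    | rightUnitor f => exact splits_of_eq (rightUnitor_hom_eq_can f (by simp))
    | rightUnitorInv f => exact splits_of_eq (rightUnitor_inv_eq_can f (by simp))
    | leftUnitor f => exact splits_of_eq (leftUnitor_hom_eq_can f (by simp))
    | leftUnitorInv f => exact splits_of_eq (leftUnitor_inv_eq_can f (by simp))
    | map₂ η => exact splits_block _
    | unit a => exact splits_block _
    | mul W W' => exact splits_block _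

end

end FreeLax

/-! ### Relative positions: an invariant of maps of `Λ'` -/

/-- Types, with functions as morphisms. -/
structure Fun : Type 1 where
  carrier : Type

instance : Category Fun where
  Hom x y := x.carrier → y.carrier
  id x := fun a => a
  comp f g := fun a => g (f a)

/-- Pairs of points of the universal cover of the cyclic set with `n` elements, up to translation:
`(a, q, b)` stands for the points `a` and `q * n + b`. -/
def PosPair (n : ℕ) : Type := {x : ℕ × ℤ × ℕ // x.1 < n ∧ x.2.2 < n}

/-- The pairs of points on an object of `Λ'`. -/
def posObj : LObj → Fun
  | .fin n => ⟨PosPair n⟩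
  | .star => ⟨Unit⟩

/-- A map on pairs of points acts by the function `f` on points, with winding `j`. -/
structure Acts {n m : ℕ} (φ : PosPair n → PosPair m) (f : ℕ → ℕ) (j : ℕ → ℤ) : Prop where
  apply : ∀ x, (φ x).1 = (f x.1.1, x.1.2.1 + j x.1.2.2 - j x.1.1, f x.1.2.2)

theorem Acts.comp {n m k : ℕ} {φ : PosPair n → PosPair m} {ψ : PosPair m → PosPair k}
    {f f' : ℕ → ℕ} {j j' : ℕ → ℤ} (h : Acts φ f j) (h' : Acts ψ f' j') :
    Acts (fun x => ψ (φ x)) (fun a => f' (f a)) (fun a => j a + j' (f a)) := by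
  refine ⟨fun x => ?_⟩
  rw [h'.apply (φ x), h.apply x]
  exact Prod.ext rfl (Prod.ext (by simp only; ring) rfl)

/-- Only differences of windings act on pairs, so an additive constant `c` is invisible. This is
where translations of the universal cover are divided out. -/
theorem Acts.congr {n m : ℕ} {φ : PosPair n → PosPair m} {f f' : ℕ → ℕ} {j j' : ℕ → ℤ}
    (h : Acts φ f j) (c : ℤ) (e : ∀ a, a < n → f' a = f a ∧ j' a = j a + c) : Acts φ f' j' := by
  refine ⟨fun x => ?_⟩
  obtain ⟨e₁, e₂⟩ := e _ x.2.1
  obtain ⟨e₃, e₄⟩ := e _ x.2.2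
  rw [h.apply x, e₁, e₂, e₃, e₄]
  exact Prod.ext rfl (Prod.ext (by simp only; ring) rfl)

theorem Acts.ext {n m : ℕ} {φ ψ : PosPair n → PosPair m} {f f' : ℕ → ℕ} {j j' : ℕ → ℤ}
    (h : Acts φ f j) (h' : Acts ψ f' j') (c : ℤ)
    (e : ∀ a, a < n → f a = f' a ∧ j a = j' a + c) : φ = ψ := by
  have h'' := h'.congr c e
  funext x
  exact Subtype.ext ((h.apply x).trans (h''.apply x).symm)

theorem acts_id (n : ℕ) : Acts (fun x : PosPair n => x) (fun a => a) (fun _ => 0) :=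
  ⟨fun x => Prod.ext rfl (Prod.ext (by simp) rfl)⟩

/-- A map between pairs of points with given action and winding. -/
def PosPair.map {n m : ℕ} (f : ℕ → ℕ) (j : ℕ → ℤ) (h : ∀ a, a < n → f a < m) (x : PosPair n) :
    PosPair m :=
  ⟨(f x.1.1, x.1.2.1 + j x.1.2.2 - j x.1.1, f x.1.2.2), h _ x.2.1, h _ x.2.2⟩

/-- The action of a coface on points. -/
def facePos (i a : ℕ) : ℕ := if a + 1 < i then a else a + 1

/-- The action of a codegeneracy on points. -/
def degPos (i a : ℕ) : ℕ := if a < i then a else a - 1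

/-- The action of the `c`-th power of the cycle on points. -/
def rotPos (n c a : ℕ) : ℕ := if a < c then a + n - c else a - c

/-- The winding of the `c`-th power of the cycle. -/
def rotWind (c a : ℕ) : ℤ := if a < c then -1 else 0

/-- The action of a generator on pairs of points. -/
def posMap : {x y : LObj} → LGen x y → (posObj x ⟶ posObj y)
  | _, _, .d n i h₁ h₂ => PosPair.map (n := n) (facePos i) (fun _ => 0)
      (by intro a ha; unfold facePos; split_ifs <;> omega)
  | _, _, .s n i h₁ h₂ => PosPair.map (n := n + 1) (degPos i) (fun _ => 0)
      (by intro a ha; unfold degPos; split_ifs <;> omega)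
  | _, _, .τ n h => PosPair.map (n := n) (rotPos n 1) (rotWind 1)
      (by intro a ha; unfold rotPos; split_ifs <;> omega)
  | _, _, .t => fun _ => ()

/-- The action of words on pairs of points. -/
abbrev posPaths : Paths LObj ⥤ Fun := Paths.lift { obj := posObj, map := posMap }

theorem posPaths_w {x y : LObj} (g : LGen x y) : posPaths.map g.w = posMap g :=
  lift_w (V := LObj) (C := Fun) _ g

/-- A word in the generators acts by the function `f` on points, with winding `j`. -/
def WordActs {n m : ℕ} (p : (Paths.of LObj).obj (.fin n) ⟶ (Paths.of LObj).obj (.fin m))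
    (f : ℕ → ℕ) (j : ℕ → ℤ) : Prop :=
  Acts (n := n) (m := m) (posPaths.map p) f j

theorem WordActs.comp {n m k : ℕ}
    {p : (Paths.of LObj).obj (.fin n) ⟶ (Paths.of LObj).obj (.fin m)}
    {q : (Paths.of LObj).obj (.fin m) ⟶ (Paths.of LObj).obj (.fin k)}
    {f f' : ℕ → ℕ} {j j' : ℕ → ℤ} (h : WordActs p f j) (h' : WordActs q f' j') :
    WordActs (p ≫ q) (fun a => f' (f a)) (fun a => j a + j' (f a)) := by
  have e : posPaths.map (p ≫ q) = posPaths.map p ≫ posPaths.map q := posPaths.map_comp p q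
  unfold WordActs
  rw [e]
  exact Acts.comp (φ := posPaths.map p) (ψ := posPaths.map q) h h'

theorem wordActs_id (n : ℕ) : WordActs (𝟙 ((Paths.of LObj).obj (.fin n))) (fun a => a)
    (fun _ => 0) := by
  unfold WordActs
  rw [show posPaths.map (𝟙 ((Paths.of LObj).obj (.fin n))) = 𝟙 _ from posPaths.map_id _]
  exact acts_id n

theorem wordActs_d (n i : ℕ) (h₁ : 1 ≤ i) (h₂ : i ≤ n + 1) :
    WordActs (LGen.d n i h₁ h₂).w (facePos i) (fun _ => 0) := by
  unfold WordActs
  rw [posPaths_w]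
  exact ⟨fun x => rfl⟩

theorem wordActs_s (n i : ℕ) (h₁ : 1 ≤ i) (h₂ : i ≤ n) :
    WordActs (LGen.s n i h₁ h₂).w (degPos i) (fun _ => 0) := by
  unfold WordActs
  rw [posPaths_w]
  exact ⟨fun x => rfl⟩

theorem wordActs_τ (n : ℕ) (h : 1 ≤ n) :
    WordActs (LGen.τ n h).w (rotPos n 1) (rotWind 1) := by
  unfold WordActs
  rw [posPaths_w]
  exact ⟨fun x => rfl⟩

/-- The formulas for `rotPos` and `rotWind` describe at most one full turn, hence the bound on `c`.
-/
theorem wordActs_τpow (n : ℕ) (h : 1 ≤ n) (c : ℕ) (hc : c ≤ n) :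
    WordActs (LGen.τpow n h c) (rotPos n c) (rotWind c) := by
  induction c with
  | zero => exact (wordActs_id n).congr 0 (fun a ha => by simp [rotPos, rotWind])
  | succ c ih =>
    refine ((wordActs_τ n h).comp (ih (by omega))).congr 0 (fun a ha => ?_)
    simp only [rotPos, rotWind]
    split_ifs <;> omega

theorem WordActs.ext {n m : ℕ}
    {p q : (Paths.of LObj).obj (.fin n) ⟶ (Paths.of LObj).obj (.fin m)}
    {f f' : ℕ → ℕ} {j j' : ℕ → ℤ} (h : WordActs p f j) (h' : WordActs q f' j') (c : ℤ)
    (e : ∀ a, a < n → f a = f' a ∧ j a = j' a + c) : posPaths.map p = posPaths.map q :=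
  Acts.ext h h' c e

/-- The action of `Λ'` on pairs of points. -/
def posFunctor : Lam ⥤ Fun :=
  CategoryTheory.Quotient.lift _ posPaths (by
    rintro x y p q h
    cases h with
    | torsion n h =>
      -- A full turn moves each point of the cover back by one period, so its winding is constantly
      -- `-1`; this differs from the identity by a constant only.
      refine (wordActs_τpow n h n le_rfl).ext (wordActs_id n) (-1) (fun a ha => ?_)
      simp only [rotPos, rotWind]
      split_ifs <;> omega
    -- Both sides land in the one-point type attached to `*`.
    | terminal => simp only [Functor.map_comp, posPaths_w]; rfl
    | face_face n i j h₁ h₂ h₃ =>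
      refine ((wordActs_d ..).comp (wordActs_d ..)).ext
        ((wordActs_d ..).comp (wordActs_d ..)) 0 (fun a ha => ?_)
      simp only [facePos]
      split_ifs <;> omega
    | deg_deg n i j h₁ h₂ h₃ =>
      refine ((wordActs_s ..).comp (wordActs_s ..)).ext
        ((wordActs_s ..).comp (wordActs_s ..)) 0 (fun a ha => ?_)
      simp only [degPos]
      split_ifs <;> omega
    | deg_face_lt n i j h₁ h₂ h₃ =>
      refine ((wordActs_d ..).comp (wordActs_s ..)).ext
        ((wordActs_s ..).comp (wordActs_d ..)) 0 (fun a ha => ?_)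
      simp only [facePos, degPos]
      split_ifs <;> omega
    | deg_face_gt n i j h₁ h₂ h₃ =>
      refine ((wordActs_d ..).comp (wordActs_s ..)).ext
        ((wordActs_s ..).comp (wordActs_d ..)) 0 (fun a ha => ?_)
      simp only [facePos, degPos]
      split_ifs <;> omega
    | deg_face_eq n j h₁ h₂ =>
      refine ((wordActs_d ..).comp (wordActs_s ..)).ext (wordActs_id n) 0 (fun a ha => ?_)
      simp only [facePos, degPos, and_true]
      split_ifs <;> omega
    | deg_face_succ n j h₁ h₂ =>
      refine ((wordActs_d ..).comp (wordActs_s ..)).ext (wordActs_id n) 0 (fun a ha => ?_)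
      simp only [facePos, degPos, and_true]
      split_ifs <;> omega
    | cycle_face n i h₁ h₂ =>
      refine ((wordActs_d ..).comp (wordActs_τ ..)).ext
        ((wordActs_τ ..).comp (wordActs_d ..)) 0 (fun a ha => ?_)
      simp only [facePos, rotPos, rotWind]
      split_ifs <;> omega
    | cycle_face_one n =>
      refine ((wordActs_d ..).comp (wordActs_τ ..)).ext (wordActs_d ..) 0 (fun a ha => ?_)
      simp only [facePos, rotPos, rotWind]
      split_ifs <;> omega
    | cycle_deg n i h₁ h₂ =>
      refine ((wordActs_s ..).comp (wordActs_τ ..)).ext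
        ((wordActs_τ ..).comp (wordActs_s ..)) 0 (fun a ha => ?_)
      simp only [degPos, rotPos, rotWind]
      split_ifs <;> omega
    | cycle_deg_one n h =>
      refine ((wordActs_s ..).comp (wordActs_τ ..)).ext
        ((wordActs_τ ..).comp ((wordActs_τ ..).comp (wordActs_s ..))) 0 (fun a ha => ?_)
      simp only [degPos, rotPos, rotWind]
      split_ifs <;> omega)

/-- A map of `Λ'` acts by the function `f` on points, with winding `j`. -/
def Lam.Acts {n m : ℕ} (u : Lam.fin n ⟶ Lam.fin m) (f : ℕ → ℕ) (j : ℕ → ℤ) : Prop :=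
  LaxShadow.Acts (n := n) (m := m) (posFunctor.map u) f j

namespace Lam

theorem Acts.comp {n m k : ℕ} {u : fin n ⟶ fin m} {v : fin m ⟶ fin k}
    {f f' : ℕ → ℕ} {j j' : ℕ → ℤ} (h : Acts u f j) (h' : Acts v f' j') :
    Acts (u ≫ v) (fun a => f' (f a)) (fun a => j a + j' (f a)) := by
  have e : posFunctor.map (u ≫ v) = posFunctor.map u ≫ posFunctor.map v := posFunctor.map_comp u v
  unfold Acts
  rw [e]
  exact LaxShadow.Acts.comp (φ := posFunctor.map u) (ψ := posFunctor.map v) h h'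

theorem acts_eqToHom {n m : ℕ} (h : n = m) (h' : fin n = fin m) :
    Acts (eqToHom h') (fun a => a) (fun _ => 0) := by
  subst h
  unfold Acts
  rw [eqToHom_refl, show posFunctor.map (𝟙 (fin n)) = 𝟙 _ from posFunctor.map_id _]
  exact acts_id n

theorem acts_d (N M i : ℕ) (hM : M = N + 1) (h₁ : 1 ≤ i) (h₂ : i ≤ N + 1) :
    Acts (d N M i hM h₁ h₂) (facePos i) (fun _ => 0) := by
  subst hM
  exact ((show Acts (gen (.d N i h₁ h₂)) _ _ from wordActs_d N i h₁ h₂).comp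
    (acts_eqToHom rfl rfl)).congr 0 (fun a ha => by simp)

theorem acts_s (N M i : ℕ) (hN : N = M + 1) (h₁ : 1 ≤ i) (h₂ : i ≤ M) :
    Acts (s N M i hN h₁ h₂) (degPos i) (fun _ => 0) := by
  subst hN
  exact ((acts_eqToHom rfl rfl).comp
    (show Acts (gen (.s M i h₁ h₂)) _ _ from wordActs_s M i h₁ h₂)).congr 0 (fun a ha => by simp)

theorem acts_rot (n c : ℕ) (hc : c ≤ n) : Acts (rot n c) (rotPos n c) (rotWind c) := by
  induction c with
  | zero => exact (acts_eqToHom rfl rfl).congr 0 (fun a ha => by simp [rotPos, rotWind])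
  | succ c ih =>
    have h1 : Acts (cyc n) (rotPos n 1) (rotWind 1) := by
      rw [cyc, dif_pos (show 1 ≤ n by omega)]
      exact wordActs_τ n (by omega)
    refine (h1.comp (ih (by omega))).congr 0 (fun a ha => ?_)
    simp only [rotPos, rotWind]
    split_ifs <;> omega

end Lam

namespace DExpr

/-- The function on points given by an expression. -/
def pos : {k l : ℕ} → DExpr k l → ℕ → ℕ
  | _, _, cast _ => fun i => i
  | _, _, comp e f => fun i => f.pos (e.pos i)
  | _, _, addLeft a e => fun i => if i < a then i else a + e.pos (i - a)
  | _, _, addRight (k := k) (l := l) e b => fun i => if i < k then e.pos i else l + (i - k)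
  | _, _, face => fun i => i + 1
  | _, _, deg => fun i => if i < 2 then 0 else i - 1

theorem pos_lt {k l : ℕ} (e : DExpr k l) : ∀ i, i < k → e.pos i < l := by
  induction e with
  | cast h => intro i hi; simp only [pos]; omega
  | comp e f he hf => intro i hi; exact hf _ (he _ hi)
  | addLeft a e he =>
    intro i hi
    simp only [pos]
    split_ifs
    · omega
    · have := he (i - a) (by omega)
      omega
  | addRight e b he =>
    intro i hi
    simp only [pos]
    split_ifs with h
    · have := he i h
      omega
    · omega
  | face => intro i hi; omega
  | deg => intro i hi; simp only [pos]; split_ifs; omega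

/-- Expressions contain cofaces and codegeneracies but no cycles, so their realizations have zero
winding. The points before `p` stay fixed and those beyond the block of length `k` are shifted by `l
- k`. -/
theorem acts_real {k l : ℕ} (e : DExpr k l) : ∀ (p q N M : ℕ) (hN : N = p + k + q)
    (hM : M = p + l + q), Lam.Acts (e.real p q N M hN hM)
      (fun i => if i < p then i else if i < p + k then p + e.pos (i - p) else i + l - k)
      (fun _ => 0) := by
  induction e with
  | cast h =>
    intro p q N M hN hM
    refine (Lam.acts_eqToHom (by omega) _).congr 0 (fun a ha => ?_)
    simp only [pos]
    split_ifs <;> omega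
  | comp e f he hf =>
    rename_i k l m
    intro p q N M hN hM
    refine ((he p q N (p + l + q) hN rfl).comp (hf p q _ M rfl hM)).congr 0 (fun a ha => ?_)
    simp only [pos, add_zero, and_true]
    by_cases h₁ : a < p
    · simp [h₁]
    · by_cases h₂ : a < p + k
      · have := e.pos_lt (a - p) (by omega)
        rw [if_neg h₁, if_pos h₂, if_neg h₁, if_pos h₂, if_neg (by omega), if_pos (by omega)]
        congr 2; omega
      · simp only [h₁, h₂, if_false]
        rw [if_neg (by omega), if_neg (by omega)]
        omega
  | addLeft a e he =>
    rename_i k l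
    intro p q N M hN hM
    refine (he (p + a) q N M (by omega) (by omega)).congr 0 (fun i hi => ?_)
    simp only [pos, add_zero, and_true]
    split_ifs <;> try omega
    rw [show i - p - a = i - (p + a) by omega]; omega
  | addRight e b he =>
    rename_i k l
    intro p q N M hN hM
    refine (he p (b + q) N M (by omega) (by omega)).congr 0 (fun i hi => ?_)
    simp only [pos, add_zero, and_true]
    split_ifs <;> omega
  | face =>
    intro p q N M hN hM
    refine (Lam.acts_d N M (p + 1) (by omega) (by omega) (by omega)).congr 0 (fun i hi => ?_)
    simp only [pos, facePos, add_zero, and_true]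
    split_ifs <;> omega
  | deg =>
    intro p q N M hN hM
    refine (Lam.acts_s N M (p + 1) (by omega) (by omega) (by omega)).congr 0 (fun i hi => ?_)
    simp only [pos, degPos, add_zero, and_true]
    split_ifs <;> omega

end DExpr

namespace Lam

/-- Evaluating the action on the pair `(a, 0, b)` reads off the image of `a` and the difference of
the windings, so both depend on the map of `Λ'` alone. -/
theorem Acts.eq {n m : ℕ} {u : fin n ⟶ fin m} {f f' : ℕ → ℕ} {j j' : ℕ → ℤ} (h : Acts u f j)
    (h' : Acts u f' j') (a b : ℕ) (ha : a < n) (hb : b < n) :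
    f a = f' a ∧ j b - j a = j' b - j' a := by
  have e := (h.apply ⟨(a, 0, b), ha, hb⟩).symm.trans (h'.apply ⟨(a, 0, b), ha, hb⟩)
  simp only [Prod.mk.injEq] at e
  exact ⟨e.1, by have := e.2.1; omega⟩

/-- A rotation followed by a map that does not wind around determines both. -/
theorem rot_comp_injective {n m c c' : ℕ} {u u' : fin n ⟶ fin m} {f f' : ℕ → ℕ}
    (hu : Acts u f (fun _ => 0)) (hu' : Acts u' f' (fun _ => 0)) (hc : c < n) (hc' : c' < n)
    (h : rot n c ≫ u = rot n c' ≫ u') : c = c' ∧ ∀ a, a < n → f a = f' a := by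
  have h₁ := (acts_rot n c hc.le).comp hu
  have h₂ := (acts_rot n c' hc'.le).comp hu'
  rw [h] at h₁
  have key := h₁.eq h₂
  -- The rotation shows in the winding relative to point `0`: with no rotation it vanishes
  -- everywhere, otherwise it jumps from `0` to `1` exactly at `c`. Since `c < n`, the last point
  -- already detects whether there is a jump.
  have : c = c' := by
    have k₁ := (key 0 c (by omega) hc).2
    have k₂ := (key 0 c' (by omega) hc').2
    have k₃ := (key 0 (n - 1) (by omega) (by omega)).2
    simp only [rotWind] at k₁ k₂ k₃
    split_ifs at k₁ k₂ k₃ <;> omega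
  subst this
  refine ⟨rfl, fun a ha => ?_⟩
  -- Rotation by `n - c` undoes rotation by `c`, so this point is the preimage of `a`.
  have := (key (rotPos n (n - c) a) 0 (by unfold rotPos; split_ifs <;> omega) (by omega)).1
  have e : rotPos n c (rotPos n (n - c) a) = a := by
    simp only [rotPos]; split_ifs <;> omega
  simpa only [e] using this

end Lam

/-! ### Folding words into a single symbol -/

section Fold

variable {C : Type u₁} [Bicategory.{w₁, v₁} C] {D : Type u₂} [Bicategory.{w₂, v₂} D]
variable (F : LaxFunctor C D) {a b c d : C}

/-- The multiplication of a lax functor, applied to two 2-cells. -/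
def laxMul {f : F.obj a ⟶ F.obj b} {g : F.obj b ⟶ F.obj c} {V : a ⟶ b} {W : b ⟶ c}
    (u : f ⟶ F.map V) (v : g ⟶ F.map W) : f ≫ g ⟶ F.map (V ≫ W) :=
  hcomp u v ≫ F.mapComp V W

/-- The inductive steps for the naturality of multiplying out. Whiskerings reduce to naturality of
the multiplication and the interchange law; associators and unitors reduce to the associativity and
unit axioms of the lax functor. -/
theorem laxMul_whiskerLeft {f : F.obj a ⟶ F.obj b} {g g' : F.obj b ⟶ F.obj c} {V : a ⟶ b}
    {W W' : b ⟶ c} (u : f ⟶ F.map V) (v : g ⟶ F.map W) (v' : g' ⟶ F.map W') (η : g ⟶ g')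
    (e : W ⟶ W') (h : η ≫ v' = v ≫ F.map₂ e) :
    f ◁ η ≫ laxMul F u v' = laxMul F u v ≫ F.map₂ (V ◁ e) := by
  simp only [laxMul, hcomp, Category.assoc, F.mapComp_naturality_right]
  rw [whisker_exchange_assoc, ← whiskerLeft_comp_assoc, h, whiskerLeft_comp_assoc]

theorem laxMul_whiskerRight {f f' : F.obj a ⟶ F.obj b} {g : F.obj b ⟶ F.obj c} {V V' : a ⟶ b}
    {W : b ⟶ c} (u : f ⟶ F.map V) (u' : f' ⟶ F.map V') (v : g ⟶ F.map W) (η : f ⟶ f')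
    (e : V ⟶ V') (h : η ≫ u' = u ≫ F.map₂ e) :
    η ▷ g ≫ laxMul F u' v = laxMul F u v ≫ F.map₂ (e ▷ W) := by
  simp only [laxMul, hcomp, Category.assoc, F.mapComp_naturality_left]
  rw [← comp_whiskerRight_assoc, h, comp_whiskerRight_assoc, whisker_exchange_assoc]

theorem laxMul_associator {f : F.obj a ⟶ F.obj b} {g : F.obj b ⟶ F.obj c} {h : F.obj c ⟶ F.obj d}
    {V : a ⟶ b} {W : b ⟶ c} {U : c ⟶ d} (u : f ⟶ F.map V) (v : g ⟶ F.map W) (w : h ⟶ F.map U) :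
    (α_ f g h).hom ≫ laxMul F u (laxMul F v w) =
      laxMul F (laxMul F u v) w ≫ F.map₂ (α_ V W U).hom := by
  simp only [laxMul, hcomp, Category.assoc, comp_whiskerRight, whiskerLeft_comp]
  have := F.map₂_associator V W U
  rw [← whisker_exchange_assoc (F.mapComp V W) w, this]
  simp

theorem laxMul_leftUnitor {f : F.obj a ⟶ F.obj b} {V : a ⟶ b} (u : f ⟶ F.map V) :
    (λ_ f).hom ≫ u = laxMul F (F.mapId a) u ≫ F.map₂ (λ_ V).hom := by
  have := F.map₂_leftUnitor V
  have e : F.map₂ (λ_ V).inv ≫ F.map₂ (λ_ V).hom = 𝟙 _ := by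
    rw [← F.map₂_comp, Iso.inv_hom_id, F.map₂_id]
  -- The unit axiom describes `F` of the inverse unitor. Substituted into `e`, it says that
  -- inserting a unit, multiplying and applying `F` of the unitor is the identity.
  rw [this] at e
  simp only [laxMul, hcomp, Category.assoc] at e ⊢
  rw [← whisker_exchange_assoc, ← cancel_epi (λ_ f).inv, Iso.inv_hom_id_assoc]
  rw [Iso.inv_comp_eq] at e
  rw [e]
  simp

theorem laxMul_rightUnitor {f : F.obj a ⟶ F.obj b} {V : a ⟶ b} (u : f ⟶ F.map V) :
    (ρ_ f).hom ≫ u = laxMul F u (F.mapId b) ≫ F.map₂ (ρ_ V).hom := by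
  have := F.map₂_rightUnitor V
  have e : F.map₂ (ρ_ V).inv ≫ F.map₂ (ρ_ V).hom = 𝟙 _ := by
    rw [← F.map₂_comp, Iso.inv_hom_id, F.map₂_id]
  rw [this] at e
  simp only [laxMul, hcomp, Category.assoc] at e ⊢
  rw [← cancel_epi (ρ_ f).inv, Iso.inv_hom_id_assoc]
  rw [Iso.inv_comp_eq] at e
  rw [e]
  simp

/-- Squares over an invertible 2-cell can be turned around, which handles the inverse associators
and unitors. -/
theorem lax_inv {f g : F.obj a ⟶ F.obj b} {V W : a ⟶ b} (u : f ⟶ F.map V) (v : g ⟶ F.map W)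
    (i : f ≅ g) (j : V ≅ W) (h : i.hom ≫ v = u ≫ F.map₂ j.hom) :
    i.inv ≫ u = v ≫ F.map₂ j.inv := by
  rw [Iso.inv_comp_eq, ← Category.assoc, h, Category.assoc, ← F.map₂_comp, j.hom_inv_id,
    F.map₂_id, Category.comp_id]

end Fold

/-! ### Multiplying out words of the free lax functor -/

section

variable {G : Type u₁} [Quiver.{v₁} G]

namespace FreeLax

/-- The 1-cell of the free bicategory obtained from a word by removing the symbol `F`. -/
def content : {a b : FreeLax G} → (a ⟶ b) → (a.pt ⟶ b.pt)
  | _, _, Hom.blk W => W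
  | _, _, Hom.id a => 𝟙 a.pt
  | _, _, Hom.comp f g => content f ≫ content g

theorem edges_content : ∀ {a b : FreeLax G} (f : a ⟶ b), bicatEdges (content f) = edges f
  | _, _, Hom.blk W => rfl
  | _, _, Hom.id a => rfl
  | _, _, Hom.comp f g => congrArg₂ (· ++ ·) (edges_content f) (edges_content g)

/-- The 2-cell multiplying out all symbols of a word. -/
def fold : {a b : FreeLax G} → (f : a ⟶ b) → (f ⟶ block (content f))
  | _, _, Hom.blk W => 𝟙 (block W)
  | _, _, Hom.id a => (functor G).mapId a.pt
  | _, _, Hom.comp f g => laxMul (functor G) (fold f) (fold g)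

/-- Associativity and unitality of the multiplication mean that the order in which symbols are
merged does not matter. For a unit insertion or a multiplication the content does not change, and
`e` is an identity. -/
theorem fold_natural {a b : FreeLax G} {f g : a ⟶ b} (η : f ⟶ g) :
    ∃ e : content f ⟶ content g, η ≫ fold g = fold f ≫ blockMap e := by
  induction η using Quot.ind with
  | mk η =>
    induction η with
    | refl f => exact ⟨𝟙 _, by rw [blockMap_id]; exact (Category.id_comp _).trans (Category.comp_id _).symm⟩
    | vcomp η θ h h' =>
      obtain ⟨e, h⟩ := h
      obtain ⟨e', h'⟩ := h'
      refine ⟨e ≫ e', ?_⟩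
      rw [blockMap_comp, ← Category.assoc, ← h, Category.assoc, ← h', ← Category.assoc]
      rfl
    | whiskerLeft f η h =>
      obtain ⟨e, h⟩ := h
      exact ⟨_, laxMul_whiskerLeft (functor G) (fold f) _ _ _ e h⟩
    | whiskerRight η g h =>
      obtain ⟨e, h⟩ := h
      exact ⟨_, laxMul_whiskerRight (functor G) _ _ (fold g) _ e h⟩
    | associator f g h => exact ⟨_, laxMul_associator (functor G) (fold f) (fold g) (fold h)⟩
    | associatorInv f g h =>
      exact ⟨_, lax_inv (functor G) _ _ _ _
        (laxMul_associator (functor G) (fold f) (fold g) (fold h))⟩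
    | rightUnitor f => exact ⟨_, laxMul_rightUnitor (functor G) (fold f)⟩
    | rightUnitorInv f =>
      exact ⟨_, lax_inv (functor G) _ _ _ _ (laxMul_rightUnitor (functor G) (fold f))⟩
    | leftUnitor f => exact ⟨_, laxMul_leftUnitor (functor G) (fold f)⟩
    | leftUnitorInv f =>
      exact ⟨_, lax_inv (functor G) _ _ _ _ (laxMul_leftUnitor (functor G) (fold f))⟩
    | map₂ η =>
      rename_i a b W W'
      have e : blockMap η ≫ 𝟙 (block W') = 𝟙 (block W) ≫ blockMap η := by
        rw [Category.comp_id, Category.id_comp]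
      exact ⟨η, e⟩
    | unit a =>
      have e (m : 𝟙 (⟨a⟩ : FreeLax G) ⟶ block (𝟙 a)) : m ≫ 𝟙 _ = m ≫ blockMap (𝟙 (𝟙 a)) := by
        rw [blockMap_id]
      exact ⟨𝟙 (𝟙 a), e _⟩
    | mul W W' =>
      have e (m : block W ≫ block W' ⟶ block (W ≫ W')) : m ≫ 𝟙 _ =
          (hcomp (𝟙 (block W)) (𝟙 (block W')) ≫ m) ≫ blockMap (𝟙 (W ≫ W')) := by
        rw [blockMap_id, hcomp_id, Category.id_comp]
      exact ⟨𝟙 (W ≫ W'), e _⟩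

/-- Multiplying out does nothing on a single symbol, so naturality writes any 2-cell into it as
`fold f` followed by `F` of a 2-cell of the free bicategory, and the latter is unique. -/
theorem hom_block_ext {a b : FreeBicategory G} {f : (⟨a⟩ : FreeLax G) ⟶ ⟨b⟩} {V : a ⟶ b}
    (η θ : f ⟶ block V) : η = θ := by
  obtain ⟨e, h⟩ := fold_natural η
  obtain ⟨e', h'⟩ := fold_natural θ
  obtain rfl : e = e' := bicat_hom_ext _ _
  exact (Category.comp_id η).symm.trans ((h.trans h'.symm).trans (Category.comp_id θ))

theorem hom_ext_of_shape {a b : FreeLax G} {f g : a ⟶ b} {s : List (Σ x y : G, x ⟶ y)}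
    (h : shape g = [s]) (η θ : f ⟶ g) : η = θ := by
  have e : shape g = shape (block (content g)) := by
    rw [shape_block, edges_content, ← flatten_shape, h]; simp
  have := hom_block_ext (η ≫ can _ _ e) (θ ≫ can _ _ e)
  have := congrArg (· ≫ can _ _ e.symm) this
  simpa only [Category.assoc, can_comp, can_self, Category.comp_id] using this

/-- Generators other than structural ones produce a symbol in their target, and symbols never
disappear. A 2-cell into a word without symbols is therefore purely structural. -/
theorem eq_can_of_blocks {a b : FreeLax G} {f g : a ⟶ b} (η : f ⟶ g) :
    shape g = [] → ∃ h : shape f = shape g, η = can f g h := by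
  induction η using Quot.ind with
  | mk η =>
    induction η with
    | refl f => exact fun _ => ⟨rfl, (can_self f rfl).symm⟩
    | vcomp η θ h h' =>
      intro hg
      obtain ⟨e', h'⟩ := h' hg
      obtain ⟨e, h⟩ := h (e'.trans hg)
      exact ⟨e.trans e', (congrArg₂ (· ≫ ·) h h').trans (can_comp e e')⟩
    | whiskerLeft f η h =>
      intro hg
      rw [shape_comp] at hg
      obtain ⟨e, h⟩ := h (List.append_eq_nil_iff.mp hg).2
      exact ⟨_, (congrArg (f ◁ ·) h).trans (whiskerLeft_can f e)⟩
    | whiskerRight η g h =>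
      intro hg
      rw [shape_comp] at hg
      obtain ⟨e, h⟩ := h (List.append_eq_nil_iff.mp hg).1
      exact ⟨_, (congrArg (· ▷ g) h).trans (whiskerRight_can g e)⟩
    | associator f g h => exact fun _ => ⟨_, associator_hom_eq_can f g h (by simp)⟩
    | associatorInv f g h => exact fun _ => ⟨_, associator_inv_eq_can f g h (by simp)⟩
    | rightUnitor f => exact fun _ => ⟨_, rightUnitor_hom_eq_can f (by simp)⟩
    | rightUnitorInv f => exact fun _ => ⟨_, rightUnitor_inv_eq_can f (by simp)⟩
    | leftUnitor f => exact fun _ => ⟨_, leftUnitor_hom_eq_can f (by simp)⟩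
    | leftUnitorInv f => exact fun _ => ⟨_, leftUnitor_inv_eq_can f (by simp)⟩
    | map₂ η => intro hg; rw [shape_block] at hg; cases hg
    | unit a => intro hg; rw [shape_block] at hg; cases hg
    | mul W W' => intro hg; rw [shape_block] at hg; cases hg

end FreeLax

end

/-! ### The positions of the symbols determine a 2-cell -/

section

variable {G : Type u₁} [Quiver.{v₁} G]

namespace FreeLax

/-- A 2-cell that has a representative acting trivially on symbols. -/
def IsTrivial {a b : FreeLax G} {f g : a ⟶ b} (η : f ⟶ g) : Prop :=
  ∃ η' : Hom₂ f g, η'.mk = η ∧ (∀ i, i < blocks f → η'.onBlocks.pos i = i) ∧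
    ∀ (p q N M : ℕ) (hN : N = p + blocks f + q) (hM : M = p + blocks g + q),
      ∃ h : N = M, η'.onBlocks.real p q N M hN hM = eqToHom (by rw [h])

/-- A 2-cell acts on the positions of symbols by a given function. -/
def HasPos {a b : FreeLax G} {f g : a ⟶ b} (η : f ⟶ g) (p : ℕ → ℕ) : Prop :=
  ∃ η' : Hom₂ f g, η'.mk = η ∧ ∀ i, i < blocks f → η'.onBlocks.pos i = p i

section

variable {a b c d : FreeLax G}

theorem exists_hasPos {f g : a ⟶ b} (η : f ⟶ g) :
    ∃ p, HasPos η p ∧ ∀ i, i < blocks f → p i < blocks g := by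
  induction η using Quot.ind with
  | mk η => exact ⟨_, ⟨η, rfl, fun _ _ => rfl⟩, η.onBlocks.pos_lt⟩

/-- Links the combinatorial positions of a chosen representative with the model of `Λ'`, where they
no longer depend on the representative. -/
theorem HasPos.acts {f g : a ⟶ b} {η : f ⟶ g} {p : ℕ → ℕ} (h : HasPos η p) :
    Lam.Acts (onBlocks η) p (fun _ => 0) := by
  obtain ⟨η', rfl, h⟩ := h
  refine (η'.onBlocks.acts_real 0 0 _ _ (by omega) (by omega)).congr 0 (fun i hi => ?_)
  simp only [not_lt_zero, if_false, zero_add, Nat.sub_zero, add_zero, and_true, if_pos hi]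
  exact (h i hi).symm

theorem HasPos.congr {f g : a ⟶ b} {η : f ⟶ g} {p p' : ℕ → ℕ} (h : HasPos η p)
    (e : ∀ i, i < blocks f → p i = p' i) : HasPos η p' := by
  obtain ⟨η', h₁, h₂⟩ := h
  exact ⟨η', h₁, fun i hi => (h₂ i hi).trans (e i hi)⟩

theorem HasPos.comp {f g k : a ⟶ b} {η : f ⟶ g} {θ : g ⟶ k} {p q : ℕ → ℕ} (h : HasPos η p)
    (h' : HasPos θ q) : HasPos (η ≫ θ) (fun i => q (p i)) := by
  obtain ⟨η', rfl, h₁⟩ := h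
  obtain ⟨θ', rfl, h₂⟩ := h'
  refine ⟨η'.vcomp θ', rfl, fun i hi => ?_⟩
  have := h₂ _ (η'.onBlocks.pos_lt i hi)
  simp only [Hom₂.onBlocks, DExpr.pos]
  rw [this, h₁ i hi]

theorem HasPos.whiskerLeft (h : a ⟶ b) {f g : b ⟶ c} {η : f ⟶ g} {p : ℕ → ℕ} (hη : HasPos η p) :
    HasPos (h ◁ η) (fun i => if i < blocks h then i else blocks h + p (i - blocks h)) := by
  obtain ⟨η', rfl, h₁⟩ := hη
  refine ⟨η'.whiskerLeft h, rfl, fun i hi => ?_⟩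
  simp only [Hom₂.onBlocks, DExpr.pos]
  split_ifs with hi'
  · rfl
  · rw [h₁ _ (by simp at hi; omega)]

theorem HasPos.whiskerRight (h : b ⟶ c) {f g : a ⟶ b} {η : f ⟶ g} {p : ℕ → ℕ} (hη : HasPos η p) :
    HasPos (η ▷ h) (fun i => if i < blocks f then p i else blocks g + (i - blocks f)) := by
  obtain ⟨η', rfl, h₁⟩ := hη
  refine ⟨η'.whiskerRight h, rfl, fun i hi => ?_⟩
  simp only [Hom₂.onBlocks, DExpr.pos]
  split_ifs with hi'
  · rw [h₁ _ hi']
  · rfl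

theorem IsTrivial.hasPos {f g : a ⟶ b} {η : f ⟶ g} (h : IsTrivial η) : HasPos η (fun i => i) := by
  obtain ⟨η', h₁, h₂, _⟩ := h
  exact ⟨η', h₁, h₂⟩

theorem IsTrivial.onBlocks_eq {f g : a ⟶ b} {η : f ⟶ g} (h : IsTrivial η) :
    ∃ h, onBlocks η = eqToHom h := by
  obtain ⟨η', rfl, _, h⟩ := h
  obtain ⟨e, h⟩ := h 0 0 (blocks f) (blocks g) (by omega) (by omega)
  exact ⟨_, h⟩

theorem isTrivial_of_cast {f g : a ⟶ b} (η : Hom₂ f g) (h : blocks f = blocks g)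
    (e : η.onBlocks = .cast h) : IsTrivial η.mk := by
  refine ⟨η, rfl, fun i _ => by rw [e]; rfl, fun p q N M hN hM => ⟨by omega, ?_⟩⟩
  rw [e]
  rfl

theorem isTrivial_id (f : a ⟶ b) : IsTrivial (𝟙 f) := isTrivial_of_cast (.refl f) rfl rfl

theorem IsTrivial.comp {f g k : a ⟶ b} {η : f ⟶ g} {θ : g ⟶ k} (h : IsTrivial η)
    (h' : IsTrivial θ) : IsTrivial (η ≫ θ) := by
  obtain ⟨η', rfl, h₁, h₂⟩ := h
  obtain ⟨θ', rfl, h₃, h₄⟩ := h'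
  refine ⟨η'.vcomp θ', rfl, fun i hi => ?_, fun p q N M hN hM => ?_⟩
  · have := η'.onBlocks.pos_lt i hi
    simp only [Hom₂.onBlocks, DExpr.pos]
    rw [h₁ i hi] at this ⊢
    exact h₃ i this
  · obtain ⟨e, h₂⟩ := h₂ p q N _ hN rfl
    obtain ⟨e', h₄⟩ := h₄ p q _ M rfl hM
    exact ⟨e.trans e', (congrArg₂ (· ≫ ·) h₂ h₄).trans (eqToHom_trans _ _)⟩

theorem IsTrivial.whiskerLeft (h : a ⟶ b) {f g : b ⟶ c} {η : f ⟶ g} (hη : IsTrivial η) :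
    IsTrivial (h ◁ η) := by
  obtain ⟨η', rfl, h₁, h₂⟩ := hη
  refine ⟨η'.whiskerLeft h, rfl, fun i hi => ?_, fun p q N M hN hM => ?_⟩
  · simp only [Hom₂.onBlocks, DExpr.pos]
    split_ifs with hi'
    · rfl
    · rw [h₁ _ (by simp at hi; omega)]; omega
  · exact h₂ _ _ N M _ _

theorem IsTrivial.whiskerRight (h : b ⟶ c) {f g : a ⟶ b} {η : f ⟶ g} (hη : IsTrivial η) :
    IsTrivial (η ▷ h) := by
  obtain ⟨η', rfl, h₁, h₂⟩ := hη
  refine ⟨η'.whiskerRight h, rfl, fun i hi => ?_, fun p q N M hN hM => ?_⟩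
  · obtain ⟨e, _⟩ := h₂ 0 0 _ _ rfl rfl
    simp only [Hom₂.onBlocks, DExpr.pos]
    split_ifs with hi'
    · rw [h₁ _ hi']
    · omega
  · exact h₂ _ _ N M _ _

theorem isTrivial_blockMap {a b : FreeBicategory G} {V W : a ⟶ b} (e : V ⟶ W) :
    IsTrivial (blockMap e) :=
  isTrivial_of_cast (.map₂ e) rfl rfl

/-- Such 2-cells are built from structure cells alone, each of which is a cast on symbols. -/
theorem isTrivial_ofNorm₂ {a b : FreeLax G} {f g : vert a ⟶ vert b} (η : f ⟶ g) :
    IsTrivial (ofNorm₂ (a := a) (b := b) η) := by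
  induction η using Quot.ind with
  | mk η =>
    obtain ⟨a⟩ := a
    obtain ⟨b⟩ := b
    change FreeBicategory.Hom₂ (B := BlockQuiver G) (a := a) (b := b) f g at η
    induction η with
    | id f => exact isTrivial_id _
    | vcomp η θ h h' => exact h.comp h'
    | whisker_left f η h => exact h.whiskerLeft _
    | whisker_right g η h => exact h.whiskerRight _
    | associator f g h => exact isTrivial_of_cast (.associator _ _ _) _ rfl
    | associator_inv f g h => exact isTrivial_of_cast (.associatorInv _ _ _) _ rfl
    | right_unitor f => exact isTrivial_of_cast (.rightUnitor _) _ rfl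
    | right_unitor_inv f => exact isTrivial_of_cast (.rightUnitorInv _) _ rfl
    | left_unitor f => exact isTrivial_of_cast (.leftUnitor _) _ rfl
    | left_unitor_inv f => exact isTrivial_of_cast (.leftUnitorInv _) _ rfl

theorem isTrivial_normIso : ∀ {a b : FreeLax G} (f : a ⟶ b),
    IsTrivial (normIso f).hom ∧ IsTrivial (normIso f).inv
  | _, _, Hom.blk W => ⟨isTrivial_blockMap _, isTrivial_blockMap _⟩
  | _, _, Hom.id a => ⟨isTrivial_id _, isTrivial_id _⟩
  | _, _, Hom.comp f g =>
    ⟨((isTrivial_normIso f).1.whiskerRight g).comp ((isTrivial_normIso g).1.whiskerLeft _),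
      ((isTrivial_normIso g).2.whiskerLeft _).comp ((isTrivial_normIso f).2.whiskerRight g)⟩

theorem isTrivial_can {f g : a ⟶ b} (h : shape f = shape g) : IsTrivial (can f g h) :=
  (isTrivial_normIso f).1.comp ((isTrivial_ofNorm₂ _).comp (isTrivial_normIso g).2)

/-- Two representatives of one 2-cell may carry different expressions. Their functions agree because
`onBlocks` is well defined in `Λ'` and the action on pairs of points reads the function off. -/
theorem HasPos.eq {f g : a ⟶ b} {η : f ⟶ g} {p q : ℕ → ℕ} (h : HasPos η p) (h' : HasPos η q)
    (i : ℕ) (hi : i < blocks f) : p i = q i :=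
  (h.acts.eq h'.acts i i hi hi).1

/-- The bound `hp` keeps the images of the symbols of `f` to the left of `blocks f'`, so the second
whiskering leaves them alone. -/
theorem HasPos.hcomp {f f' : a ⟶ b} {g g' : b ⟶ c} {η : f ⟶ f'} {θ : g ⟶ g'} {p q : ℕ → ℕ}
    (h : HasPos η p) (h' : HasPos θ q) (hp : ∀ i, i < blocks f → p i < blocks f') :
    HasPos (LaxShadow.hcomp η θ)
      (fun i => if i < blocks f then p i else blocks f' + q (i - blocks f)) := by
  refine ((h.whiskerRight g).comp (h'.whiskerLeft f')).congr (fun i hi => ?_)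
  by_cases h₁ : i < blocks f
  · simp [h₁, hp i h₁]
  · simp [h₁]

end

/-- Induction on the number of target symbols. Splitting off the first target symbol cuts the source
at its preimage, which the position function determines; over one symbol there is nothing to choose,
and the rest is handled by induction. -/
theorem hom_ext_of_hasPos : ∀ (n : ℕ) {a b : FreeLax G} {f g : a ⟶ b} {η θ : f ⟶ g} {p : ℕ → ℕ},
    blocks g = n → HasPos η p → HasPos θ p → η = θ := by
  intro n
  induction n with
  | zero =>
    intro a b f g η θ p hn hη hθ
    have hg : shape g = [] := List.length_eq_zero_iff.mp ((length_shape g).trans hn)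
    obtain ⟨_, rfl⟩ := eq_can_of_blocks η hg
    obtain ⟨_, rfl⟩ := eq_can_of_blocks θ hg
    rfl
  | succ n ih =>
    intro a b f g η θ p hn hη hθ
    obtain ⟨s, T, hg⟩ : ∃ s T, shape g = [s] ++ T := by
      rcases hs : shape g with _ | ⟨s, T⟩
      · have := length_shape g
        rw [hs, hn] at this
        simp at this
      · exact ⟨s, T, rfl⟩
    obtain ⟨c, g₁, g₂, h₁, h₂⟩ := exists_split g _ _ hg
    have hg' : shape (g₁ ≫ g₂) = shape g := by rw [shape_comp, h₁, h₂, hg]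
    have b₁ : blocks g₁ = 1 := by rw [← length_shape, h₁]; rfl
    have b₂ : blocks g₂ = n := by
      have := congrArg List.length hg'
      rw [shape_comp, List.length_append, length_shape, length_shape, length_shape, b₁, hn] at this
      omega
    obtain ⟨f₁, f₂, e, η₁, η₂, rfl⟩ := splits η g₁ g₂ hg'
    obtain ⟨f₁', f₂', e', θ₁, θ₂, rfl⟩ := splits θ g₁ g₂ hg'
    obtain ⟨p₁, hp₁, lt₁⟩ := exists_hasPos η₁
    obtain ⟨p₂, hp₂, lt₂⟩ := exists_hasPos η₂
    obtain ⟨q₁, hq₁, lt₁'⟩ := exists_hasPos θ₁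
    obtain ⟨q₂, hq₂, lt₂'⟩ := exists_hasPos θ₂
    have bf : blocks f = blocks f₁ + blocks f₂ := by
      rw [← length_shape f, e, length_shape, blocks_comp]
    have bf' : blocks f = blocks f₁' + blocks f₂' := by
      rw [← length_shape f, e', length_shape, blocks_comp]
    have E₁ := fun i hi => ((isTrivial_can e).hasPos.comp
      ((hp₁.hcomp hp₂ lt₁).comp (isTrivial_can hg').hasPos)).eq hη i hi
    have E₂ := fun i hi => ((isTrivial_can e').hasPos.comp
      ((hq₁.hcomp hq₂ lt₁').comp (isTrivial_can hg').hasPos)).eq hθ i hi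
    have E := fun i hi => (E₁ i hi).trans (E₂ i hi).symm
    simp only [b₁] at E
    -- A source symbol lies in the first factor exactly when it is sent to target symbol `0`, so
    -- both splittings cut the source at the same place.
    have hb : blocks f₁ = blocks f₁' := by
      rcases Nat.lt_trichotomy (blocks f₁) (blocks f₁') with h | h | h
      · have := E (blocks f₁) (by omega)
        have := lt₁' (blocks f₁) h
        split_ifs at * <;> omega
      · exact h
      · have := E (blocks f₁') (by omega)
        have := lt₁ (blocks f₁') h
        split_ifs at * <;> omega
    obtain ⟨s₁, s₂⟩ : shape f₁ = shape f₁' ∧ shape f₂ = shape f₂' := by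
      have := e.symm.trans e'
      rw [shape_comp, shape_comp] at this
      exact List.append_inj this (by rw [length_shape, length_shape, hb])
    obtain rfl : η₁ = can _ _ s₁ ≫ θ₁ := hom_ext_of_shape h₁ _ _
    -- Positions in the second factors are those of the whole, shifted by `blocks f₁` in the source
    -- and by one in the target.
    obtain rfl : η₂ = can _ _ s₂ ≫ θ₂ := by
      refine ih b₂ hp₂ (((isTrivial_can s₂).hasPos.comp hq₂).congr (fun i hi => ?_))
      have := E (i + blocks f₁) (by omega)
      rw [if_neg (by omega), if_neg (by omega), hb, Nat.add_sub_cancel] at this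
      omega
    rw [← hcomp_comp, hcomp_can, Category.assoc, can_comp_assoc]

end FreeLax

end

/-! ### Normal forms for morphisms of shadow categories -/

section Rotators

variable {B : Type u₁} [Bicategory.{w₁, v₁} B] {C : Type u₂} [Category.{v₂} C] (T : Shadow B C)

theorem Shadow.rot_hcomp {a b : B} {f f' : a ⟶ b} {g g' : b ⟶ a} (η : f ⟶ f') (θ : g ⟶ g') :
    (T.sh a).map (hcomp η θ) ≫ (T.rot f' g').hom =
      (T.rot f g).hom ≫ (T.sh b).map (hcomp θ η) := by
  simp only [hcomp, Functor.map_comp, Category.assoc]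
  rw [T.rot_naturality_right, ← Category.assoc, T.rot_naturality_left, Category.assoc,
    ← Functor.map_comp, ← Functor.map_comp, whisker_exchange]

/-- Put a unit into the first slot of the hexagon: two of its rotators become the two asked for
here, and the third is removed by a unit triangle. -/
theorem Shadow.rot_rot {a b : B} (f : a ⟶ b) (g : b ⟶ a) :
    (T.rot f g).hom ≫ (T.rot g f).hom = 𝟙 _ := by
  have h := T.rot_assoc (𝟙 a) f g
  have h₁ := T.rot_naturality_left (λ_ f).hom g
  have h₂ := T.rot_naturality_left (ρ_ g).hom f
  have h₃ := T.rot_id_left (f ≫ g)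
  rw [← cancel_epi ((T.sh a).map ((λ_ f).hom ▷ g)), ← Category.assoc, h₁, Category.comp_id,
    Category.assoc]
  have e : (T.sh b).map (g ◁ (λ_ f).hom) =
      (T.sh b).map (α_ g (𝟙 a) f).inv ≫ (T.sh b).map ((ρ_ g).hom ▷ f) := by
    rw [← Functor.map_comp]; simp
  rw [e, Category.assoc, h₂, ← Category.assoc (T.sh b |>.map _), ← Category.assoc, h]
  simp only [Category.assoc]
  rw [← Functor.map_comp, show (α_ f g (𝟙 a)).hom ≫ f ◁ (ρ_ g).hom = (ρ_ (f ≫ g)).hom by simp, h₃,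
    ← Functor.map_comp]
  simp

theorem Shadow.rot_inv {a b : B} (f : a ⟶ b) (g : b ⟶ a) : (T.rot f g).inv = (T.rot g f).hom := by
  rw [← Category.comp_id (T.rot f g).inv, ← T.rot_rot f g, Iso.inv_hom_id_assoc]

end Rotators

/-- A labelling of the 1-cells of a bicategory by lists, compatible with splittings, and canonical
2-cells between 1-cells with the same labels. -/
structure Words (B : Type u₁) [Bicategory.{w₁, v₁} B] (X : Type u₂) where
  /-- The list of labels. -/
  list {a b : B} (f : a ⟶ b) : List X
  list_comp {a b c : B} (f : a ⟶ b) (g : b ⟶ c) : list (f ≫ g) = list f ++ list g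
  list_id (a : B) : list (𝟙 a) = []
  /-- The canonical 2-cells. -/
  can {a b : B} (f g : a ⟶ b) (h : list f = list g) : f ⟶ g
  can_self {a b : B} (f : a ⟶ b) (h : list f = list f) : can f f h = 𝟙 f
  can_comp {a b : B} {f g k : a ⟶ b} (h : list f = list g) (h' : list g = list k) :
    can f g h ≫ can g k h' = can f k (h.trans h')
  hcomp_can {a b c : B} {f f' : a ⟶ b} {g g' : b ⟶ c} (h : list f = list f')
    (h' : list g = list g') (h'' : list (f ≫ g) = list (f' ≫ g')) :
    hcomp (can f f' h) (can g g' h') = can (f ≫ g) (f' ≫ g') h''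
  associator_hom {a b c d : B} (f : a ⟶ b) (g : b ⟶ c) (k : c ⟶ d)
    (h : list ((f ≫ g) ≫ k) = list (f ≫ g ≫ k)) : (α_ f g k).hom = can _ _ h
  leftUnitor_hom {a b : B} (f : a ⟶ b) (h : list (𝟙 a ≫ f) = list f) : (λ_ f).hom = can _ _ h
  rightUnitor_hom {a b : B} (f : a ⟶ b) (h : list (f ≫ 𝟙 b) = list f) : (ρ_ f).hom = can _ _ h
  exists_split {a c : B} (f : a ⟶ c) (S T : List X) (h : list f = S ++ T) :
    ∃ (b : B) (f₁ : a ⟶ b) (f₂ : b ⟶ c), list f₁ = S ∧ list f₂ = T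
  target_eq {a b b' : B} (f : a ⟶ b) (g : a ⟶ b') (h : list f = list g) : b = b'
  splits {a b c : B} {f g : a ⟶ c} (η : f ⟶ g) (g₁ : a ⟶ b) (g₂ : b ⟶ c)
    (h : list (g₁ ≫ g₂) = list g) :
    ∃ (f₁ : a ⟶ b) (f₂ : b ⟶ c) (h' : list f = list (f₁ ≫ f₂)) (η₁ : f₁ ⟶ g₁) (η₂ : f₂ ⟶ g₂),
      η = can f (f₁ ≫ f₂) h' ≫ hcomp η₁ η₂ ≫ can (g₁ ≫ g₂) g h

namespace Words

variable {B : Type u₁} [Bicategory.{w₁, v₁} B] {X : Type u₂} (W : Words B X)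

theorem inv_eq_can {a b : B} {f g : a ⟶ b} (e : f ≅ g) (h : W.list f = W.list g)
    (he : e.hom = W.can f g h) : e.inv = W.can g f h.symm := by
  rw [← Category.comp_id e.inv, ← W.can_self f rfl, ← W.can_comp h h.symm, ← he,
    e.inv_hom_id_assoc]

theorem associator_inv {a b c d : B} (f : a ⟶ b) (g : b ⟶ c) (k : c ⟶ d)
    (h : W.list (f ≫ g ≫ k) = W.list ((f ≫ g) ≫ k)) : (α_ f g k).inv = W.can _ _ h :=
  W.inv_eq_can _ h.symm (W.associator_hom f g k h.symm)

variable {C : Type u₃} [Category.{v₃} C] (T : Shadow B C)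

/-- The shadow of a canonical 2-cell. -/
def shCan {a : B} (f g : a ⟶ a) (h : W.list f = W.list g) : (T.sh a).obj f ⟶ (T.sh a).obj g :=
  (T.sh a).map (W.can f g h)

theorem shCan_self {a : B} (f : a ⟶ a) (h : W.list f = W.list f) : W.shCan T f f h = 𝟙 _ := by
  rw [shCan, W.can_self, CategoryTheory.Functor.map_id]

theorem shCan_comp {a : B} {f g k : a ⟶ a} (h : W.list f = W.list g) (h' : W.list g = W.list k) :
    W.shCan T f g h ≫ W.shCan T g k h' = W.shCan T f k (h.trans h') := by
  rw [shCan, shCan, ← Functor.map_comp, W.can_comp]; rfl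

theorem shCan_comp_assoc {a : B} {f g k : a ⟶ a} (h : W.list f = W.list g)
    (h' : W.list g = W.list k) {z : C} (φ : (T.sh a).obj k ⟶ z) :
    W.shCan T f g h ≫ W.shCan T g k h' ≫ φ = W.shCan T f k (h.trans h') ≫ φ := by
  rw [← Category.assoc, shCan_comp]

/-- Naturality of the rotator, applied to a horizontal composite of canonical 2-cells. -/
theorem shCan_rot {a b : B} {f f' : a ⟶ b} {g g' : b ⟶ a} (h : W.list f = W.list f')
    (h' : W.list g = W.list g') (e : W.list (f ≫ g) = W.list (f' ≫ g'))
    (e' : W.list (g ≫ f) = W.list (g' ≫ f')) :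
    W.shCan T (f ≫ g) (f' ≫ g') e ≫ (T.rot f' g').hom =
      (T.rot f g).hom ≫ W.shCan T (g ≫ f) (g' ≫ f') e' := by
  rw [shCan, shCan, ← W.hcomp_can h h' e, ← W.hcomp_can h' h e', T.rot_hcomp]

theorem rot_eq {a b : B} {f f' : a ⟶ b} {g g' : b ⟶ a} (h : W.list f = W.list f')
    (h' : W.list g = W.list g') (e : W.list (f ≫ g) = W.list (f' ≫ g'))
    (e' : W.list (g' ≫ f') = W.list (g ≫ f)) :
    (T.rot f g).hom =
      W.shCan T (f ≫ g) (f' ≫ g') e ≫ (T.rot f' g').hom ≫ W.shCan T (g' ≫ f') (g ≫ f) e' := by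
  rw [← Category.assoc, W.shCan_rot T h h' e e'.symm, Category.assoc, shCan_comp, shCan_self,
    Category.comp_id]

/-- The unit triangle expresses a rotator past a unit through two unitors, both of which are
canonical. -/
theorem rot_id {a : B} (f : a ⟶ a) (h : W.list (f ≫ 𝟙 a) = W.list (𝟙 a ≫ f)) :
    (T.rot f (𝟙 a)).hom = W.shCan T _ _ h := by
  have e := T.rot_id_right f
  have h₁ : W.list (𝟙 a ≫ f) = W.list f := by rw [W.list_comp, W.list_id]; rfl
  have h₂ : W.list (f ≫ 𝟙 a) = W.list f := h.trans h₁
  rw [W.leftUnitor_hom f h₁, W.rightUnitor_hom f h₂] at e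
  have := congrArg (· ≫ W.shCan T _ _ h₁.symm) e
  change ((_ ≫ W.shCan T _ _ h₁) ≫ _) = W.shCan T _ _ h₂ ≫ _ at this
  rwa [Category.assoc, shCan_comp, shCan_self, Category.comp_id, shCan_comp] at this

theorem id_rot {a : B} (f : a ⟶ a) (h : W.list (𝟙 a ≫ f) = W.list (f ≫ 𝟙 a)) :
    (T.rot (𝟙 a) f).hom = W.shCan T _ _ h := by
  rw [← Category.comp_id (T.rot (𝟙 a) f).hom, ← W.shCan_self T _ rfl, ← W.shCan_comp T h.symm h,
    ← W.rot_id T f h.symm, ← Category.assoc, T.rot_rot, Category.id_comp]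

theorem shCan_eq_rot {a : B} {f g : a ⟶ a} (h : W.list f = W.list g)
    (h₁ : W.list f = W.list (𝟙 a ≫ f)) (h₂ : W.list (f ≫ 𝟙 a) = W.list g) :
    W.shCan T f g h = W.shCan T _ _ h₁ ≫ (T.rot (𝟙 a) f).hom ≫ W.shCan T _ _ h₂ := by
  rw [W.id_rot T f (h₁.symm.trans (h.trans h₂.symm)), shCan_comp, shCan_comp]

/-- The composite of two rotators is a rotator, up to canonical 2-cells. -/
theorem exists_rot_comp {a b c : B} (f₁ : a ⟶ b) (f₂ : b ⟶ a) (u₁ : b ⟶ c) (u₂ : c ⟶ b)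
    (h : W.list (f₂ ≫ f₁) = W.list (u₁ ≫ u₂)) :
    ∃ (v₁ : a ⟶ c) (v₂ : c ⟶ a) (h₁ : W.list (f₁ ≫ f₂) = W.list (v₁ ≫ v₂))
      (h₂ : W.list (v₂ ≫ v₁) = W.list (u₂ ≫ u₁)),
      (T.rot f₁ f₂).hom ≫ W.shCan T _ _ h ≫ (T.rot u₁ u₂).hom =
        W.shCan T _ _ h₁ ≫ (T.rot v₁ v₂).hom ≫ W.shCan T _ _ h₂ := by
  have h' := h
  rw [W.list_comp, W.list_comp] at h'
  -- Compare where the second rotation cuts the word `f₂ f₁` left by the first: inside `f₁` or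
  -- inside `f₂`.
  rcases List.append_eq_append_iff.mp h' with ⟨U, e₁, e₂⟩ | ⟨U, e₁, e₂⟩
  -- The second rotator moves `f₂` and an initial piece `m` of `f₁`. With `f₁` moved before, this is
  -- a full turn plus `m`, and the hexagon for `m`, `n`, `f₂` says so.
  · obtain ⟨c', m, n, hm, hn⟩ := W.exists_split f₁ U _ e₂
    obtain rfl : c' = c := W.target_eq (f₂ ≫ m) u₁ (by rw [W.list_comp, hm, e₁])
    have k := T.rot_assoc m n f₂
    have l₁ : W.list (f₂ ≫ m ≫ n) = W.list ((f₂ ≫ m) ≫ n) := by simp [W.list_comp]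
    have l₂ : W.list ((m ≫ n) ≫ f₂) = W.list (m ≫ n ≫ f₂) := by simp [W.list_comp]
    have l₃ : W.list ((n ≫ f₂) ≫ m) = W.list (n ≫ f₂ ≫ m) := by simp [W.list_comp]
    rw [W.associator_inv _ _ _ l₁, W.associator_hom _ _ _ l₂, W.associator_hom _ _ _ l₃] at k
    change _ ≫ W.shCan T _ _ l₁ ≫ _ = W.shCan T _ _ l₂ ≫ _ ≫ W.shCan T _ _ l₃ at k
    have c₁ : W.list f₁ = W.list (m ≫ n) := by rw [W.list_comp, hm, hn, e₂]
    have c₂ : W.list u₁ = W.list (f₂ ≫ m) := by rw [W.list_comp, hm, e₁]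
    have c₃ : W.list u₂ = W.list n := hn.symm
    refine ⟨m, n ≫ f₂, by simp [W.list_comp, c₁], by simp [W.list_comp, c₂, c₃], ?_⟩
    rw [W.rot_eq T c₁ (rfl : W.list f₂ = W.list f₂) (by simp [W.list_comp, c₁])
      (by simp [W.list_comp, c₁]), W.rot_eq T c₂ c₃ (by simp [W.list_comp, c₂, c₃])
      (by simp [W.list_comp, c₂, c₃])]
    simp only [Category.assoc, shCan_comp_assoc]
    have k' := congrArg (W.shCan T (f₁ ≫ f₂) ((m ≫ n) ≫ f₂) (by simp [W.list_comp, c₁]) ≫ · ≫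
      W.shCan T (n ≫ f₂ ≫ m) (u₂ ≫ u₁) (by simp [W.list_comp, c₂, c₃])) k
    simpa only [Category.assoc, shCan_comp_assoc, shCan_comp] using k'
  -- Here only an initial piece `l` of `f₂` moves next, so in total `f₁ ≫ l` moves.
  · obtain ⟨c', l, m, hl, hm⟩ := W.exists_split f₂ _ U e₁
    obtain rfl : c' = c := W.target_eq l u₁ hl
    have k := T.rot_assoc f₁ l m
    have l₁ : W.list (m ≫ f₁ ≫ l) = W.list ((m ≫ f₁) ≫ l) := by simp [W.list_comp]
    have l₂ : W.list ((f₁ ≫ l) ≫ m) = W.list (f₁ ≫ l ≫ m) := by simp [W.list_comp]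
    have l₃ : W.list ((l ≫ m) ≫ f₁) = W.list (l ≫ m ≫ f₁) := by simp [W.list_comp]
    rw [W.associator_inv _ _ _ l₁, W.associator_hom _ _ _ l₂, W.associator_hom _ _ _ l₃] at k
    change _ ≫ W.shCan T _ _ l₁ ≫ _ = W.shCan T _ _ l₂ ≫ _ ≫ W.shCan T _ _ l₃ at k
    have c₁ : W.list f₂ = W.list (l ≫ m) := by rw [W.list_comp, hl, hm, e₁]
    have c₂ : W.list u₁ = W.list l := hl.symm
    have c₃ : W.list u₂ = W.list (m ≫ f₁) := by rw [W.list_comp, hm, e₂]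
    refine ⟨f₁ ≫ l, m, by simp [W.list_comp, c₁], by simp [W.list_comp, c₂, c₃], ?_⟩
    rw [W.rot_eq T (rfl : W.list f₁ = W.list f₁) c₁ (by simp [W.list_comp, c₁])
      (by simp [W.list_comp, c₁]), W.rot_eq T c₂ c₃ (by simp [W.list_comp, c₂, c₃])
      (by simp [W.list_comp, c₂, c₃])]
    simp only [Category.assoc, shCan_comp_assoc]
    have k' := congrArg (W.shCan T (f₁ ≫ f₂) ((f₁ ≫ l) ≫ m) (by simp [W.list_comp, c₁]) ≫ · ≫
      (T.rot l (m ≫ f₁)).hom ≫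
      W.shCan T ((m ≫ f₁) ≫ l) (u₂ ≫ u₁) (by simp [W.list_comp, c₂, c₃])) k
    simp only [Category.assoc, shCan_comp_assoc] at k'
    -- The hexagon contains the rotator of `m ≫ f₁` past `l`; the opposite rotator, composed on the
    -- right, cancels it.
    rw [← Category.assoc (T.rot (m ≫ f₁) l).hom, T.rot_rot, Category.id_comp, shCan_comp] at k'
    exact k'.symm

/-- Morphisms `⟨f⟩ ⟶ ⟨g⟩` that consist of a rotator followed by a 2-cell. -/
def IsNormal {a b : B} {f : a ⟶ a} {g : b ⟶ b} (φ : (T.sh a).obj f ⟶ (T.sh b).obj g) : Prop :=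
  ∃ (f₁ : a ⟶ b) (f₂ : b ⟶ a) (h : W.list f = W.list (f₁ ≫ f₂)) (η : f₂ ≫ f₁ ⟶ g),
    ((W.list f₁).length < (W.list f).length ∨ W.list f = []) ∧
    φ = W.shCan T f (f₁ ≫ f₂) h ≫ (T.rot f₁ f₂).hom ≫ (T.sh b).map η

/-- Uses the rotator that moves the unit. It moves no labels, so the bound on the rotation holds
unless the word is empty. -/
theorem isNormal_sh {a : B} {f g : a ⟶ a} (η : f ⟶ g) : W.IsNormal T ((T.sh a).map η) := by
  have h₁ : W.list f = W.list (𝟙 a ≫ f) := by rw [W.list_comp, W.list_id]; rfl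
  have h₂ : W.list (f ≫ 𝟙 a) = W.list f := by rw [W.list_comp, W.list_id, List.append_nil]
  refine ⟨𝟙 a, f, h₁, W.can _ _ h₂ ≫ η, ?_, ?_⟩
  · rw [W.list_id]
    rcases W.list f with _ | ⟨x, l⟩
    · exact Or.inr rfl
    · exact Or.inl (Nat.succ_pos _)
  · have := W.shCan_eq_rot T (rfl : W.list f = W.list f) h₁ h₂
    rw [shCan_self] at this
    refine (Category.id_comp _).symm.trans ((congrArg (· ≫ (T.sh a).map η) this).trans ?_)
    rw [Functor.map_comp]
    simp only [Category.assoc]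
    rfl

/-- A rotator followed by a 2-cell is normal. -/
theorem isNormal_of_eq {a b : B} {f : a ⟶ a} {g : b ⟶ b} (f₁ : a ⟶ b) (f₂ : b ⟶ a)
    (h : W.list f = W.list (f₁ ≫ f₂)) (η : f₂ ≫ f₁ ⟶ g) :
    W.IsNormal T (W.shCan T f (f₁ ≫ f₂) h ≫ (T.rot f₁ f₂).hom ≫ (T.sh b).map η) := by
  -- If `f₂` is empty the rotator makes a full turn, which violates the bound in `IsNormal`; it is
  -- then canonical and is absorbed into the 2-cell.
  by_cases h₂ : W.list f₂ = []
  · obtain rfl : b = a := W.target_eq (𝟙 b) f₂ ((W.list_id b).trans h₂.symm)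
    have e : W.list f₂ = W.list (𝟙 b) := h₂.trans (W.list_id b).symm
    rw [W.rot_eq T rfl e (by rw [W.list_comp, W.list_comp, e]) (by rw [W.list_comp, W.list_comp, e]),
      W.rot_id T f₁ (by rw [W.list_comp, W.list_comp, W.list_id, List.append_nil]; rfl)]
    simp only [shCan_comp, shCan_comp_assoc]
    rw [shCan, ← Functor.map_comp]
    exact W.isNormal_sh T _
  · refine ⟨f₁, f₂, h, η, Or.inl ?_, rfl⟩
    rw [h, W.list_comp, List.length_append]
    have := List.length_pos_of_ne_nil h₂
    omega

variable {W T}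

theorem IsNormal.sh {a b : B} {f : a ⟶ a} {g g' : b ⟶ b} {φ : (T.sh a).obj f ⟶ (T.sh b).obj g}
    (h : W.IsNormal T φ) (η : g ⟶ g') : W.IsNormal T (φ ≫ (T.sh b).map η) := by
  obtain ⟨f₁, f₂, e, θ, h, rfl⟩ := h
  refine ⟨f₁, f₂, e, θ ≫ η, h, ?_⟩
  simp only [Category.assoc, Functor.map_comp]

/-- Split the 2-cell along `g₁ ≫ g₂`, move the new rotator in front of it by naturality, and merge
the two adjacent rotators. -/
theorem IsNormal.rot {a b c : B} {f : a ⟶ a} {g₁ : b ⟶ c} {g₂ : c ⟶ b}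
    {φ : (T.sh a).obj f ⟶ (T.sh b).obj (g₁ ≫ g₂)} (h : W.IsNormal T φ) :
    W.IsNormal T (φ ≫ (T.rot g₁ g₂).hom) := by
  obtain ⟨f₁, f₂, e, θ, h, rfl⟩ := h
  obtain ⟨u₁, u₂, e', η₁, η₂, rfl⟩ := W.splits θ g₁ g₂ rfl
  obtain ⟨v₁, v₂, h₁, h₂, k⟩ := W.exists_rot_comp T f₁ f₂ u₁ u₂ e'
  have := W.isNormal_of_eq T v₁ v₂ (e.trans h₁) (W.can _ _ h₂ ≫ hcomp η₂ η₁)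
  convert this using 1
  rw [W.can_self, Category.comp_id, Functor.map_comp, Functor.map_comp]
  simp only [Category.assoc]
  rw [T.rot_hcomp]
  have k' := congrArg (W.shCan T _ _ e ≫ · ≫ (T.sh c).map (hcomp η₂ η₁)) k
  simp only [Category.assoc, shCan_comp_assoc] at k'
  exact k'

theorem IsNormal.rotInv {a b c : B} {f : a ⟶ a} {g₁ : b ⟶ c} {g₂ : c ⟶ b}
    {φ : (T.sh a).obj f ⟶ (T.sh c).obj (g₂ ≫ g₁)} (h : W.IsNormal T φ) :
    W.IsNormal T (φ ≫ (T.rot g₁ g₂).inv) := by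
  rw [T.rot_inv]
  exact h.rot

end Words

/-! ### Normal forms in the free shadow categories -/

section

variable {C : Type u₁} [Bicategory.{w₁, v₁} C] {C' : Type u₂} [Category.{v₂} C'] {S : Shadow C C'}
  {D : Type u₃} [Bicategory.{w₂, v₃} D] {D' : Type u₄} [Category.{v₄} D'] {T : Shadow D D'}

/-- The compatibility of `s` with rotators, transported from images under `F` to arbitrary 1-cells
mapping into them. -/
theorem LaxShadowFunctor.rot_laxMul_s (Φ : LaxShadowFunctor S T) {a b : C}
    {f : Φ.F.obj a ⟶ Φ.F.obj b} {g : Φ.F.obj b ⟶ Φ.F.obj a} {V : a ⟶ b} {W : b ⟶ a}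
    (u : f ⟶ Φ.F.map V) (v : g ⟶ Φ.F.map W) :
    (T.rot f g).hom ≫ (T.sh _).map (laxMul Φ.F v u) ≫ Φ.s (W ≫ V) =
      (T.sh _).map (laxMul Φ.F u v) ≫ Φ.s (V ≫ W) ≫ Φ.H.map (S.rot V W).hom := by
  rw [laxMul, laxMul, Functor.map_comp, Functor.map_comp, Category.assoc, Category.assoc,
    ← Category.assoc (T.rot f g).hom, ← T.rot_hcomp, Category.assoc, Φ.s_rot]

end

section

variable {G : Type u₁} [Quiver.{v₁} G]

theorem exists_bicat_split : ∀ {a c : FreeBicategory G} (f : a ⟶ c)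
    (S T : List (Σ x y : G, x ⟶ y)), bicatEdges f = S ++ T →
      ∃ (b : FreeBicategory G) (f₁ : a ⟶ b) (f₂ : b ⟶ c), bicatEdges f₁ = S ∧ bicatEdges f₂ = T
  | _, _, .of e, S, T, h => by
    rcases S with _ | ⟨s, S⟩
    · exact ⟨_, 𝟙 _, .of e, rfl, h⟩
    · obtain ⟨h₁, h₂⟩ := List.cons.inj h
      obtain ⟨rfl, rfl⟩ := List.append_eq_nil_iff.mp h₂.symm
      exact ⟨_, .of e, 𝟙 _, congrArg (fun x => [x]) h₁, rfl⟩
  | _, _, .id a, S, T, h => by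
    obtain ⟨rfl, rfl⟩ := List.append_eq_nil_iff.mp h.symm
    exact ⟨_, 𝟙 _, 𝟙 _, rfl, rfl⟩
  | _, _, .comp f g, S, T, h => by
    rcases List.append_eq_append_iff.mp h with ⟨U, h₁, h₂⟩ | ⟨U, h₁, h₂⟩
    · obtain ⟨b, g₁, g₂, hg₁, hg₂⟩ := exists_bicat_split g U T h₂
      exact ⟨b, f ≫ g₁, g₂, (congrArg _ hg₁).trans h₁.symm, hg₂⟩
    · obtain ⟨b, f₁, f₂, hf₁, hf₂⟩ := exists_bicat_split f S U h₁
      exact ⟨b, f₁, f₂ ≫ g, hf₁, (congrArg (· ++ _) hf₂).trans h₂.symm⟩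

variable (G) in
/-- The labelling of the 1-cells of the free bicategory by their edges. -/
noncomputable def edgeWords : Words (FreeBicategory G) (Σ x y : G, x ⟶ y) where
  list f := bicatEdges f
  list_comp f g := rfl
  list_id a := rfl
  can f g h := bicatCan f g h
  can_self f h := bicat_hom_ext _ _
  can_comp h h' := bicat_hom_ext _ _
  hcomp_can h h' h'' := bicat_hom_ext _ _
  associator_hom f g k h := bicat_hom_ext _ _
  leftUnitor_hom f h := bicat_hom_ext _ _
  rightUnitor_hom f h := bicat_hom_ext _ _
  exists_split f S T h := exists_bicat_split f S T h
  target_eq {a b b'} f g h := by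
    have e := endpoint_bicatEdges f
    rw [h] at e
    exact e.symm.trans (endpoint_bicatEdges g)
  splits {a b c f g} η g₁ g₂ h :=
    -- Source and target have the same edges, so identities on the given pieces split `η`; the
    -- equation holds by thinness.
    ⟨g₁, g₂, (bicatEdges_eq η).trans h.symm, 𝟙 _, 𝟙 _, bicat_hom_ext _ _⟩

variable (G) in
/-- The labelling of the words of the free lax functor by the edges of their symbols. -/
noncomputable def shapeWords : Words (FreeLax G) (List (Σ x y : G, x ⟶ y)) where
  list f := FreeLax.shape f
  list_comp f g := FreeLax.shape_comp f g
  list_id a := FreeLax.shape_id a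
  can f g h := FreeLax.can f g h
  can_self f h := FreeLax.can_self f h
  can_comp h h' := FreeLax.can_comp h h'
  hcomp_can h h' h'' := FreeLax.hcomp_can h h'
  associator_hom f g k h := FreeLax.associator_hom_eq_can f g k h
  leftUnitor_hom f h := FreeLax.leftUnitor_hom_eq_can f h
  rightUnitor_hom f h := FreeLax.rightUnitor_hom_eq_can f h
  exists_split f S T h := FreeLax.exists_split f S T h
  target_eq f g h := FreeLax.target_eq (FreeLax.edges_eq_of_shape h)
  splits η g₁ g₂ h := FreeLax.splits η g₁ g₂ h

/-- Every morphism of the free shadow category on a free bicategory is normal. -/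
theorem isNormal_freeSh {x y : ShObj (FreeBicategory G)}
    (φ : ((freeShadow (FreeBicategory G)).sh x.pt).obj x.cell ⟶
      ((freeShadow (FreeBicategory G)).sh y.pt).obj y.cell) :
    (edgeWords G).IsNormal (freeShadow (FreeBicategory G)) φ := by
  refine quotientPaths_induction (ShRel (B := FreeBicategory G))
    (fun x y φ => (edgeWords G).IsNormal (freeShadow (FreeBicategory G))
      (f := x.cell) (g := y.cell) φ) (fun a => ?_) ?_ x y φ
  · have := (edgeWords G).isNormal_sh (freeShadow (FreeBicategory G)) (𝟙 a.cell)
    rw [CategoryTheory.Functor.map_id] at this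
    exact this
  · rintro a b c φ g h
    change ShGen b c at g
    cases g with
    | sh η => exact h.sh η
    | rot f g => exact h.rot
    | rotInv f g => exact h.rotInv

namespace FreeLax

variable (G) in
/-- The shadow of the target of the free lax shadow functor. -/
abbrev innShadow : Shadow (FreeLax G) (FreeLaxSh G) :=
  laxShShadow (freeShadow (FreeBicategory G)) (functor G)

/-- The morphism `⟨f⟩ ⟶ H⟨V⟩` multiplying out all symbols of the word `f`. -/
def collapse {a : FreeLax G} (f : a ⟶ a) :
    LaxSh.ob (S := freeShadow (FreeBicategory G)) (F := functor G) (.inn f) ⟶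
      LaxSh.ob (.out (((freeShadow (FreeBicategory G)).sh a.pt).obj (content f))) :=
  ((innShadow G).sh a).map (fold f) ≫ (freeLaxShadowFunctor G).s (content f)

theorem sh_blockMap_s {a : FreeBicategory G} {V W : a ⟶ a} (e : V ⟶ W) :
    ((innShadow G).sh ⟨a⟩).map (blockMap e) ≫ (freeLaxShadowFunctor G).s W =
      (freeLaxShadowFunctor G).s V ≫
        (freeLaxShadowFunctor G).H.map (((freeShadow (FreeBicategory G)).sh a).map e) :=
  (freeLaxShadowFunctor G).s_naturality e

/-- A 2-cell inside the bracket is absorbed by multiplying out and reappears under `H`, by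
naturality of `fold` and of `s`. The next lemma does the same for rotators. -/
theorem sh_collapse {a : FreeLax G} {f g : a ⟶ a} (η : f ⟶ g) :
    ∃ ρ, ((innShadow G).sh a).map η ≫ collapse g =
      collapse f ≫ (freeLaxShadowFunctor G).H.map ρ := by
  obtain ⟨e, h⟩ := fold_natural η
  have h' := congrArg (((innShadow G).sh a).map) h
  rw [Functor.map_comp, Functor.map_comp] at h'
  refine ⟨((freeShadow (FreeBicategory G)).sh a.pt).map e, ?_⟩
  have k := congrArg (((innShadow G).sh a).map (fold f) ≫ ·) (sh_blockMap_s e)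
  exact (Category.assoc _ _ _).symm.trans ((congrArg (· ≫ _) h').trans
    ((Category.assoc _ _ _).trans (k.trans (Category.assoc _ _ _).symm)))

theorem rot_collapse {a b : FreeLax G} (f : a ⟶ b) (g : b ⟶ a) :
    ∃ ρ, ((innShadow G).rot f g).hom ≫ collapse (g ≫ f) =
      collapse (f ≫ g) ≫ (freeLaxShadowFunctor G).H.map ρ :=
  ⟨((freeShadow (FreeBicategory G)).rot (content f) (content g)).hom,
    ((freeLaxShadowFunctor G).rot_laxMul_s (fold f) (fold g)).trans
      (Category.assoc _ _ _).symm⟩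

theorem collapse_block {a : FreeBicategory G} (V : a ⟶ a) :
    collapse (block V) = (freeLaxShadowFunctor G).s V := by
  have : ((innShadow G).sh ⟨a⟩).map (𝟙 (block V)) = 𝟙 _ := CategoryTheory.Functor.map_id _ _
  exact (congrArg (· ≫ (freeLaxShadowFunctor G).s V) this).trans (Category.id_comp _)

/-- The normal forms of the morphisms of the free shadow category. -/
def NormalForm : (x y : LaxShObj (freeShadow (FreeBicategory G)) (functor G)) →
    (LaxSh.ob x ⟶ LaxSh.ob y) → Prop
  | .inn f, .inn g, φ => (shapeWords G).IsNormal (innShadow G) (f := f) (g := g) φ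
  | .inn f, .out y, φ => ∃ ρ : _ ⟶ y, φ = collapse f ≫ (freeLaxShadowFunctor G).H.map ρ
  | .out x, .out y, φ => ∃ ρ : x ⟶ y, φ = (freeLaxShadowFunctor G).H.map ρ
  | .out _, .inn _, _ => False

/-- Pastes three squares, one each for the 2-cell, the rotator and the canonical 2-cell of a normal
form. -/
theorem comp_chain {C : Type u₂} [Category.{v₂} C] {x₀ x₁ x₂ x₃ y₀ y₁ y₂ y₃ : C} {c : x₀ ⟶ x₁}
    {r : x₁ ⟶ x₂} {s : x₂ ⟶ x₃} {v : x₃ ⟶ y₃} {k₀ : x₀ ⟶ y₀} {k₁ : x₁ ⟶ y₁} {k₂ : x₂ ⟶ y₂}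
    {r₀ : y₀ ⟶ y₁} {r₁ : y₁ ⟶ y₂} {r₂ : y₂ ⟶ y₃} (h₂ : s ≫ v = k₂ ≫ r₂) (h₁ : r ≫ k₂ = k₁ ≫ r₁)
    (h₀ : c ≫ k₁ = k₀ ≫ r₀) : (c ≫ r ≫ s) ≫ v = k₀ ≫ r₀ ≫ r₁ ≫ r₂ := by
  rw [Category.assoc, Category.assoc, h₂, ← Category.assoc r, h₁, Category.assoc,
    ← Category.assoc c, h₀, Category.assoc]

/-- On a single symbol `s` is already a collapse. It is pulled back through the normal form to the
source word, leaving all residual morphisms under `H`. -/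
theorem normalForm_s {x : LaxShObj (freeShadow (FreeBicategory G)) (functor G)}
    {a : FreeBicategory G} (V : a ⟶ a) (φ : LaxSh.ob x ⟶ LaxSh.ob (.inn (block V)))
    (h : NormalForm x _ φ) : NormalForm x _ (φ ≫ (freeLaxShadowFunctor G).s V) := by
  cases x with
  | out x => exact False.elim h
  | inn f =>
    obtain ⟨f₁, f₂, e, η, -, rfl⟩ := h
    obtain ⟨ρ₁, h₁⟩ := sh_collapse η
    obtain ⟨ρ₂, h₂⟩ := rot_collapse f₁ f₂
    obtain ⟨ρ₃, h₃⟩ := sh_collapse ((shapeWords G).can f _ e)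
    rw [collapse_block] at h₁
    refine ⟨ρ₃ ≫ ρ₂ ≫ ρ₁, (comp_chain h₁ h₂ h₃).trans (congrArg (_ ≫ ·) ?_)⟩
    exact ((freeLaxShadowFunctor G).H.map_comp _ _).trans
      (congrArg (_ ≫ ·) ((freeLaxShadowFunctor G).H.map_comp _ _)) |>.symm

/-- It is enough that normal forms contain identities and are stable under composing with a
generator on the right. No generator leads from the image of `H` into a bracket, so that case stays
empty. -/
theorem normalForm (x y : LaxShObj (freeShadow (FreeBicategory G)) (functor G))
    (φ : LaxSh.ob x ⟶ LaxSh.ob y) : NormalForm x y φ := by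
  refine quotientPaths_induction (LaxShRel (freeShadow (FreeBicategory G)) (functor G))
    (fun x y φ => NormalForm x y φ) (fun a => ?_) ?_ x y φ
  · cases a with
    | out x => exact ⟨𝟙 x, ((freeLaxShadowFunctor G).H.map_id x).symm⟩
    | inn f =>
      have := (shapeWords G).isNormal_sh (innShadow G) (𝟙 f)
      rw [CategoryTheory.Functor.map_id] at this
      exact this
  · rintro a b c φ g h
    change LaxShGen _ _ b c at g
    cases g with
    | hmap ψ =>
      cases a with
      | out x =>
        obtain ⟨ρ, rfl⟩ := h
        exact ⟨ρ ≫ ψ, ((freeLaxShadowFunctor G).H.map_comp ρ ψ).symm⟩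
      | inn f =>
        obtain ⟨ρ, rfl⟩ := h
        exact ⟨ρ ≫ ψ, (Category.assoc _ _ _).trans
          (congrArg (_ ≫ ·) ((freeLaxShadowFunctor G).H.map_comp ρ ψ).symm)⟩
    | sh η =>
      cases a with
      | out x => exact h
      | inn f =>
        exact Words.IsNormal.sh (W := shapeWords G) (T := innShadow G) (φ := φ) h η
    | rot f g =>
      cases a with
      | out x => exact h
      | inn f =>
        exact Words.IsNormal.rot (W := shapeWords G) (T := innShadow G) (φ := φ) h
    | rotInv f g =>
      cases a with
      | out x => exact h
      | inn f =>
        exact Words.IsNormal.rotInv (W := shapeWords G) (T := innShadow G) (φ := φ) h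
    | s V => exact normalForm_s V φ h

end FreeLax

end

/-! ### Supporting maps and underlying permutations are jointly faithful -/

namespace Words

variable {B : Type u₁} [Bicategory.{w₁, v₁} B] {X : Type u₂} (W : Words B X)
variable {C : Type u₃} [Category.{v₃} C] (T : Shadow B C)

/-- Two normal forms with the same rotation differ by a canonical 2-cell. -/
theorem normal_congr {a b : B} {f : a ⟶ a} {f₁ f₁' : a ⟶ b} {f₂ f₂' : b ⟶ a}
    (h : W.list f = W.list (f₁ ≫ f₂)) (h' : W.list f = W.list (f₁' ≫ f₂'))
    (e : (W.list f₁).length = (W.list f₁').length) :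
    ∃ k : W.list (f₂ ≫ f₁) = W.list (f₂' ≫ f₁'), ∀ {g : b ⟶ b} (η : f₂' ≫ f₁' ⟶ g),
      W.shCan T f _ h' ≫ (T.rot f₁' f₂').hom ≫ (T.sh b).map η =
        W.shCan T f _ h ≫ (T.rot f₁ f₂).hom ≫ (T.sh b).map (W.can _ _ k ≫ η) := by
  obtain ⟨e₁, e₂⟩ : W.list f₁ = W.list f₁' ∧ W.list f₂ = W.list f₂' := by
    have := h.symm.trans h'
    rw [W.list_comp, W.list_comp] at this
    exact List.append_inj this e
  have k : W.list (f₂ ≫ f₁) = W.list (f₂' ≫ f₁') := by rw [W.list_comp, W.list_comp, e₁, e₂]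
  refine ⟨k, fun {g} η => ?_⟩
  rw [W.rot_eq T e₁ e₂ (h.symm.trans h') k.symm, Functor.map_comp]
  change _ = _ ≫ _ ≫ W.shCan T _ _ k ≫ _
  simp only [Category.assoc, shCan_comp_assoc, shCan_self, Category.id_comp]

end Words

section

variable {G : Type u₁} [Quiver.{v₁} G]

theorem shadowPermutation_gen {x y : ShObj (FreeBicategory G)} (g : ShGen x y) :
    (shadowPermutation G).map (FreeSh.gen g) = shadowPermutationMap g :=
  lift_w (V := ShObj (FreeBicategory G)) (C := FinBij)
    { obj := fun x => ⟨bicatNum x.cell⟩, map := shadowPermutationMap } g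

/-- The 2-cells on both sides preserve positions, so only the rotator moves edges. -/
theorem shadowPermutation_normal {x y : ShObj (FreeBicategory G)} (V₁ : x.pt ⟶ y.pt)
    (V₂ : y.pt ⟶ x.pt)
    (h : (edgeWords G).list x.cell = (edgeWords G).list (V₁ ≫ V₂)) (η : V₂ ≫ V₁ ⟶ y.cell)
    (i : Fin (bicatNum x.cell)) :
    (((shadowPermutation G).map ((edgeWords G).shCan (freeShadow (FreeBicategory G)) x.cell _ h ≫
      ((freeShadow (FreeBicategory G)).rot V₁ V₂).hom ≫
        ((freeShadow (FreeBicategory G)).sh y.pt).map η)).toFun i).val =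
      if i.val < bicatNum V₁ then bicatNum V₂ + i.val else i.val - bicatNum V₁ := by
  have e : (shadowPermutation G).map ((edgeWords G).shCan (freeShadow (FreeBicategory G)) x.cell _ h ≫
      ((freeShadow (FreeBicategory G)).rot V₁ V₂).hom ≫
        ((freeShadow (FreeBicategory G)).sh y.pt).map η) =
      FinBij.ofEq (bicatNum_eq (bicatCan x.cell _ h)) ≫ FinBij.flip (bicatNum V₁) (bicatNum V₂) ≫
        FinBij.ofEq (bicatNum_eq η) :=
    ((shadowPermutation G).map_comp _ _).trans (congrArg₂ (· ≫ ·)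
      (shadowPermutation_gen (.sh (bicatCan x.cell (V₁ ≫ V₂) h)))
      (((shadowPermutation G).map_comp _ _).trans (congrArg₂ (· ≫ ·)
        (shadowPermutation_gen (.rot V₁ V₂)) (shadowPermutation_gen (.sh η)))))
  rw [e]
  exact FinBij.flip_val _ _ _

/-- The permutation reveals how many edges the rotator moves. Normal forms with the same rotation
differ at most in their 2-cell, and that is unique. -/
theorem shadowPermutation_faithful {x y : FreeSh (FreeBicategory G)} (φ ψ : x ⟶ y)
    (h : (shadowPermutation G).map φ = (shadowPermutation G).map ψ) : φ = ψ := by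
  have key : ∀ (x y : ShObj (FreeBicategory G)) (φ ψ :
      ((freeShadow (FreeBicategory G)).sh x.pt).obj x.cell ⟶
        ((freeShadow (FreeBicategory G)).sh y.pt).obj y.cell)
      (_ : (shadowPermutation G).map φ = (shadowPermutation G).map ψ), φ = ψ := by
    intro x y φ ψ h
    obtain ⟨V₁, V₂, e, η, hlt, rfl⟩ := isNormal_freeSh φ
    obtain ⟨V₁', V₂', e', η', hlt', rfl⟩ := isNormal_freeSh ψ
    have p := fun i => (shadowPermutation_normal V₁ V₂ e η i).symm.trans
      ((congrArg (fun (u : (shadowPermutation G).obj (FreeSh.ob x.cell) ⟶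
        (shadowPermutation G).obj (FreeSh.ob y.cell)) => (u.toFun i).val) h).trans
        (shadowPermutation_normal V₁' V₂' e' η' i))
    have n₁ : bicatNum x.cell = bicatNum V₁ + bicatNum V₂ :=
      (length_bicatEdges _).symm.trans ((congrArg _ e).trans (length_bicatEdges (V₁ ≫ V₂)))
    have n₂ : bicatNum x.cell = bicatNum V₁' + bicatNum V₂' :=
      (length_bicatEdges _).symm.trans ((congrArg _ e').trans (length_bicatEdges (V₁' ≫ V₂')))
    have l₁ : bicatNum V₁ < bicatNum x.cell ∨ bicatNum x.cell = 0 := by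
      rw [← length_bicatEdges, ← length_bicatEdges]
      exact hlt.imp id fun h => congrArg List.length h
    have l₂ : bicatNum V₁' < bicatNum x.cell ∨ bicatNum x.cell = 0 := by
      rw [← length_bicatEdges, ← length_bicatEdges]
      exact hlt'.imp id fun h => congrArg List.length h
    -- The image of the first edge is `0` without a rotation and the length of the unmoved part
    -- otherwise; that part is nonempty by the bound in the normal form.
    have k : bicatNum V₁ = bicatNum V₁' := by
      rcases Nat.eq_zero_or_pos (bicatNum x.cell) with h0 | h0
      · omega
      · have := p ⟨0, h0⟩
        simp only at this
        split_ifs at this <;> omega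
    obtain ⟨l, hl⟩ := (edgeWords G).normal_congr (freeShadow (FreeBicategory G)) e e'
      ((length_bicatEdges _).trans (k.trans (length_bicatEdges _).symm))
    refine Eq.trans ?_ (hl η').symm
    rw [bicat_hom_ext η (((edgeWords G).can _ _ l) ≫ η')]
  exact key x.as y.as φ ψ h

namespace FreeLax

theorem support_gen {x y : LaxShObj (freeShadow (FreeBicategory G)) (functor G)}
    (g : LaxShGen _ _ x y) : (support G).map (LaxSh.gen g) = supportMap g :=
  lift_w (V := LaxShObj (freeShadow (FreeBicategory G)) (functor G)) (C := Lam)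
    { obj := supportObj, map := supportMap } g

theorem permutation_gen {x y : LaxShObj (freeShadow (FreeBicategory G)) (functor G)}
    (g : LaxShGen _ _ x y) : (permutation G).map (LaxSh.gen g) = permutationMap g :=
  lift_w (V := LaxShObj (freeShadow (FreeBicategory G)) (functor G)) (C := FinBij)
    { obj := permutationObj, map := permutationMap } g

theorem eqToHom_cycleFlip {n k l m : ℕ} (e : n = k + l) (h : Lam.fin n = Lam.fin (k + l))
    (h' : Lam.fin n = Lam.fin (l + k)) (v : Lam.fin (l + k) ⟶ Lam.fin m) :
    eqToHom h ≫ cycleFlip k l ≫ v = Lam.rot n k ≫ eqToHom h' ≫ v := by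
  subst e
  simp [cycleFlip]

/-- Brings the support into the shape required by `Lam.rot_comp_injective`: the canonical 2-cell is
invisible, the rotator becomes a power of the cycle, and the 2-cell contributes a map without
winding. -/
theorem support_normal {a b : FreeLax G} {f : a ⟶ a} {g : b ⟶ b} (f₁ : a ⟶ b) (f₂ : b ⟶ a)
    (h : shape f = shape (f₁ ≫ f₂)) (η : f₂ ≫ f₁ ⟶ g) :
    ∃ u : Lam.fin (blocks f) ⟶ Lam.fin (blocks g),
      (support G).map ((shapeWords G).shCan (innShadow G) f _ h ≫
        ((innShadow G).rot f₁ f₂).hom ≫ ((innShadow G).sh b).map η) =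
          Lam.rot (blocks f) (blocks f₁) ≫ u ∧
      ∀ p, HasPos η p → Lam.Acts u p (fun _ => 0) := by
  have e : (support G).map ((shapeWords G).shCan (innShadow G) f _ h ≫
      ((innShadow G).rot f₁ f₂).hom ≫ ((innShadow G).sh b).map η) =
      onBlocks (can f _ h) ≫ cycleFlip (blocks f₁) (blocks f₂) ≫ onBlocks η :=
    ((support G).map_comp _ _).trans (congrArg₂ (· ≫ ·) (support_gen (.sh (can f _ h)))
      (((support G).map_comp _ _).trans (congrArg₂ (· ≫ ·)
        (support_gen (.rot f₁ f₂)) (support_gen (.sh η)))))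
  obtain ⟨e', hc⟩ := (isTrivial_can h).onBlocks_eq
  have n : blocks f = blocks (f₁ ≫ f₂) := by rw [← length_shape, h, length_shape]
  have n' : blocks f = blocks (f₂ ≫ f₁) := n.trans (Nat.add_comm (blocks f₁) (blocks f₂))
  refine ⟨eqToHom (congrArg Lam.fin n') ≫ onBlocks η, e.trans ?_, fun p hp => ?_⟩
  · rw [hc]
    exact eqToHom_cycleFlip n e' _ _
  · exact ((Lam.acts_eqToHom n' _).comp hp.acts).congr 0 (fun a _ => ⟨rfl, rfl⟩)

/-- Between bracketed words the support alone suffices. It determines the rotation and the positions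
of symbols, and these determine the normal form. -/
theorem hom_ext_inn {a b : FreeLax G} {f : a ⟶ a} {g : b ⟶ b}
    (φ ψ : ((innShadow G).sh a).obj f ⟶ ((innShadow G).sh b).obj g)
    (h : (support G).map φ = (support G).map ψ) : φ = ψ := by
  have hφ : (shapeWords G).IsNormal (innShadow G) φ := normalForm (.inn f) (.inn g) φ
  have hψ : (shapeWords G).IsNormal (innShadow G) ψ := normalForm (.inn f) (.inn g) ψ
  obtain ⟨f₁, f₂, e, η, hlt, rfl⟩ := hφ
  obtain ⟨f₁', f₂', e', η', hlt', rfl⟩ := hψ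
  obtain ⟨u, hu, hu'⟩ := support_normal f₁ f₂ e η
  obtain ⟨v, hv, hv'⟩ := support_normal f₁' f₂' e' η'
  obtain ⟨p, hp, -⟩ := exists_hasPos η
  obtain ⟨q, hq, -⟩ := exists_hasPos η'
  have hrot := hu.symm.trans (h.trans hv)
  have n₁ : blocks f = blocks f₁ + blocks f₂ :=
    (length_shape _).symm.trans ((congrArg _ e).trans (length_shape (f₁ ≫ f₂)))
  have n₂ : blocks f = blocks f₁' + blocks f₂' :=
    (length_shape _).symm.trans ((congrArg _ e').trans (length_shape (f₁' ≫ f₂')))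
  have l₁ : blocks f₁ < blocks f ∨ blocks f = 0 := by
    rw [← length_shape, ← length_shape]
    exact hlt.imp id fun h => congrArg List.length h
  have l₂ : blocks f₁' < blocks f ∨ blocks f = 0 := by
    rw [← length_shape, ← length_shape]
    exact hlt'.imp id fun h => congrArg List.length h
  obtain ⟨k, hpq⟩ : blocks f₁ = blocks f₁' ∧ ∀ i, i < blocks f → p i = q i := by
    -- Without symbols in the source there is no rotation and no position to compare.
    rcases Nat.eq_zero_or_pos (blocks f) with h0 | h0
    · exact ⟨by omega, fun i hi => by omega⟩
    · exact Lam.rot_comp_injective (hu' p hp) (hv' q hq) (by omega) (by omega) hrot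
  obtain ⟨l, hl⟩ := (shapeWords G).normal_congr (innShadow G) e e'
    ((length_shape _).trans (k.trans (length_shape _).symm))
  refine Eq.trans ?_ (hl η').symm
  have : η = can _ _ l ≫ η' := by
    refine hom_ext_of_hasPos _ rfl (hp.congr fun i hi => ?_)
      ((isTrivial_can l).hasPos.comp hq)
    exact hpq i (by rw [blocks_comp] at hi; omega)
  rw [this]
  rfl

/-- Into the image of `H` the support carries no information, but there the normal form is a fixed
collapse followed by a morphism under `H`, which its permutation determines. -/
theorem hom_ext_support_permutation {x y : FreeLaxSh G} (φ ψ : x ⟶ y)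
    (h : (support G).map φ = (support G).map ψ)
    (h' : (permutation G).map φ = (permutation G).map ψ) : φ = ψ := by
  have key : ∀ (x y : LaxShObj (freeShadow (FreeBicategory G)) (functor G))
      (φ ψ : LaxSh.ob x ⟶ LaxSh.ob y), (support G).map φ = (support G).map ψ →
      (permutation G).map φ = (permutation G).map ψ → φ = ψ := by
    intro x y φ ψ h h'
    have hφ := normalForm x y φ
    have hψ := normalForm x y ψ
    have H {x y : FreeSh (FreeBicategory G)} (ρ : x ⟶ y) : (permutation G).map
        ((freeLaxShadowFunctor G).H.map ρ) = (shadowPermutation G).map ρ :=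
      permutation_gen (.hmap ρ)
    cases x with
    | out x =>
      cases y with
      | inn g => exact False.elim hφ
      | out y =>
        obtain ⟨ρ, rfl⟩ := hφ
        obtain ⟨ρ', rfl⟩ := hψ
        rw [shadowPermutation_faithful ρ ρ' ((H ρ).symm.trans (h'.trans (H ρ')))]
    | inn f =>
      cases y with
      | inn g => exact hom_ext_inn φ ψ h
      | out y =>
        obtain ⟨ρ, rfl⟩ := hφ
        obtain ⟨ρ', rfl⟩ := hψ
        have e : ∀ ρ : _ ⟶ y, (permutation G).map (collapse f ≫ (freeLaxShadowFunctor G).H.map ρ) =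
            FinBij.ofEq (num_eq (fold f)) ≫ 𝟙 _ ≫ (shadowPermutation G).map ρ := fun ρ =>
          ((permutation G).map_comp _ _).trans ((congrArg₂ (· ≫ ·)
            (((permutation G).map_comp _ _).trans (congrArg₂ (· ≫ ·)
              (permutation_gen (.sh (fold f))) (permutation_gen (.s (content f))))) (H ρ)).trans
                (Category.assoc _ _ _))
        have k := (e ρ).symm.trans (h'.trans (e ρ'))
        -- The collapse acts on edges by an identification of positions; it is cancelled to isolate
        -- the permutation of `ρ`.
        have k' := congrArg (FinBij.ofEq (num_eq (fold f)).symm ≫ ·) k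
        rw [shadowPermutation_faithful ρ ρ' k']
  exact key x.as y.as φ ψ h h'

end FreeLax

/-! ### From joint faithfulness to commuting diagrams -/

theorem lift_comp_map {J : Type u₅} [Quiver.{v₅} J] {A : Type u₁} [Category.{v₁} A]
    {C : Type u₂} [Category.{v₂} C] (K : J ⥤q A) (P : A ⥤ C) {a b : Paths J} (p : a ⟶ b) :
    (Paths.lift (K ⋙q P.toPrefunctor)).map p = P.map ((Paths.lift K).map p) := by
  change Quiver.Path (V := J) a b at p
  induction p with
  | nil => exact (P.map_id _).symm
  | cons p e ih => exact (congrArg (· ≫ P.map (K.map e)) ih).trans (P.map_comp _ _).symm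

/-- Two parallel composites of the lift agree after both functors, hence already in the source
category, and any functor `E` preserves the equality. -/
theorem commutes_of_faithful {J : Type u₅} [Quiver.{v₅} J] {A : Type u₁} [Category.{v₁} A]
    {C : Type u₂} [Category.{v₂} C] {C' : Type u₃} [Category.{v₃} C'] {D : Type u₄}
    [Category.{v₄} D] (K : J ⥤q A) (P : A ⥤ C) (P' : A ⥤ C') (E : A ⥤ D)
    (hf : ∀ {x y : A} (φ ψ : x ⟶ y), P.map φ = P.map ψ → P'.map φ = P'.map ψ → φ = ψ)
    (h : Commutes (K ⋙q P.toPrefunctor)) (h' : Commutes (K ⋙q P'.toPrefunctor)) :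
    Commutes (K ⋙q E.toPrefunctor) := by
  intro a b p q
  refine (lift_comp_map K E p).trans (Eq.trans ?_ (lift_comp_map K E q).symm)
  exact congrArg E.map (hf _ _
    ((lift_comp_map K P p).symm.trans ((h a b p q).trans (lift_comp_map K P q)))
    ((lift_comp_map K P' p).symm.trans ((h' a b p q).trans (lift_comp_map K P' q))))

end

section

variable {C : Type u₁} [Bicategory.{w₁, v₁} C] {C' : Type u₂} [Category.{v₂} C'] {S : Shadow C C'}
  {D : Type u₃} [Bicategory.{w₂, v₃} D] {D' : Type u₄} [Category.{v₄} D'] {T : Shadow D D'}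
  {J : Type u₅} [Quiver.{v₅} J] {X : J ⥤q D'}

theorem LaxShadowFunctor.IsBlackTie.commutes {Φ : LaxShadowFunctor S T} (h : Φ.IsBlackTie X) :
    Commutes X := by
  obtain ⟨K, rfl, h₁, h₂⟩ := h
  exact commutes_of_faithful K (support C) (permutation C) Φ.eval
    (fun φ ψ => FreeLax.hom_ext_support_permutation φ ψ) h₁ h₂

theorem OplaxShadowFunctor.IsBlackTie.commutes {Φ : OplaxShadowFunctor S T} (h : Φ.IsBlackTie X) :
    Commutes X := by
  obtain ⟨K, rfl, h₁, h₂⟩ := h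
  exact commutes_of_faithful K (support (Co C)).op (permutation (Co C)).op Φ.eval
    (fun φ ψ h h' => Quiver.Hom.unop_inj (FreeLax.hom_ext_support_permutation φ.unop ψ.unop
      (Quiver.Hom.op_inj h) (Quiver.Hom.op_inj h'))) h₁ h₂

end

/-! ### Lifting maps of `Λ'` to the free lax shadow category -/

theorem Lam.eqToHom_d {n N M i i' : ℕ} (e : n = N) (h : Lam.fin n = Lam.fin N) (hM : M = N + 1)
    (h₁ : 1 ≤ i) (h₂ : i ≤ N + 1) (hi : i = i') :
    eqToHom h ≫ Lam.d N M i hM h₁ h₂ = Lam.d n M i' (by omega) (by omega) (by omega) := by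
  subst e hi
  simp

theorem Lam.eqToHom_s {n N M i i' : ℕ} (e : n = N) (h : Lam.fin n = Lam.fin N) (hN : N = M + 1)
    (h₁ : 1 ≤ i) (h₂ : i ≤ M) (hi : i = i') :
    eqToHom h ≫ Lam.s N M i hN h₁ h₂ = Lam.s n M i' (by omega) (by omega) (by omega) := by
  subst e hi
  simp

section

variable {G : Type u₁} [Quiver.{v₁} G]

namespace FreeLax

theorem onBlocks_comp {a b : FreeLax G} {f g k : a ⟶ b} (η : f ⟶ g) (θ : g ⟶ k) :
    onBlocks (η ≫ θ) = onBlocks η ≫ onBlocks θ := by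
  induction η using Quot.ind with
  | mk η =>
    induction θ using Quot.ind with
    | mk θ => exact DExpr.real_comp η.onBlocks θ.onBlocks 0 0 _ _ _ _ _ _

/-- A word can be split after any number of symbols. -/
theorem exists_split_blocks {a c : FreeLax G} (f : a ⟶ c) (k : ℕ) (h : k ≤ blocks f) :
    ∃ (b : FreeLax G) (f₁ : a ⟶ b) (f₂ : b ⟶ c), shape f = shape (f₁ ≫ f₂) ∧
      blocks f₁ = k ∧ blocks f₁ + blocks f₂ = blocks f := by
  obtain ⟨b, f₁, f₂, h₁, h₂⟩ := exists_split f _ _ (List.take_append_drop k (shape f)).symm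
  refine ⟨b, f₁, f₂, ?_, ?_, ?_⟩
  · rw [shape_comp, h₁, h₂, List.take_append_drop]
  · rw [← length_shape, h₁, List.length_take, length_shape]; omega
  · rw [← length_shape, ← length_shape, ← length_shape, h₁, h₂, ← List.length_append,
      List.take_append_drop]

/-- A word with one symbol may still contain formal units. This allows a canonical 2-cell to replace
it by an actual symbol, as the multiplication and `s` require. -/
theorem shape_eq_block {a b : FreeLax G} (f : a ⟶ b) (h : blocks f = 1) :
    shape f = shape (block (content f)) := by
  rw [← length_shape] at h
  obtain ⟨s, hs⟩ := List.length_eq_one_iff.mp h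
  rw [shape_block, edges_content, ← flatten_shape, hs]
  simp

/-- The 2-cell inserting a unit. -/
def insertUnit {a b c : FreeLax G} (f : a ⟶ b) (g : b ⟶ c) :
    f ≫ g ⟶ f ≫ (block (𝟙 b.pt) ≫ g) :=
  (Hom₂.whiskerLeft f ((Hom₂.leftUnitorInv g).vcomp (Hom₂.whiskerRight (Hom₂.unit b.pt) g))).mk

/-- The 2-cell multiplying two adjacent symbols. -/
def multiply {a d : FreeLax G} {b b' c : FreeBicategory G} (f : a ⟶ ⟨b⟩) (V : b ⟶ b') (V' : b' ⟶ c)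
    (g : (⟨c⟩ : FreeLax G) ⟶ d) :
    f ≫ ((block V ≫ block V') ≫ g) ⟶ f ≫ (block (V ≫ V') ≫ g) :=
  (Hom₂.whiskerLeft f (Hom₂.whiskerRight (Hom₂.mul V V') g)).mk

theorem onBlocks_insertUnit {a b c : FreeLax G} (f : a ⟶ b) (g : b ⟶ c) (i : ℕ)
    (h₁ : 1 ≤ i) (h₂ : i ≤ blocks (f ≫ g) + 1) (hi : blocks f + 1 = i) :
    onBlocks (insertUnit f g) = Lam.d (blocks (f ≫ g)) (blocks (f ≫ (block (𝟙 b.pt) ≫ g))) i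
      (by simp only [blocks_comp, blocks_block]; omega) h₁ h₂ :=
  Lam.eqToHom_d (N := 0 + blocks f + (0 + blocks g) + 0) (i := 0 + blocks f + 1)
    (by rw [blocks_comp]; omega) _ (by simp only [blocks_comp, blocks_block]; omega) (by omega)
    (by omega) (by omega)

theorem onBlocks_multiply {a d : FreeLax G} {b b' c : FreeBicategory G} (f : a ⟶ ⟨b⟩) (V : b ⟶ b')
    (V' : b' ⟶ c) (g : (⟨c⟩ : FreeLax G) ⟶ d) (i : ℕ) (h₁ : 1 ≤ i)
    (h₂ : i ≤ blocks (f ≫ (block (V ≫ V') ≫ g))) (hi : blocks f + 1 = i) :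
    onBlocks (multiply f V V' g) = Lam.s (blocks (f ≫ ((block V ≫ block V') ≫ g)))
      (blocks (f ≫ (block (V ≫ V') ≫ g))) i
      (by simp only [blocks_comp, blocks_block]; omega) h₁ h₂ := by
  subst hi
  refine (Category.id_comp _).symm.trans ((congrArg (· ≫ _) (eqToHom_refl _ rfl).symm).trans ?_)
  exact Lam.eqToHom_s (i := 0 + blocks f + 1) rfl rfl
    (by simp only [blocks_comp, blocks_block]; omega) (by omega)
    (by simp only [blocks_comp, blocks_block]; omega) (by omega)

/-- The coface `d^i` is a unit inserted after the first `i - 1` symbols. -/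
theorem exists_onBlocks_d {a c : FreeLax G} (f : a ⟶ c) (i : ℕ) (h₁ : 1 ≤ i)
    (h₂ : i ≤ blocks f + 1) :
    ∃ (g : a ⟶ c) (η : f ⟶ g) (e : blocks g = blocks f + 1),
      onBlocks η = Lam.d (blocks f) (blocks g) i e h₁ h₂ := by
  obtain ⟨b, f₁, f₂, h, hk, hb⟩ := exists_split_blocks f (i - 1) (by omega)
  obtain ⟨e, he⟩ := (isTrivial_can h).onBlocks_eq
  refine ⟨_, can _ _ h ≫ insertUnit f₁ f₂, ?_, ?_⟩
  · rw [blocks_comp, blocks_comp, blocks_block]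
    omega
  · rw [onBlocks_comp, he]
    have e' : blocks f = blocks (f₁ ≫ f₂) := by rw [blocks_comp]; omega
    refine (congrArg (eqToHom e ≫ ·) (onBlocks_insertUnit f₁ f₂ i h₁ (by omega) (by omega))).trans ?_
    exact Lam.eqToHom_d e' _ _ _ _ rfl

/-- The codegeneracy `s^i` multiplies symbols `i` and `i + 1`. The word is cut into `i - 1` symbols,
these two, and the rest. -/
theorem exists_onBlocks_s {a c : FreeLax G} (f : a ⟶ c) (M i : ℕ) (hM : blocks f = M + 1)
    (h₁ : 1 ≤ i) (h₂ : i ≤ M) :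
    ∃ (g : a ⟶ c) (η : f ⟶ g) (e : blocks g = M),
      onBlocks η = Lam.s (blocks f) (blocks g) i (by omega) h₁ (by omega) := by
  obtain ⟨b, f₁, f₂, h, hk, hb⟩ := exists_split_blocks f (i - 1) (by omega)
  obtain ⟨b', g₁, f₃, h', hk', hb'⟩ := exists_split_blocks f₂ 1 (by omega)
  obtain ⟨b'', g₂, f₄, h'', hk'', hb''⟩ := exists_split_blocks f₃ 1 (by omega)
  have H : shape f = shape (f₁ ≫ ((block (content g₁) ≫ block (content g₂)) ≫ f₄)) := by
    rw [h, shape_comp, h', shape_comp, h'', shape_comp, shape_eq_block g₁ hk',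
      shape_eq_block g₂ hk'']
    simp
  obtain ⟨e, he⟩ := (isTrivial_can H).onBlocks_eq
  refine ⟨_, can _ _ H ≫ multiply f₁ (content g₁) (content g₂) f₄, ?_, ?_⟩
  · simp only [blocks_comp, blocks_block]
    omega
  · rw [onBlocks_comp, he]
    have e' : blocks f = blocks (f₁ ≫ ((block (content g₁) ≫ block (content g₂)) ≫ f₄)) := by
      simp only [blocks_comp, blocks_block]; omega
    refine (congrArg (eqToHom e ≫ ·) (onBlocks_multiply f₁ (content g₁) (content g₂) f₄ i h₁
      (by simp only [blocks_comp, blocks_block]; omega) (by omega))).trans ?_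
    exact Lam.eqToHom_s e' _ _ _ _ rfl

/-- The supporting map of a morphism, between the supports of objects. -/
def supp {x y : LaxShObj (freeShadow (FreeBicategory G)) (functor G)}
    (φ : LaxSh.ob x ⟶ LaxSh.ob y) : supportObj x ⟶ supportObj y := (support G).map φ

theorem supp_comp {x y z : LaxShObj (freeShadow (FreeBicategory G)) (functor G)}
    (φ : LaxSh.ob x ⟶ LaxSh.ob y) (ψ : LaxSh.ob y ⟶ LaxSh.ob z) :
    supp (φ ≫ ψ) = supp φ ≫ supp ψ := (support G).map_comp φ ψ

theorem supp_id (x : LaxShObj (freeShadow (FreeBicategory G)) (functor G)) :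
    supp (𝟙 (LaxSh.ob x)) = 𝟙 _ := (support G).map_id _

theorem supp_gen {x y : LaxShObj (freeShadow (FreeBicategory G)) (functor G)}
    (g : LaxShGen _ _ x y) : supp (LaxSh.gen g) = supportMap g := support_gen g

end FreeLax

/-- The object of `Λ'` given by an object of the generating graph. -/
abbrev Lam.ofObj (x : LObj) : Lam := (Quotient.functor LRel).obj ((Paths.of LObj).obj x)

theorem Lam.ofObj_injective {x y : LObj} (h : Lam.ofObj x = Lam.ofObj y) : x = y :=
  congrArg (fun z : Lam => (show LObj from z.as)) h

namespace FreeLax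

/-- Cofaces and codegeneracies lift to 2-cells, the cycle lifts to the rotator moving the first
symbol to the end, and `t` lifts to `s` once the word is identified with a single symbol. No
generator starts at `*`. -/
theorem exists_lift_gen {b c : LObj} (g : LGen b c)
    (y : LaxShObj (freeShadow (FreeBicategory G)) (functor G)) (e : supportObj y = Lam.ofObj b) :
    ∃ (z : LaxShObj (freeShadow (FreeBicategory G)) (functor G)) (φ : LaxSh.ob y ⟶ LaxSh.ob z)
      (e' : supportObj z = Lam.ofObj c), supp φ ≫ eqToHom e' = eqToHom e ≫ Lam.gen g := by
  cases y with
  | out x =>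
    have : LObj.star = b := Lam.ofObj_injective e
    subst this
    cases g
  | inn f =>
    have hb : LObj.fin (blocks f) = b := Lam.ofObj_injective e
    cases g with
    | d n i h₁ h₂ =>
      cases hb
      obtain ⟨g, η, e₁, h⟩ := exists_onBlocks_d f i h₁ h₂
      refine ⟨.inn g, LaxSh.gen (.sh η), congrArg Lam.fin e₁, ?_⟩
      rw [supp_gen]
      refine (congrArg (· ≫ eqToHom _) h).trans ?_
      refine (Category.assoc _ _ _).trans ?_
      exact (congrArg (Lam.gen (LGen.d (blocks f) i h₁ h₂) ≫ ·) (eqToHom_trans _ _)).trans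
        ((Category.comp_id _).trans (Category.id_comp _).symm)
    | s n i h₁ h₂ =>
      have hb : blocks f = n + 1 := congrArg (fun z : LObj => match z with | .fin k => k | .star => 0) hb
      obtain ⟨g, η, e₁, h⟩ := exists_onBlocks_s f n i hb h₁ h₂
      subst e₁
      refine ⟨.inn g, LaxSh.gen (.sh η), rfl, ?_⟩
      rw [supp_gen]
      exact (congrArg (· ≫ 𝟙 _) h).trans (Category.comp_id _)
    | τ n hn =>
      cases hb
      obtain ⟨b, f₁, f₂, h, hk, hb⟩ := exists_split_blocks f 1 hn
      obtain ⟨e₁, he⟩ := (isTrivial_can h).onBlocks_eq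
      refine ⟨.inn (f₂ ≫ f₁), LaxSh.gen (.sh (can _ _ h)) ≫ LaxSh.gen (.rot f₁ f₂),
        congrArg Lam.fin ((Nat.add_comm _ _).trans hb), ?_⟩
      rw [supp_comp, supp_gen, supp_gen]
      refine (congrArg (fun u => (u ≫ cycleFlip (blocks f₁) (blocks f₂)) ≫ eqToHom _) he).trans ?_
      refine (Category.assoc _ _ _).trans ?_
      refine (eqToHom_cycleFlip hb.symm e₁ (congrArg Lam.fin (hb.symm.trans (Nat.add_comm _ _))) _).trans ?_
      refine (congrArg (Lam.rot (blocks f) (blocks f₁) ≫ ·) (eqToHom_trans _ _)).trans ?_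
      refine (Category.comp_id _).trans (Eq.trans ?_ (Category.id_comp _).symm)
      rw [hk]
      simp only [Lam.rot, Category.comp_id, Lam.cyc, dif_pos hn]
    | t =>
      have hb : blocks f = 1 := congrArg (fun z : LObj => match z with | .fin k => k | .star => 0) hb
      have h := shape_eq_block f hb
      obtain ⟨e₁, he⟩ := (isTrivial_can h).onBlocks_eq
      refine ⟨_, LaxSh.gen (.sh (can _ _ h)) ≫ LaxSh.gen (.s (content f)), rfl, ?_⟩
      refine (Category.comp_id _).trans ((supp_comp _ _).trans ?_)
      exact (congrArg (· ≫ supp _) ((supp_gen (.sh (can _ _ h))).trans he)).trans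
        (congrArg (eqToHom e₁ ≫ ·) (supp_gen (.s (content f))))

theorem exists_lift (y : LaxShObj (freeShadow (FreeBicategory G)) (functor G)) (w : Lam)
    (v : supportObj y ⟶ w) :
    ∃ (z : LaxShObj (freeShadow (FreeBicategory G)) (functor G)) (φ : LaxSh.ob y ⟶ LaxSh.ob z)
      (e : supportObj z = w), supp φ ≫ eqToHom e = v := by
  have key := quotientPaths_induction LRel (fun a b v => ∀ e : supportObj y = Lam.ofObj a,
    ∃ (z : LaxShObj (freeShadow (FreeBicategory G)) (functor G)) (φ : LaxSh.ob y ⟶ LaxSh.ob z)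
      (e' : supportObj z = Lam.ofObj b), supp φ ≫ eqToHom e' = eqToHom e ≫ v)
    (fun a e => ⟨y, 𝟙 _, e, by rw [supp_id, Category.id_comp]; exact (Category.comp_id _).symm⟩) ?_
    (supportObj y).as w.as v rfl
  · obtain ⟨z, φ, e, h⟩ := key
    exact ⟨z, φ, e, h.trans (Category.id_comp _)⟩
  · intro a b c v g ih e
    obtain ⟨z, φ, e', h⟩ := ih e
    obtain ⟨z', ψ, e'', h'⟩ := exists_lift_gen g z e'
    refine ⟨z', φ ≫ ψ, e'', ?_⟩
    rw [supp_comp, Category.assoc, h', ← Category.assoc, h, Category.assoc]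
    rfl

end FreeLax

end

/-! ### Aperiodic lists -/

/-- Equal powers of the cycle in `Λ'` have congruent exponents, since the action on pairs of points
distinguishes rotations by less than a full turn. -/
theorem Aperiodic.modEq {X : Type u₂} {l : List X} (h : Aperiodic l) (h0 : 0 < l.length) {a b : ℕ}
    (hab : l.rotate a = l.rotate b) : a ≡ b [MOD l.length] := by
  have e := h.rot_eq hab
  rw [← Lam.rot_mod _ a, ← Lam.rot_mod _ b] at e
  exact (Lam.rot_comp_injective (Lam.acts_eqToHom rfl rfl) (Lam.acts_eqToHom rfl rfl)
    (Nat.mod_lt a h0) (Nat.mod_lt b h0) (congrArg (· ≫ eqToHom rfl) e)).1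

/-- Moving the first `k` positions to the end lowers every position by `k` modulo the length. -/
theorem FinBij.flip_modEq (k l n : ℕ) (hn : n = k + l) (i : Fin (k + l)) :
    ((FinBij.flip k l).toFun i).val + k ≡ i.val [MOD n] := by
  subst hn
  rw [FinBij.flip_val]
  split_ifs with h
  · rw [show l + i.val + k = i.val + (k + l) by omega]
    exact Nat.add_mod_right _ _
  · rw [Nat.sub_add_cancel (by omega)]

section

variable {G : Type u₁} [Quiver.{v₁} G]

/-- One number `c` describes both effects: the edge list is rotated by `c` and positions drop by `c`
modulo the length. This lets the edge lists control the permutation. -/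
theorem exists_rotate_shadowPermutation {x y : FreeSh (FreeBicategory G)} (φ : x ⟶ y) :
    ∃ c, shadowEdges y = (shadowEdges x).rotate c ∧
      ∀ i, (((shadowPermutation G).map φ).toFun i).val + c ≡ i.val [MOD (shadowEdges x).length] := by
  refine quotientPaths_induction (ShRel (B := FreeBicategory G))
    (fun a b φ => ∃ c, bicatEdges b.cell = (bicatEdges a.cell).rotate c ∧
      ∀ i, (((shadowPermutation G).map φ).toFun i).val + c ≡ i.val
        [MOD (bicatEdges a.cell).length])
    (fun a => ⟨0, by simp, fun i => ?_⟩) ?_ x.as y.as φ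
  · rw [(shadowPermutation G).map_id]
    rfl
  rintro a b c φ g ⟨n, hn, h⟩
  change ShGen b c at g
  have key : ∃ m, bicatEdges c.cell = (bicatEdges b.cell).rotate m ∧
      ∀ i, ((shadowPermutationMap g).toFun i).val + m ≡ i.val [MOD (bicatEdges b.cell).length] := by
    cases g with
    | sh η => exact ⟨0, (bicatEdges_eq η).symm.trans (List.rotate_zero _).symm, fun i => rfl⟩
    | rot f g =>
      refine ⟨bicatNum f, ?_, FinBij.flip_modEq _ _ _ (length_bicatEdges _)⟩
      rw [← length_bicatEdges]
      exact (List.rotate_append_length_eq (bicatEdges f) (bicatEdges g)).symm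
    | rotInv f g =>
      refine ⟨bicatNum g, ?_, FinBij.flip_modEq _ _ _ (length_bicatEdges _)⟩
      rw [← length_bicatEdges]
      exact (List.rotate_append_length_eq (bicatEdges g) (bicatEdges f)).symm
  obtain ⟨m, hm, h'⟩ := key
  refine ⟨n + m, by rw [hm, hn, List.rotate_rotate], fun i => ?_⟩
  have e : (shadowPermutation G).map (φ ≫ (Quotient.functor _).map ((Paths.of _).map g)) =
      (shadowPermutation G).map φ ≫ shadowPermutationMap g :=
    ((shadowPermutation G).map_comp _ _).trans (congrArg (_ ≫ ·) (shadowPermutation_gen g))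
  rw [e]
  have k := h' (((shadowPermutation G).map φ).toFun i)
  rw [hn, List.length_rotate] at k
  have k' := (k.add_right n).trans (h i)
  rw [Nat.add_assoc, Nat.add_comm m n] at k'
  exact k'

namespace FreeLax

theorem exists_rotate_permutation {x y : FreeLaxSh G} (φ : x ⟶ y) :
    ∃ c, listOf y = (listOf x).rotate c ∧
      ∀ i, (((permutation G).map φ).toFun i).val + c ≡ i.val [MOD (listOf x).length] := by
  refine quotientPaths_induction (LaxShRel (freeShadow (FreeBicategory G)) (functor G))
    (fun a b φ => ∃ c, objEdges b = (objEdges a).rotate c ∧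
      ∀ i, (((permutation G).map φ).toFun i).val + c ≡ i.val [MOD (objEdges a).length])
    (fun a => ⟨0, by simp, fun i => ?_⟩) ?_ x.as y.as φ
  · rw [(permutation G).map_id]
    rfl
  rintro a b c φ g ⟨n, hn, h⟩
  change LaxShGen _ _ b c at g
  have key : ∃ m, objEdges c = (objEdges b).rotate m ∧
      ∀ i, ((permutationMap g).toFun i).val + m ≡ i.val [MOD (objEdges b).length] := by
    cases g with
    | hmap ρ => exact exists_rotate_shadowPermutation ρ
    | sh η => exact ⟨0, (edges_eq η).symm.trans (List.rotate_zero _).symm, fun i => rfl⟩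
    | rot f g =>
      refine ⟨num f, ?_, FinBij.flip_modEq _ _ _ (length_edges _)⟩
      rw [← length_edges]
      exact (List.rotate_append_length_eq (edges f) (edges g)).symm
    | rotInv f g =>
      refine ⟨num g, ?_, FinBij.flip_modEq _ _ _ (length_edges _)⟩
      rw [← length_edges]
      exact (List.rotate_append_length_eq (edges g) (edges f)).symm
    | s f => exact ⟨0, (List.rotate_zero _).symm, fun i => rfl⟩
  obtain ⟨m, hm, h'⟩ := key
  refine ⟨n + m, by rw [hm, hn, List.rotate_rotate], fun i => ?_⟩
  have e : (permutation G).map (φ ≫ (Quotient.functor _).map ((Paths.of _).map g)) =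
      (permutation G).map φ ≫ permutationMap g :=
    ((permutation G).map_comp _ _).trans (congrArg (_ ≫ ·) (permutation_gen g))
  rw [e]
  have k := h' (((permutation G).map φ).toFun i)
  rw [hn, List.length_rotate] at k
  have k' := (k.add_right n).trans (h i)
  rw [Nat.add_assoc, Nat.add_comm m n] at k'
  exact k'

theorem card_permutation : ∀ x : LaxShObj (freeShadow (FreeBicategory G)) (functor G),
    (permutationObj x).card = (objEdges x).length
  | .out _ => (length_bicatEdges _).symm
  | .inn f => (length_edges f).symm

/-- Parallel morphisms between objects with aperiodic edges have the same underlying permutation. -/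
theorem permutation_eq_of_aperiodic {x y z : FreeLaxSh G} (hx : Aperiodic (listOf x)) {r : ℕ}
    (hr : (listOf x).rotate r = listOf y) (φ ψ : y ⟶ z) :
    (permutation G).map φ = (permutation G).map ψ := by
  obtain ⟨c, hc, h⟩ := exists_rotate_permutation φ
  obtain ⟨c', hc', h'⟩ := exists_rotate_permutation ψ
  have hy : ((permutation G).obj y).card = (listOf y).length := card_permutation y.as
  have hz : ((permutation G).obj z).card = (listOf y).length := by
    rw [← List.length_rotate (listOf y) c, ← hc]
    exact card_permutation z.as
  have hxy : (listOf x).length = (listOf y).length := by rw [← hr, List.length_rotate]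
  refine FinBij.hom_ext fun i => ?_
  have hi : i.val < (listOf y).length := hy ▸ i.isLt
  -- The two rotations give the same list when applied to the edges of `y`; translated back to the
  -- aperiodic list of `x` by `r`, they must agree modulo the length.
  have key := hx.modEq (by omega) (a := r + c) (b := r + c')
    (by rw [← List.rotate_rotate, ← List.rotate_rotate, hr, ← hc, ← hc'])
  rw [hxy] at key
  have k := ((h i).trans (h' i).symm).trans ((key.add_left_cancel' r).symm.add_left _)
  exact (k.add_right_cancel' c).eq_of_lt_of_lt (hz ▸ Fin.isLt _) (hz ▸ Fin.isLt _)

/-! ### Base vertices of objects without edges -/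

/-- The vertex at which an object of the free lax shadow category is based. -/
def base : LaxShObj (freeShadow (FreeBicategory G)) (functor G) → FreeBicategory G
  | .out x => ShObj.pt (show ShObj (FreeBicategory G) from x.as)
  | .inn (a := a) _ => a.pt

theorem pt_eq_of_edges_eq_nil {a b : FreeBicategory G} {V : a ⟶ b} (h : bicatEdges V = []) :
    a = b := by
  have := endpoint_bicatEdges V
  rw [h] at this
  exact this

/-- A rotator changes the base from the source of `f` to its target, but without edges the two
coincide. -/
theorem shadow_base_eq {x y : FreeSh (FreeBicategory G)} (φ : x ⟶ y) (h : shadowEdges x = []) :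
    ShObj.pt (show ShObj (FreeBicategory G) from x.as) =
      ShObj.pt (show ShObj (FreeBicategory G) from y.as) := by
  refine quotientPaths_induction (ShRel (B := FreeBicategory G))
    (fun a b φ => bicatEdges a.cell = [] → a.pt = b.pt) (fun a _ => rfl) ?_ x.as y.as φ h
  intro a b c φ g ih h
  refine (ih h).trans ?_
  obtain ⟨n, hn⟩ := exists_rotate φ
  have hb : bicatEdges b.cell = [] := hn.trans ((congrArg (List.rotate · n) h).trans (by simp))
  change ShGen b c at g
  cases g with
  | sh η => rfl
  | rot f g => exact pt_eq_of_edges_eq_nil (List.append_eq_nil_iff.mp hb).1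
  | rotInv f g => exact pt_eq_of_edges_eq_nil (List.append_eq_nil_iff.mp hb).1

theorem base_eq {x y : FreeLaxSh G} (φ : x ⟶ y) (h : listOf x = []) :
    base x.as = base y.as := by
  refine quotientPaths_induction (LaxShRel (freeShadow (FreeBicategory G)) (functor G))
    (fun a b φ => objEdges a = [] → base a = base b) (fun a _ => rfl) ?_ x.as y.as φ h
  intro a b c φ g ih h
  refine (ih h).trans ?_
  obtain ⟨n, hn, -⟩ := exists_support φ
  have hb : objEdges b = [] := hn.trans ((congrArg (List.rotate · n) h).trans (by simp))
  change LaxShGen _ _ b c at g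
  cases g with
  | hmap ρ => exact shadow_base_eq ρ hb
  | sh η => rfl
  | rot f g =>
    have : bicatEdges (content f) = [] :=
      (edges_content f).trans (List.append_eq_nil_iff.mp hb).1
    exact pt_eq_of_edges_eq_nil this
  | rotInv f g =>
    have : bicatEdges (content g) = [] :=
      (edges_content g).trans (List.append_eq_nil_iff.mp hb).1
    exact pt_eq_of_edges_eq_nil this
  | s f => rfl

/-- An empty edge list does not record its vertex, so for edgeless objects the vertex must be known
to be constant along the component. -/
theorem base_eq_of_zigzag {x y : FreeLaxSh G} (h : Zigzag x y) (hx : listOf x = []) :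
    base x.as = base y.as := by
  have key : listOf y = [] ∧ base x.as = base y.as := by
    induction h with
    | refl => exact ⟨hx, rfl⟩
    | tail _ h ih =>
      obtain ⟨h₁, h₂⟩ := ih
      rcases h with ⟨⟨φ⟩⟩ | ⟨⟨φ⟩⟩
      · obtain ⟨c, hc, -⟩ := exists_support φ
        exact ⟨by rw [hc, h₁, List.rotate_nil], h₂.trans (base_eq φ h₁)⟩
      · obtain ⟨c, hc, -⟩ := exists_support φ
        have h₃ := List.rotate_eq_nil_iff.mp (hc.symm.trans h₁)
        exact ⟨h₃, h₂.trans (base_eq φ h₃).symm⟩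
  exact key.2

end FreeLax

end

/-! ### Objects are determined by their edges and groups -/

/-- The index of the list containing the `i`-th element of the concatenation of a list of lists. -/
def groupIndex {X : Type u₂} : List (List X) → ℕ → ℕ
  | [], i => i
  | s :: S, i => if i < s.length then 0 else 1 + groupIndex S (i - s.length)

theorem groupIndex_append {X : Type u₂} (S T : List (List X)) (i : ℕ) :
    groupIndex (S ++ T) i =
      if i < S.flatten.length then groupIndex S i
      else S.length + groupIndex T (i - S.flatten.length) := by
  induction S generalizing i with
  | nil => simp
  | cons s S ih =>
    rw [List.cons_append, groupIndex, groupIndex, ih, List.flatten_cons, List.length_append,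
      List.length_cons, show i - (s.length + S.flatten.length) = i - s.length - S.flatten.length by omega]
    split_ifs <;> omega

/-- The first list ends at the first index whose group is not `0`, and the comparison continues with
the tail. Equality of lengths is needed separately, because trailing empty lists contain no index.
-/
theorem eq_of_groupIndex_eq {X : Type u₂} (S T : List (List X)) (hl : S.length = T.length)
    (hf : S.flatten = T.flatten)
    (h : ∀ i, i < S.flatten.length → groupIndex S i = groupIndex T i) : S = T := by
  induction S generalizing T with
  | nil => exact (List.length_eq_zero_iff.mp hl.symm).symm
  | cons s S ih =>
    cases T with
    | nil => simp at hl
    | cons t T =>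
      rw [List.flatten_cons, List.flatten_cons] at hf
      have hlen := congrArg List.length hf
      rw [List.length_append, List.length_append] at hlen
      simp only [List.flatten_cons, List.length_append, groupIndex] at h
      -- If one first list were shorter, the index just past its end would be in group `0` on one
      -- side only.
      have e : s.length = t.length := by
        rcases Nat.lt_trichotomy s.length t.length with k | k | k
        · have := h s.length (by omega)
          rw [if_neg (by omega), if_pos k] at this
          omega
        · exact k
        · have := h t.length (by omega)
          rw [if_pos k, if_neg (by omega)] at this
          omega
      obtain ⟨rfl, hf'⟩ := List.append_inj hf e
      rw [ih T (by simpa using hl) hf' fun i hi => ?_]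
      have := h (s.length + i) (by omega)
      rw [if_neg (by omega), if_neg (by omega), Nat.add_sub_cancel_left] at this
      omega

/-- The value beyond `n` continues the numbering after the single target point. It matches the
convention of `groupIndex` past the end, which is what lets `groups_pos` hold for every `i`. -/
theorem DExpr.fold_pos (n i : ℕ) : (fold n).pos i = if i < n then 0 else 1 + (i - n) := by
  induction n with
  | zero => simp [fold, pos]; omega
  | succ n ih =>
    simp only [fold, pos, ih]
    split_ifs <;> omega

section

variable {G : Type u₁} [Quiver.{v₁} G]

theorem pt_eq_of_bicatEdges_cons {e : Σ x y : G, x ⟶ y} : ∀ {a b : FreeBicategory G} (V : a ⟶ b)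
    {l : List (Σ x y : G, x ⟶ y)}, bicatEdges V = e :: l → a = (e.1 : FreeBicategory G)
  | _, _, .of f, l, h => congrArg (fun e : Σ x y : G, x ⟶ y => e.1) (List.cons.inj h).1
  | _, _, .id a, l, h => absurd h (List.cons_ne_nil _ _).symm
  | _, _, .comp f g, l, h => by
    cases hf : bicatEdges f with
    | nil =>
      refine (FreeLax.pt_eq_of_edges_eq_nil hf).trans (pt_eq_of_bicatEdges_cons g (l := l) ?_)
      exact (congrArg (· ++ bicatEdges g) hf).symm.trans h
    | cons e' l' =>
      refine (pt_eq_of_bicatEdges_cons f hf).trans ?_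
      have := (congrArg (· ++ bicatEdges g) hf).symm.trans h
      exact congrArg (fun e : Σ x y : G, x ⟶ y => e.1) (List.cons.inj this).1

/-- A nonempty edge list shows the starting vertex as the source of its first edge; the empty case
is supplied by `h0`. -/
theorem pt_eq_of_bicatEdges_eq {a b c d : FreeBicategory G} {V : a ⟶ b} {W : c ⟶ d}
    (h : bicatEdges V = bicatEdges W) (h0 : bicatEdges V = [] → a = c) : a = c := by
  cases hV : bicatEdges V with
  | nil => exact h0 hV
  | cons e l =>
    exact (pt_eq_of_bicatEdges_cons V hV).trans (pt_eq_of_bicatEdges_cons W (h.symm.trans hV)).symm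

namespace FreeLax

/-- Turns the structure map of a word into explicit data from which its shape can be rebuilt. -/
theorem groups_pos : ∀ {a b : FreeLax G} (f : a ⟶ b) (i : ℕ),
    (groups f).pos i = groupIndex (shape f) i
  | _, _, Hom.blk W, i => by
    refine (DExpr.fold_pos _ _).trans ?_
    refine Eq.trans ?_ (congrArg (groupIndex · i) (shape_block W)).symm
    rw [show num (Hom.blk W) = (bicatEdges W).length from (length_bicatEdges W).symm]
    rfl
  | _, _, Hom.id a, i => (congrArg (groupIndex · i) (shape_id a)).symm
  | _, _, Hom.comp f g, i => by
    refine Eq.trans ?_ (congrArg (groupIndex · i) (shape_comp f g)).symm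
    rw [groupIndex_append, flatten_shape, length_edges, length_shape]
    refine Eq.trans (b := if (if i < num f then (groups f).pos i else blocks f + (i - num f)) <
      blocks f then (if i < num f then (groups f).pos i else blocks f + (i - num f)) else
      blocks f + (groups g).pos ((if i < num f then (groups f).pos i else blocks f + (i - num f))
        - blocks f)) rfl ?_
    rw [← groups_pos f, ← groups_pos g]
    by_cases h : i < num f
    · have := (groups f).pos_lt i h
      simp [h, this]
    · simp [h]

theorem acts_objGroups {a : FreeLax G} (f : a ⟶ a) (N : ℕ) (h : N = (edges f).length) :
    Lam.Acts (n := N) (m := blocks f) (objGroups (.inn f) N h) (groupIndex (shape f))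
      (fun _ => 0) := by
  refine ((groups f).acts_real 0 0 N (blocks f) _ _).congr 0 (fun i hi => ?_)
  rw [length_edges] at h
  simp only [not_lt_zero, if_false, zero_add, Nat.sub_zero, add_zero, and_true,
    if_pos (show i < num f by omega), groups_pos]

/-- The grouping maps do not wind, so a rotation relating them is a multiple of a full turn. The two
words then have the same edges, grouped in the same way, hence the same shape and a canonical 2-cell
between them. -/
theorem exists_supp_eq_inn {a b : FreeLax G} (f : a ⟶ a) (g : b ⟶ b) (c : ℕ)
    (hl : edges g = (edges f).rotate c) (h0 : edges f = [] → a.pt = b.pt)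
    (e : blocks f = blocks g)
    (hg : ∀ N (h : N = (edges f).length) (h' : N = (edges g).length),
      (show Lam.fin N ⟶ Lam.fin (blocks f) from objGroups (.inn f) N h) ≫
        eqToHom (congrArg Lam.fin e) =
        Lam.rot N c ≫ (show Lam.fin N ⟶ Lam.fin (blocks g) from objGroups (.inn g) N h')) :
    ∃ ψ : LaxSh.ob (.inn f) ⟶ LaxSh.ob (.inn g), supp ψ = eqToHom (congrArg Lam.fin e) := by
  have hlen : (edges f).length = (edges g).length := by rw [hl, List.length_rotate]
  have key : edges f = edges g ∧ ∀ i, i < (edges f).length →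
      groupIndex (shape f) i = groupIndex (shape g) i := by
    rcases Nat.eq_zero_or_pos (edges f).length with hn | hn
    · have hf := List.length_eq_zero_iff.mp hn
      exact ⟨hf.trans (List.length_eq_zero_iff.mp (hlen.symm.trans hn)).symm, fun i hi => by omega⟩
    · have k := hg _ rfl hlen
      rw [← Lam.rot_mod] at k
      -- The left-hand side is read as carrying a rotation by `0`.
      have := Lam.rot_comp_injective (c := 0)
        (((acts_objGroups f _ rfl).comp (Lam.acts_eqToHom e _)).congr 0
          (f' := groupIndex (shape f)) (j' := fun _ => 0) (fun a _ => ⟨rfl, rfl⟩))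
        (acts_objGroups g _ hlen) hn (Nat.mod_lt c hn) ((Category.id_comp _).trans k)
      refine ⟨?_, this.2⟩
      rw [hl, ← List.rotate_mod, ← this.1, List.rotate_zero]
  have hs : shape f = shape g := by
    refine eq_of_groupIndex_eq _ _ ?_ ?_ ?_
    · rw [length_shape, length_shape, e]
    · rw [flatten_shape, flatten_shape, key.1]
    · rw [flatten_shape]
      exact key.2
  have hab : a.pt = b.pt := by
    refine pt_eq_of_bicatEdges_eq (V := content f) (W := content g) ?_ ?_
    · rw [edges_content, edges_content, key.1]
    · rw [edges_content]
      exact h0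
  obtain ⟨a⟩ := a
  obtain ⟨b⟩ := b
  obtain rfl : a = b := hab
  obtain ⟨k, hk⟩ := (isTrivial_can hs).onBlocks_eq
  exact ⟨LaxSh.gen (.sh (can f g hs)), (supp_gen (.sh (can f g hs))).trans hk⟩

/-- Cut `V` after `c` edges modulo the length, rotate the first part to the end, and finish with a
coherence 2-cell. -/
theorem nonempty_hom_of_rotate {a b : FreeBicategory G} (V : a ⟶ a) (W : b ⟶ b) (c : ℕ)
    (hl : bicatEdges W = (bicatEdges V).rotate c) (h0 : bicatEdges V = [] → a = b) :
    Nonempty (FreeSh.ob V ⟶ FreeSh.ob W) := by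
  obtain ⟨p, V₁, V₂, h₁, h₂⟩ := exists_bicat_split V _ _
    (List.take_append_drop (c % (bicatEdges V).length) (bicatEdges V)).symm
  have e : bicatEdges V = bicatEdges (V₁ ≫ V₂) := by
    refine Eq.trans ?_ (congrArg₂ (· ++ ·) h₁ h₂).symm
    exact (List.take_append_drop _ _).symm
  have e' : bicatEdges (V₂ ≫ V₁) = bicatEdges W := by
    refine (congrArg₂ (· ++ ·) h₂ h₁).trans ?_
    rw [hl, List.rotate_eq_drop_append_take_mod]
  -- With edges present, the first edge of the rotated list fixes the vertex; without edges, every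
  -- vertex in sight equals the base of `V`.
  obtain rfl : p = b := by
    refine pt_eq_of_bicatEdges_eq e' fun h => ?_
    have h' := List.append_eq_nil_iff.mp h
    exact (FreeLax.pt_eq_of_edges_eq_nil (V := V₁) h'.2).symm.trans
      (h0 (e.trans (List.append_eq_nil_iff.mpr h'.symm)))
  exact ⟨FreeSh.gen (.sh (bicatCan V (V₁ ≫ V₂) e)) ≫ FreeSh.gen (.rot V₁ V₂) ≫
    FreeSh.gen (.sh (bicatCan (V₂ ≫ V₁) W e'))⟩

/-- Objects with the same edges up to a rotation that is compatible with the maps to their symbols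
are connected by a morphism supported on an identity. -/
theorem exists_supp_eq (y z : LaxShObj (freeShadow (FreeBicategory G)) (functor G)) (c : ℕ)
    (hl : objEdges z = (objEdges y).rotate c) (h0 : objEdges y = [] → base y = base z)
    (e : supportObj y = supportObj z)
    (hg : ∀ N (h : N = (objEdges y).length) (h' : N = (objEdges z).length),
      objGroups y N h ≫ eqToHom e = Lam.rot N c ≫ objGroups z N h') :
    ∃ ψ : LaxSh.ob y ⟶ LaxSh.ob z, supp ψ = eqToHom e := by
  cases y with
  | out x =>
    cases z with
    | out x' =>
      obtain ⟨ρ⟩ := nonempty_hom_of_rotate (ShObj.cell (B := FreeBicategory G) x.as)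
        (ShObj.cell (B := FreeBicategory G) x'.as) c hl h0
      exact ⟨LaxSh.gen (.hmap ρ), supp_gen (.hmap ρ)⟩
    | inn g => exact absurd (Lam.ofObj_injective (x := .star) (y := .fin (blocks g)) e) nofun
  | inn f =>
    cases z with
    | out x => exact absurd (Lam.ofObj_injective (x := .fin (blocks f)) (y := .star) e) nofun
    | inn g =>
      have e' : blocks f = blocks g := LObj.fin.inj
        (Lam.ofObj_injective (x := .fin (blocks f)) (y := .fin (blocks g)) e)
      exact exists_supp_eq_inn f g c hl h0 e' hg

end FreeLax

end

/-! ### The supporting functor on a component is an equivalence -/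

theorem Lam.exists_rot_inv {X : Type u₂} (n r : ℕ) : ∃ r', Lam.rot n r' ≫ Lam.rot n r = 𝟙 _ ∧
    Lam.rot n r ≫ Lam.rot n r' = 𝟙 _ ∧
      ∀ l : List X, l.length = n → (l.rotate r).rotate r' = l := by
  rcases Nat.eq_zero_or_pos n with rfl | hn
  · have : ∀ c, Lam.rot 0 c = 𝟙 _ := by
      intro c
      induction c with
      | zero => rfl
      | succ c ih => simp [Lam.rot, Lam.cyc, ih]
    refine ⟨0, by simp [this], by simp [this], fun l hl => ?_⟩
    rw [List.length_eq_zero_iff.mp hl]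
    simp
  · have e : r + (n * r - r) = n * r := Nat.add_sub_cancel' (Nat.le_mul_of_pos_left r hn)
    refine ⟨n * r - r, ?_, ?_, fun l hl => ?_⟩
    · rw [← Lam.rot_add, Nat.add_comm, e, Lam.rot_mul]
    · rw [← Lam.rot_add, e, Lam.rot_mul]
    · rw [List.rotate_rotate, e, ← hl, List.rotate_length_mul]

section

variable {G : Type u₁} [Quiver.{v₁} G]

namespace FreeLax

/-- The word with one symbol for every edge of a 1-cell. -/
def singles : {a b : FreeBicategory G} → (a ⟶ b) → ((⟨a⟩ : FreeLax G) ⟶ ⟨b⟩)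
  | _, _, .of e => block (.of e)
  | _, _, .id a => 𝟙 (⟨a⟩ : FreeLax G)
  | _, _, .comp V W => singles V ≫ singles W

theorem edges_singles : ∀ {a b : FreeBicategory G} (V : a ⟶ b),
    edges (singles V) = bicatEdges V
  | _, _, .of e => rfl
  | _, _, .id a => rfl
  | _, _, .comp V W => congrArg₂ (· ++ ·) (edges_singles V) (edges_singles W)

/-- Each group holds exactly one edge, so the structure map is an identity up to a cast. -/
theorem groups_singles_real : ∀ {a b : FreeBicategory G} (V : a ⟶ b) (p q N M : ℕ)
    (hN : N = p + num (singles V) + q) (hM : M = p + blocks (singles V) + q),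
    ∃ h : Lam.fin N = Lam.fin M, (groups (singles V)).real p q N M hN hM = eqToHom h
  | _, _, .of e, p, q, N, M, hN, hM => ⟨_, fold_one_real p q N M hN hM⟩
  | _, _, .id a, p, q, N, M, hN, hM => ⟨_, rfl⟩
  | _, _, .comp V W, p, q, N, M, hN, hM => by
    have e := groups_comp_real (singles V) (singles W) p q N
      (p + blocks (singles V) + num (singles W) + q) M hN rfl hM
    obtain ⟨h₁, e₁⟩ := groups_singles_real V p (num (singles W) + q) N
      (p + blocks (singles V) + num (singles W) + q)
      (by rw [hN]; change p + (num (singles V) + num (singles W)) + q = _; omega) (by omega)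
    obtain ⟨h₂, e₂⟩ := groups_singles_real W (p + blocks (singles V)) q
      (p + blocks (singles V) + num (singles W) + q) M rfl
      (by rw [hM]; change p + (blocks (singles V) + blocks (singles W)) + q = _; omega)
    exact ⟨h₁.trans h₂, e.trans ((congrArg₂ (· ≫ ·) e₁ e₂).trans (eqToHom_trans _ _))⟩

/-- Start from the finest grouping and multiply together the edges of each symbol; an edgeless
symbol arises from a unit insertion. -/
theorem nonempty_singles_hom : ∀ {a b : FreeLax G} (f : a ⟶ b),
    Nonempty (singles (content f) ⟶ f)
  | _, _, Hom.blk W => ⟨fold (singles W) ≫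
      blockMap (bicatCan _ W ((edges_content _).trans (edges_singles W)))⟩
  | _, _, Hom.id a => ⟨𝟙 (𝟙 a)⟩
  | _, _, Hom.comp f g => by
    obtain ⟨η⟩ := nonempty_singles_hom f
    obtain ⟨θ⟩ := nonempty_singles_hom g
    exact ⟨hcomp η θ⟩

theorem exists_singles_hom (y : LaxShObj (freeShadow (FreeBicategory G)) (functor G)) :
    ∃ (a : FreeBicategory G) (V : a ⟶ a), Nonempty (LaxSh.ob (.inn (singles V)) ⟶ LaxSh.ob y) := by
  cases y with
  | out x =>
    let V := ShObj.cell (B := FreeBicategory G) x.as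
    let ρ : ((freeShadow (FreeBicategory G)).sh _).obj (content (singles V)) ⟶ x :=
      FreeSh.gen (.sh (bicatCan _ V ((edges_content _).trans (edges_singles V))))
    exact ⟨_, V, ⟨collapse (singles V) ≫ (freeLaxShadowFunctor G).H.map ρ⟩⟩
  | inn f =>
    obtain ⟨η⟩ := nonempty_singles_hom f
    exact ⟨_, content f, ⟨LaxSh.gen (.sh η)⟩⟩

/-! ### Faithfulness, fullness and essential surjectivity -/

section

variable {x : FreeLaxSh G}

/-- A target of a morphism out of the component of `x`, as an object of the component. -/
def ofHom (y : (CategoryTheory.ConnectedComponents.mk x).Component) {z : FreeLaxSh G}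
    (φ : y.obj ⟶ z) : (CategoryTheory.ConnectedComponents.mk x).Component :=
  ⟨z, (Quotient.sound (Zigzag.symm (Zigzag.of_hom φ))).trans y.property⟩

theorem componentSupport_w (hx : Aperiodic (listOf x))
    {y z : (CategoryTheory.ConnectedComponents.mk x).Component} (φ : y.obj ⟶ z.obj) :
    ((componentSupport x hx).obj y).hom ≫ (support G).map φ =
      ((componentSupport x hx).obj z).hom :=
  Under.w ((componentSupport x hx).map (ObjectProperty.homMk φ))

/-- Supports agree by assumption, and permutations agree because aperiodic edges leave only one
possible rotation. -/
theorem componentSupport_faithful (hx : Aperiodic (listOf x)) :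
    (componentSupport x hx).Faithful where
  map_injective {y z} φ ψ h := by
    refine ObjectProperty.hom_ext _ (hom_ext_support_permutation _ _ ?_ ?_)
    · exact congrArg (fun u : (componentSupport x hx).obj y ⟶ (componentSupport x hx).obj z =>
        u.right) h
    · exact permutation_eq_of_aperiodic hx (exists_rotation_component y).choose_spec _ _

/-- The structure maps start with the chosen rotations from `x`. Undoing the one of `y` turns their
equality into compatibility of the groupings of `y` and `z` up to a rotation, as `exists_supp_eq`
demands. -/
theorem exists_supp_eq_component (hx : Aperiodic (listOf x))
    (y z : (CategoryTheory.ConnectedComponents.mk x).Component)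
    (e : (support G).obj y.obj = (support G).obj z.obj)
    (h : ((componentSupport x hx).obj y).hom ≫ eqToHom e = ((componentSupport x hx).obj z).hom) :
    ∃ ψ : y.obj ⟶ z.obj, (support G).map ψ = eqToHom e := by
  have hy := (exists_rotation_component y).choose_spec
  have hz := (exists_rotation_component z).choose_spec
  obtain ⟨r', h₁, -, h₂⟩ := Lam.exists_rot_inv (X := Σ a b : G, a ⟶ b) (listOf x).length
    (exists_rotation_component y).choose
  have h₂ := h₂ (listOf x) rfl
  rw [hy] at h₂
  refine exists_supp_eq y.obj.as z.obj.as (r' + (exists_rotation_component z).choose) ?_ ?_ e ?_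
  · refine Eq.trans ?_ (List.rotate_rotate (listOf y.obj) _ _)
    rw [h₂]
    exact hz.symm
  · exact base_eq_of_zigzag (Quotient.exact (y.property.trans z.property.symm))
  · intro N hN hN'
    obtain rfl : N = (listOf x).length := by
      rw [hN, ← List.length_rotate (listOf x), hy]
      rfl
    have k := congrArg (Lam.rot _ r' ≫ ·) h
    have k₁ : Lam.rot (listOf x).length r' ≫ ((componentSupport x hx).obj y).hom ≫ eqToHom e =
        groupsOf y.obj _ hN ≫ eqToHom e := by
      change Lam.rot _ r' ≫ (Lam.rot _ _ ≫ groupsOf y.obj _ _) ≫ eqToHom e = _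
      rw [Category.assoc, ← Category.assoc, h₁, Category.id_comp]
    refine k₁.symm.trans (k.trans ?_)
    rw [Lam.rot_add]
    exact (Category.assoc _ _ _).symm

theorem exists_support_lift (y : FreeLaxSh G) (w : Lam) (v : (support G).obj y ⟶ w) :
    ∃ (z : FreeLaxSh G) (φ : y ⟶ z) (e : (support G).obj z = w),
      (support G).map φ ≫ eqToHom e = v := by
  obtain ⟨z, φ, e, h⟩ := exists_lift y.as w v
  exact ⟨LaxSh.ob z, φ, e, h⟩

theorem componentSupport_full (hx : Aperiodic (listOf x)) : (componentSupport x hx).Full where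
  map_surjective {y z} v := by
    obtain ⟨z', φ, e, h⟩ := exists_support_lift y.obj ((support G).obj z.obj) v.right
    -- The target of the lift need not be `z`, but it lies in the component and has the same
    -- structure map, so an identity-supported morphism corrects it.
    obtain ⟨ψ, hψ⟩ := exists_supp_eq_component hx (ofHom y φ) z e (by
      refine (congrArg (· ≫ eqToHom e) (componentSupport_w hx (z := ofHom y φ) φ).symm).trans ?_
      exact (Category.assoc _ _ _).trans ((congrArg (_ ≫ ·) h).trans (Under.w v)))
    refine ⟨ObjectProperty.homMk (φ ≫ ψ), Under.UnderMorphism.ext ?_⟩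
    exact ((support G).map_comp φ ψ).trans ((congrArg (_ ≫ ·) hψ).trans h)

/-- The word with one symbol per edge lies in the component. Its structure map is a rotation
followed by a cast, so the opposite rotation provides `k`. -/
theorem exists_comp_eq_id (hx : Aperiodic (listOf x)) :
    ∃ y : (CategoryTheory.ConnectedComponents.mk x).Component,
      ∃ k : (support G).obj y.obj ⟶ Lam.fin (listOf x).length,
        ((componentSupport x hx).obj y).hom ≫ k = 𝟙 (Lam.fin (listOf x).length) := by
  obtain ⟨a, V, ⟨φ⟩⟩ := exists_singles_hom x.as
  let y : (CategoryTheory.ConnectedComponents.mk x).Component :=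
    ⟨LaxSh.ob (.inn (singles V)), Quotient.sound (Zigzag.of_hom φ)⟩
  have hy := (exists_rotation_component y).choose_spec
  obtain ⟨r', -, h₁, -⟩ := Lam.exists_rot_inv (X := PUnit.{1}) (listOf x).length
    (exists_rotation_component y).choose
  have hN : (listOf x).length = (edges (singles V)).length := by
    rw [← List.length_rotate (listOf x), hy]
    rfl
  rw [length_edges] at hN
  obtain ⟨h, e⟩ := groups_singles_real V 0 0 (listOf x).length (blocks (singles V))
    (by omega) (by omega)
  refine ⟨y, eqToHom h.symm ≫ Lam.rot _ r', ?_⟩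
  have k : ((componentSupport x hx).obj y).hom =
      Lam.rot (listOf x).length (exists_rotation_component y).choose ≫ eqToHom h :=
    congrArg (_ ≫ ·) e
  refine (congrArg (· ≫ eqToHom h.symm ≫ Lam.rot _ r') k).trans ?_
  rw [Category.assoc, eqToHom_trans_assoc, eqToHom_refl, Category.id_comp, h₁]

theorem componentSupport_essSurj (hx : Aperiodic (listOf x)) :
    (componentSupport x hx).EssSurj where
  mem_essImage u := by
    obtain ⟨y, k, hk⟩ := exists_comp_eq_id hx
    -- After the structure map of `y`, the factor `k` cancels, so the target of the lift has
    -- structure map `u.hom` up to the cast `e`.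
    obtain ⟨z, φ, e, h⟩ := exists_support_lift y.obj u.right (k ≫ u.hom)
    refine ⟨ofHom y φ, ⟨Under.isoMk (eqToIso e) ?_⟩⟩
    refine (congrArg (· ≫ eqToHom e) (componentSupport_w hx (z := ofHom y φ) φ).symm).trans ?_
    refine (Category.assoc _ _ _).trans ((congrArg (_ ≫ ·) h).trans ?_)
    exact (Category.assoc _ _ _).symm.trans ((congrArg (· ≫ u.hom) hk).trans (Category.id_comp _))

theorem componentSupport_isEquivalence (hx : Aperiodic (listOf x)) :
    (componentSupport x hx).IsEquivalence where
  faithful := componentSupport_faithful hx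
  full := componentSupport_full hx
  essSurj := componentSupport_essSurj hx

end

end FreeLax

end

end LaxShadow

theorem mainTheorem2 :
    (∀ (C : Type u₁) [Bicategory.{w₁, v₁} C] (C' : Type u₂) [Category.{v₂} C']
      (S : LaxShadow.Shadow C C') (D : Type u₃) [Bicategory.{w₂, v₃} D] (D' : Type u₄)
      [Category.{v₄} D'] (T : LaxShadow.Shadow D D') (Φ : LaxShadow.LaxShadowFunctor S T)
      (J : Type u₅) [Quiver.{v₅} J] (X : J ⥤q D'), Φ.IsBlackTie X → LaxShadow.Commutes X) ∧
    (∀ (C : Type u₁) [Bicategory.{w₁, v₁} C] (C' : Type u₂) [Category.{v₂} C']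
      (S : LaxShadow.Shadow C C') (D : Type u₃) [Bicategory.{w₂, v₃} D] (D' : Type u₄)
      [Category.{v₄} D'] (T : LaxShadow.Shadow D D') (Φ : LaxShadow.OplaxShadowFunctor S T)
      (J : Type u₅) [Quiver.{v₅} J] (X : J ⥤q D'), Φ.IsBlackTie X → LaxShadow.Commutes X) ∧
    (∀ (G : Type u₁) [Quiver.{v₁} G] (x : LaxShadow.FreeLaxSh G)
      (hx : LaxShadow.Aperiodic (LaxShadow.FreeLax.listOf x)),
      (LaxShadow.componentSupport x hx).IsEquivalence) :=
  ⟨fun _ _ _ _ _ _ _ _ _ _ _ _ _ _ h => h.commutes,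
    fun _ _ _ _ _ _ _ _ _ _ _ _ _ _ h => h.commutes,
    fun _ _ _ hx => LaxShadow.FreeLax.componentSupport_isEquivalence hx⟩
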